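/- **Conventions.** For a Coxeter system $(W,S)$ and $J\subseteq S$ let $W^J=\{w\in W:\ell(ws)>\ell(w)\text{ for all }s\in J\}$ be the set of minimal length representatives of the cosets $wW_J$, and let $\le$ be the Bruhat order. The relative $R$-polynomials $R^J_{u,v}(q)\in\mathbb Z[q]$ ($u,v\in W^J$) are Deodhar's parabolic $R$-polynomials of type $x=-1$, i.e. the unique family with $R^J_{u,v}=0$ if $u\not\le v$, $R^J_{u,u}=1$, and, if $u<v$, $s\in S$ and $\ell(sv)<\ell(v)$, $$R^J_{u,v}=\begin{cases}R^J_{su,sv}&\text{if }su<u,\\ q\,R^J_{u,sv}&\text{if }u<su\notin W^J,\\ (q-1)R^J_{u,sv}+q\,R^J_{su,sv}&\text{if }u<su\in W^J.\end{cases}$$ A *Hermitian quotient* $W^J$ is one of the following, with $J=S\setminus\{s_k\}$ and the Bourbaki numbering $s_1,\dots,s_n$ of $S$. To it belongs a labelled diagram, a finite set of boxes in the grid, with rows $i\ge1$ counted downwards and columns $j\ge1$ counted to the right, each box labelled by a simple reflection (we write $m$ for $s_m$): * $A_n/(A_{p-1}\times A_{n-p})$, $1\le p\le n$, $k=p$: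 boxes $1\le i\le n+1-p$, $1\le j\le p$, with label $p+i-j$. * $B_n/B_{n-1}$, $n\ge2$, $k=1$: row $1$ has labels $1,\dots,n$ in columns $1,\dots,n$; below its last box, in column $n$, are the labels $n-1,n-2,\dots,1$. * $C_n/A_{n-1}$, $n\ge2$, $k=n$: boxes $1\le i\le j\le n$, with label $n-(j-i)$. * $D_n/A_{n-1}$, $n\ge3$, $k=n$: boxes $1\le i\le j\le n-1$, with label $n-1-(j-i)$ if $i<j$, label $n$ if $i=j$ is odd, and label $n-1$ if $i=j$ is even. * $D_n/D_{n-1}$, $n\ge3$, $k=1$: row $1$ has labels $1,2,\dots,n-2,n$ in columns $1,\dots,n-1$; row $2$ has labels $n-1,n-2$ in columns $n-2,n-1$; below, in column $n-1$, are the labels $n-3,n-4,\dots,1$. * $E_6/D_5$, $k=1$: rows (first column : labels) $1:1\,3\,4\,5\,6$; $\;3:2\,4\,5$; $\;4:3\,4\,2$; $\;4:1\,3\,4\,5\,6$. * $E_7/E_6$, $k=7$: rows $1:7\,6\,5\,4\,3\,1$; $\;4:2\,4\,3$; $\;5:5\,4\,2$; $\;5:6\,5\,4\,3\,1$; $\;5:7\,6\,5\,4\,3$;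 $\;8:2\,4$; $\;9:5$; $\;9:6$; $\;9:7$. A *subdiagram* is a set $D$ of boxes of the diagram that contains with a box $b$ all boxes of the diagram weakly above and weakly left of $b$. It is the diagram of $w\in W^J$ if $w=(s_{c_1}s_{c_2}\cdots s_{c_r})^{-1}$, where $c_1,\dots,c_r$ are the labels of $D$ read row by row from top to bottom, each row from left to right. If $u<v$ in $W^J$ have diagrams $M$ and $\Lambda$, then $\Lambda\setminus M$ is called a *skew diagram of type $W^J$*, and $R^J_{u,v}$ is its relative $R$-polynomial. Two finite sets of boxes have the *same shape* if they agree, without their labels, up to a translation of the grid. A set of boxes is *standard skew* if it has the same shape as $\lambda\setminus\mu$ for some ordinary (top and left justified) Young diagrams $\mu\subseteq\lambda$. **Proposition.** Let $W^J$ be a Hermitian quotient, let $u<v$ in $W^J$ have diagrams $M$ and $\Lambda$, and suppose that the skew diagram $\Lambda\setminus M$ is standard skew. Then: 1. $\Lambda\setminus M$ can be identified with a skew diagram of type $A$: there are $1\le p\le n$ and $u'<v'$ in the quotient $A_n/(A_{p-1}\times A_{n-p})$, with diagrams $M'$ and $\Lambda'$, such that $\Lambda'\setminus M'$ has the same shape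 as $\Lambda\setminus M$. 2. For all $1\le p\le n$ and all $u'<v'$ in $(W')^{J'}=A_n/(A_{p-1}\times A_{n-p})$ with diagrams $M'$, $\Lambda'$ such that $\Lambda'\setminus M'$ has the same shape as $\Lambda\setminus M$, $$R^J_{u,v}(q)=R^{J'}_{u',v'}(q).$$ -/

import Mathlib

open Polynomial

namespace HermitianSkew

/-! ### Bruhat order, parabolic quotients and relative `R`-polynomials -/

section Coxeter

variable {B W : Type*} [Group W] {M : CoxeterMatrix B} (cs : CoxeterSystem M W)

/-- The strong Bruhat order: the reflexive transitive closure of `u → t * u`, where `t` is a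
reflection and the length increases. -/
def BruhatLE (u v : W) : Prop :=
  Relation.ReflTransGen
    (fun a b => cs.length a < cs.length b ∧ ∃ t, cs.IsReflection t ∧ t * a = b) u v

/-- The strict Bruhat order. -/
def BruhatLT (u v : W) : Prop := BruhatLE cs u v ∧ u ≠ v

/-- The quotient `W^J`, as the set of minimal length representatives of the cosets `w W_J`. -/
def minReps (J : Set B) : Set W :=
  {w | ∀ j ∈ J, cs.length w < cs.length (w * cs.simple j)}

open Classical in
/-- The relative (parabolic) `R`-polynomial `R^{J,x}_{u,v}(q)` of type `x = -1`, computed by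
Deodhar's recursion along a left descent of `v`; the variable `X` is `q`. It is a theorem of
Deodhar that for `u, v ∈ W^J` the result does not depend on the left descents used. -/
noncomputable def relR (J : Set B) (u v : W) : ℤ[X] :=
  if ¬ BruhatLE cs u v then 0
  else if u = v then 1
  else if h : ∃ i, cs.IsLeftDescent v i then
    let s := cs.simple h.choose
    if cs.length (s * u) < cs.length u then relR J (s * u) (s * v)
    else if s * u ∈ minReps cs J then
      (X - 1) * relR J u (s * v) + X * relR J (s * u) (s * v)
    else (X - 1 - (-1)) * relR J u (s * v)
  else 0
termination_by cs.length v
decreasing_by all_goals exact h.choose_spec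

end Coxeter

/-! ### Hermitian quotients and their labelled diagrams -/

/-- Adjacency in the Dynkin diagram of type `D_n` with nodes `0, …, n - 1`: the nodes
`0, …, n - 2` form a path and the node `n - 1` is joined to the node `n - 3`. -/
def dAdj (n i j : ℕ) : Prop := (i + 1 = j ∧ j + 1 < n) ∨ (i + 2 = j ∧ j + 1 = n)

instance (n i j : ℕ) : Decidable (dAdj n i j) := by unfold dAdj; infer_instance

/-- The Coxeter matrix of type `D_n`, in the Bourbaki ordering of the nodes.
(`CoxeterMatrix.D` also joins the nodes `n - 2` and `n - 1` and so is not of type `D_n`.) -/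
def typeD (n : ℕ) : CoxeterMatrix (Fin n) where
  M := Matrix.of fun i j : Fin n =>
    if i = j then 1 else if dAdj n i j ∨ dAdj n j i then 3 else 2
  isSymm := by
    ext i j
    simp only [Matrix.transpose_apply, Matrix.of_apply, eq_comm (a := j), or_comm (a := dAdj n j i)]
  diagonal := by simp
  off_diagonal := by
    intro i j h
    simp only [Matrix.of_apply, if_neg h]
    split_ifs <;> decide

/-- The Hermitian symmetric quotients `W^J`, where `J` consists of all nodes but one. -/
inductive HermitianType : Type
  /-- `A_n / (A_{p-1} × A_{n-p})` -/
  | A (n p : ℕ) (hp : 1 ≤ p) (hpn : p ≤ n)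
  /-- `B_n / B_{n-1}` -/
  | B (n : ℕ) (hn : 2 ≤ n)
  /-- `C_n / A_{n-1}` -/
  | C (n : ℕ) (hn : 2 ≤ n)
  /-- `D_n / A_{n-1}` -/
  | DA (n : ℕ) (hn : 3 ≤ n)
  /-- `D_n / D_{n-1}` -/
  | DD (n : ℕ) (hn : 3 ≤ n)
  /-- `E_6 / D_5` -/
  | E6
  /-- `E_7 / E_6` -/
  | E7

namespace HermitianType

/-- The rank of `W`. -/
def rank : HermitianType → ℕ
  | A n _ _ _ => n
  | B n _ => n
  | C n _ => n
  | DA n _ => n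
  | DD n _ => n
  | E6 => 6
  | E7 => 7

theorem rank_pos (t : HermitianType) : 0 < t.rank := by
  cases t <;> simp only [rank] <;> omega

/-- The Coxeter matrix of `W`, with nodes in the Bourbaki ordering: the simple reflection `s_k` is
the one at the index `k - 1`. Types `B_n` and `C_n` have the same Coxeter matrix. -/
def coxeterMatrix : (t : HermitianType) → CoxeterMatrix (Fin t.rank)
  | A n _ _ _ => CoxeterMatrix.A n
  | B n _ => CoxeterMatrix.B n
  | C n _ => CoxeterMatrix.B n
  | DA n _ => typeD n
  | DD n _ => typeD n
  | E6 => CoxeterMatrix.E₆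
  | E7 => CoxeterMatrix.E₇

/-- The number `k` such that `J` consists of all simple reflections but `s_k`. -/
def node : HermitianType → ℕ
  | A _ p _ _ => p
  | B _ _ => 1
  | C n _ => n
  | DA n _ => n
  | DD _ _ => 1
  | E6 => 1
  | E7 => 7

/-- The set `J` of simple reflections. -/
def J (t : HermitianType) : Set (Fin t.rank) := {i | (i : ℕ) + 1 ≠ t.node}

/-- A diagram given by its rows: each row is given by the number of empty positions to its left
and the list of its labels. The value `0` stands for the absence of a box. -/
def ofRows (rows : List (ℕ × List ℕ)) (b : ℕ × ℕ) : ℕ :=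
  let row := rows.getD b.1 (0, [])
  if b.2 < row.1 then 0 else row.2.getD (b.2 - row.1) 0

/-- The labelled diagram of the Hermitian quotient: `t.entry (i, j)` is the label `k` (standing for
`s_k`) of the box in row `i` and column `j`, both counted from `0`, and it is `0` if there is no box
in this position. -/
def entry : HermitianType → ℕ × ℕ → ℕ
  | A n p _ _, (i, j) => if i < n + 1 - p ∧ j < p then p + i - j else 0
  | B n _, (i, j) =>
      if i = 0 ∧ j < n then j + 1
      else if i < n ∧ j = n - 1 then n - i
      else 0
  | C n _, (i, j) => if i ≤ j ∧ j < n then n - (j - i) else 0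
  | DA n _, (i, j) =>
      if i = j ∧ j < n - 1 then (if Even i then n else n - 1)
      else if i < j ∧ j < n - 1 then n - 1 - (j - i)
      else 0
  | DD n _, (i, j) =>
      if i = 0 ∧ j < n - 2 then j + 1
      else if i = 0 ∧ j = n - 2 then n
      else if i = 1 ∧ j = n - 3 then n - 1
      else if i < n - 1 ∧ j = n - 2 then n - 1 - i
      else 0
  | E6, b => ofRows [(0, [1, 3, 4, 5, 6]), (2, [2, 4, 5]), (3, [3, 4, 2]), (3, [1, 3, 4, 5, 6])] b
  | E7, b => ofRows [(0, [7, 6, 5, 4, 3, 1]), (3, [2, 4, 3]), (4, [5, 4, 2]), (4, [6, 5, 4, 3, 1]),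
      (4, [7, 6, 5, 4, 3]), (7, [2, 4]), (8, [5]), (8, [6]), (8, [7])] b

/-- The index of the simple reflection labelling a box. The reduction modulo the rank is the
identity on boxes, since their labels lie between `1` and the rank. -/
def label (t : HermitianType) (b : ℕ × ℕ) : Fin t.rank :=
  ⟨(t.entry b - 1) % t.rank, Nat.mod_lt _ t.rank_pos⟩

/-- A subdiagram: a finite set of boxes that contains, with a box `b`, every box of the diagram
that is located (weakly) above and left of `b`. -/
def IsSubdiagram (t : HermitianType) (D : Finset (ℕ × ℕ)) : Prop :=
  (∀ b ∈ D, t.entry b ≠ 0) ∧ ∀ b ∈ D, ∀ c, t.entry c ≠ 0 → c ≤ b → c ∈ D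

/-- The labels of a set of boxes, read row by row from top to bottom and in each row from left to
right. -/
def readingWord (t : HermitianType) (D : Finset (ℕ × ℕ)) : List (Fin t.rank) :=
  ((D.map (toLex : ℕ × ℕ ≃ ℕ ×ₗ ℕ).toEmbedding).sort (· ≤ ·)).map fun b => t.label (ofLex b)

variable {W : Type*} [Group W]

/-- `D` is the diagram of `w`: it is a subdiagram, and `w` is the inverse of the product of the
simple reflections in its reading word. -/
def IsDiagramOf (t : HermitianType) (cs : CoxeterSystem t.coxeterMatrix W)
    (D : Finset (ℕ × ℕ)) (w : W) : Prop :=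
  t.IsSubdiagram D ∧ w = (cs.wordProd (t.readingWord D))⁻¹

/-- `L \ M` is a skew diagram of type `W^J`: there are `u < v` in `W^J` (the given ones) such that
`M` is the diagram of `u` and `L` is the diagram of `v`. -/
structure IsSkewDiagram (t : HermitianType) (cs : CoxeterSystem t.coxeterMatrix W)
    (u v : W) (M L : Finset (ℕ × ℕ)) : Prop where
  left_mem : u ∈ minReps cs t.J
  right_mem : v ∈ minReps cs t.J
  lt : BruhatLT cs u v
  left_diagram : t.IsDiagramOf cs M u
  right_diagram : t.IsDiagramOf cs L v

end HermitianType

/-! ### Shapes -/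

/-- Two finite sets of boxes have the same shape if they agree up to a translation of the grid. -/
def SameShape (S T : Finset (ℕ × ℕ)) : Prop :=
  ∃ a b : ℕ × ℕ, S.image (· + a) = T.image (· + b)

/-- A set of boxes is standard skew if it has the shape of a difference `l \ m` of two Young
diagrams (finite, top and left justified, with weakly decreasing rows) with `m ⊆ l`. -/
def IsStandardSkew (S : Finset (ℕ × ℕ)) : Prop :=
  ∃ l m : YoungDiagram, m ≤ l ∧ SameShape S (l.cells \ m.cells)

end HermitianSkew

/-! The quotient W^J is realised as the orbit of a minuscule weight: the coset of w goes to w(ω_k) =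
ω_k - ∑ c_i α_i and is recorded by the vector c. The orbit is in turn the set of order ideals of the
labelled diagram, with c_i the number of boxes of label i. The pairing of the weight with a simple
coroot is 1, -1 or 0, and the reflection accordingly adds a box, removes a box or fixes the weight.
These are the three cases of Deodhar's recursion. Length becomes the number of boxes, and the Bruhat
order on W^J becomes inclusion of ideals.

For fixed v, collect the polynomials R_{u,v} into one vector f_v indexed by u. The recursion applies
an operator `rOp s` to f_{sv}. These operators satisfy the braid relations, and those of J multiply
the initial vector by q. Hence f_v does not depend on the descents chosen, and moreover `rOp s`
multiplies f_v by q whenever s fixes the weight of v (`IsRVector.fixed`). The second fact is not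
part of the recursion; it allows a box to be moved from the skew shape into the lower ideal
(`relRIdeal_insert`).

A standard skew shape S is convex for the product order on boxes. Therefore S contains the rectangle
spanned by the first box of its first row and the last box of its last column. Let its sides be k +
1 rows and l + 1 columns. Labels are constant along diagonals inside S, which gives three rules. If
k < l, the label of the last box fixes the lower ideal, and R(S) = q R(S minus the last box). If k >
l, the label of the first box fixes the upper ideal, and R(S) = q R(S minus the first box). If k =
l, both boxes have the same label, and R(S) = (q - 1) R(S minus the last box) + q R(S minus both),
where the last term is 0 if the two boxes coincide. The rules mention only the shape, so induction
on the number of boxes (`relRIdeal_eq_of_shape`) proves the equality of polynomials. For the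
existence in type A, the lower closure of S and its difference with S are ideals in a large enough
square.

What remains is to see that each Hermitian diagram is a heap with the required properties
(`diagramHeap`): by finite computation for E_6 and E_7, and by local conditions on rows, columns and
repeated labels in the classical types. -/

namespace HermitianSkew

/-! ### The strong exchange property -/

section Exchange

variable {B W : Type*} [Group W] {M : CoxeterMatrix B} (cs : CoxeterSystem M W)

open Classical in
/-- The action of a simple reflection on pairs of a group element and a sign. -/
noncomputable def signedConj (i : B) : Function.End (W × ZMod 2) := fun x =>
  (cs.simple i * x.1 * cs.simple i, x.2 + if x.1 = cs.simple i then 1 else 0)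

-- The sign changes each time the conjugated element meets the acting simple reflection. Pulled back
-- to the start, these events are equalities with the reflections of the dihedral subgroup, listed
-- in order.
open Classical in
theorem signedConj_mul_pow (i j : B) (m : ℕ) (x : W × ZMod 2) :
    ((signedConj cs i * signedConj cs j) ^ m) x =
      ((cs.simple i * cs.simple j) ^ m * x.1 * ((cs.simple i * cs.simple j) ^ m)⁻¹,
        x.2 + ∑ k ∈ Finset.range (2 * m),
          if x.1 = ((cs.simple i * cs.simple j)⁻¹) ^ k * cs.simple j then 1 else 0) := by
  induction m with
  | zero => simp; rfl
  | succ m ih =>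
    rw [pow_succ' (signedConj cs i * signedConj cs j)]
    change signedConj cs i (signedConj cs j (((signedConj cs i * signedConj cs j) ^ m) x)) = _
    rw [ih]
    set g := cs.simple i * cs.simple j with hg
    have hj : ∀ k : ℕ, cs.simple j * g ^ k = (g⁻¹) ^ k * cs.simple j := by
      intro k
      have h : SemiconjBy (cs.simple j) g g⁻¹ := by simp [SemiconjBy, hg, mul_assoc]
      exact h.pow_right k
    -- The next factor of the product contributes two letters; `h1` and `h2` identify their events
    -- with the summands at 2m and 2m + 1.
    have h1 : ∀ t : W, g ^ m * t * (g ^ m)⁻¹ = cs.simple j ↔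
        t = (g⁻¹) ^ (2 * m) * cs.simple j := by
      intro t
      rw [mul_inv_eq_iff_eq_mul, hj, ← eq_inv_mul_iff_mul_eq, two_mul, pow_add, mul_assoc, inv_pow]
    have h2 : ∀ t : W, cs.simple j * (g ^ m * t * (g ^ m)⁻¹) * cs.simple j = cs.simple i ↔
        t = (g⁻¹) ^ (2 * m + 1) * cs.simple j := by
      intro t
      have e : (g⁻¹) ^ (2 * m + 1) * cs.simple j
          = (g ^ m)⁻¹ * (cs.simple j * cs.simple i * cs.simple j) * g ^ m := by
        rw [mul_assoc, mul_assoc, hj m, ← inv_pow, two_mul, pow_succ, pow_add]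
        simp only [hg, mul_assoc, mul_inv_rev, cs.inv_simple]
        have c := Commute.pow_self (cs.simple j * cs.simple i) m
        have c' : (cs.simple j * cs.simple i) ^ m * (cs.simple j * (cs.simple i * cs.simple j))
          = cs.simple j * (cs.simple i * ((cs.simple j * cs.simple i) ^ m * cs.simple j)) := by
          have := congrArg (· * cs.simple j) c.eq
          simpa [mul_assoc] using this
        rw [c']
      rw [e]
      constructor
      · intro h
        rw [← h]
        simp [mul_assoc]
      · rintro rfl
        simp [mul_assoc]
    simp only [signedConj]
    rw [show 2 * (m + 1) = 2 * m + 1 + 1 by ring, Finset.sum_range_succ, Finset.sum_range_succ]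
    ext1
    · rw [pow_succ' g m, mul_inv_rev]
      simp only [hg, mul_inv_rev, cs.inv_simple, mul_assoc]
    · simp only [h1, h2]
      ring

/-- For m = M i j the summands have period m, so the 2m of them cancel in pairs modulo 2. -/
theorem signedConj_isLiftable : M.IsLiftable (signedConj cs) := by
  classical
  intro i j
  funext x
  rw [signedConj_mul_pow, cs.simple_mul_simple_pow, two_mul, Finset.sum_range_add]
  have hp : ((cs.simple i * cs.simple j)⁻¹) ^ M i j = 1 := by
    rw [inv_pow, cs.simple_mul_simple_pow, inv_one]
  simp only [pow_add, hp, one_mul]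
  rw [CharTwo.add_self_eq_zero]
  simp
  rfl

/-- The action of `W` on pairs of a group element and a sign. -/
noncomputable def signedConjHom : W →* Function.End (W × ZMod 2) :=
  cs.lift ⟨signedConj cs, signedConj_isLiftable cs⟩

-- Since the left side depends only on the group element, so does the parity of the number of times
-- a reflection occurs in the inversion sequence of a word.
open Classical in
theorem signedConjHom_wordProd (ω : List B) (x : W × ZMod 2) :
    signedConjHom cs (cs.wordProd ω) x =
      (cs.wordProd ω * x.1 * (cs.wordProd ω)⁻¹, x.2 + ((cs.rightInvSeq ω).count x.1 : ℕ)) := by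
  induction ω with
  | nil => simp; rfl
  | cons i ω ih =>
    rw [cs.wordProd_cons, map_mul]
    change signedConjHom cs (cs.simple i) (signedConjHom cs (cs.wordProd ω) x) = _
    rw [ih, signedConjHom, cs.lift_apply_simple]
    have e : (cs.wordProd ω)⁻¹ * cs.simple i * cs.wordProd ω = x.1 ↔
        cs.wordProd ω * x.1 * (cs.wordProd ω)⁻¹ = cs.simple i := by
      constructor
      · intro h; rw [← h]; group
      · intro h; rw [← h]; group
    simp only [signedConj, CoxeterSystem.rightInvSeq, List.count_cons, beq_iff_eq, e]
    ext1
    · simp [mul_assoc]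
    · push_cast
      ring

theorem signedConjHom_add (w : W) (t : W) (a b : ZMod 2) :
    signedConjHom cs w (t, a + b) =
      ((signedConjHom cs w (t, a)).1, (signedConjHom cs w (t, a)).2 + b) := by
  obtain ⟨ω, rfl⟩ := cs.wordProd_surjective w
  rw [signedConjHom_wordProd, signedConjHom_wordProd]
  simp only [Prod.mk.injEq, true_and]
  ring

/-- Conjugation reduces this to a simple reflection, which flips its own sign; the sign picked up on
the way in is undone on the way out. -/
theorem signedConjHom_reflection {t : W} (ht : cs.IsReflection t) :
    signedConjHom cs t (t, 0) = (t, 1) := by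
  classical
  obtain ⟨g, i, rfl⟩ := ht
  have key : ∀ w : W, ∀ x, signedConjHom cs (g * w) x
      = signedConjHom cs g (signedConjHom cs w x) := fun w x => by rw [map_mul]; rfl
  set t := g * cs.simple i * g⁻¹ with htdef
  have h1 : (signedConjHom cs g⁻¹ (t, 0)).1 = cs.simple i := by
    obtain ⟨ω, hω⟩ := cs.wordProd_surjective g⁻¹
    rw [← hω, signedConjHom_wordProd, hω, htdef]
    group
  obtain ⟨a, ha⟩ : ∃ a, signedConjHom cs g⁻¹ (t, 0) = (cs.simple i, a) := ⟨_, Prod.ext h1 rfl⟩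
  have h2 : signedConjHom cs (cs.simple i) (cs.simple i, a) = (cs.simple i, a + 1) := by
    rw [signedConjHom, cs.lift_apply_simple]
    simp [signedConj]
  have h3 : signedConjHom cs g (cs.simple i, a) = (t, 0) := by
    rw [← ha, ← key, mul_inv_cancel, map_one]; rfl
  have h4 : signedConjHom cs t (t, 0) =
      signedConjHom cs g (signedConjHom cs (cs.simple i) (signedConjHom cs g⁻¹ (t, 0))) := by
    conv_lhs => rw [htdef, map_mul, map_mul]
    rfl
  rw [h4, ha, h2, signedConjHom_add, h3]
  simp

/-- The strong exchange property, for right inversions. -/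
theorem mem_rightInvSeq_of_isRightInversion {ω : List B} {t : W}
    (ht : cs.IsRightInversion (cs.wordProd ω) t) : t ∈ cs.rightInvSeq ω := by
  classical
  by_contra hmem
  obtain ⟨ω', hω', he⟩ := cs.exists_isReduced (cs.wordProd ω * t)
  have h1 : signedConjHom cs (cs.wordProd ω * t) (t, 0) =
      signedConjHom cs (cs.wordProd ω) (signedConjHom cs t (t, 0)) := by rw [map_mul]; rfl
  rw [signedConjHom_reflection cs ht.1, he, signedConjHom_wordProd, signedConjHom_wordProd,
    List.count_eq_zero_of_not_mem hmem] at h1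
  have h2 := congrArg Prod.snd h1
  -- Multiplication by t changes the parity of the occurrences of t. If t is absent for w, it occurs
  -- for a reduced word of w * t, and then w is shorter than w * t.
  have hmem' : t ∈ cs.rightInvSeq ω' := by
    by_contra h
    rw [List.count_eq_zero_of_not_mem h] at h2
    simp at h2
  have h3 := (cs.isRightInversion_of_mem_rightInvSeq hω' hmem').2
  rw [← he, mul_assoc, ht.1.mul_self, mul_one] at h3
  exact lt_asymm h3 ht.2

/-- The strong exchange property: multiplication by a left inversion deletes a letter. -/
theorem exists_eraseIdx_of_isLeftInversion {ω : List B} {t : W}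
    (ht : cs.IsLeftInversion (cs.wordProd ω) t) :
    ∃ j < ω.length, t * cs.wordProd ω = cs.wordProd (ω.eraseIdx j) := by
  have h : t ∈ cs.rightInvSeq ω.reverse := by
    apply mem_rightInvSeq_of_isRightInversion
    rwa [cs.wordProd_reverse, cs.isRightInversion_inv_iff]
  rw [cs.rightInvSeq_reverse, List.mem_reverse] at h
  obtain ⟨j, hj, rfl⟩ := List.mem_iff_getElem.mp h
  refine ⟨j, by simpa using hj, ?_⟩
  rw [← cs.getD_leftInvSeq_mul_wordProd, List.getD_eq_getElem]

end Exchange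

/-! ### Minuscule weight systems -/

/-- A minuscule orbit of weights for a Coxeter matrix: `A` is a Cartan matrix, `k` a node, and a
vector `c` stands for the weight `ω_k - ∑ c_i α_i`. -/
structure WeightSystem {B : Type*} [Fintype B] [DecidableEq B] (M : CoxeterMatrix B) where
  A : B → B → ℤ
  k : B
  A_diag : ∀ i, A i i = 2
  A_cases : ∀ i j, i ≠ j → (M i j = 2 ∧ A i j = 0 ∧ A j i = 0) ∨
    (M i j = 3 ∧ A i j = -1 ∧ A j i = -1) ∨
    (M i j = 4 ∧ A i j = -1 ∧ A j i = -2) ∨ (M i j = 4 ∧ A i j = -2 ∧ A j i = -1)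
  carrier : Set (B → ℤ)
  zero_mem : 0 ∈ carrier
  nonneg : ∀ c ∈ carrier, 0 ≤ c
  wt_mem : ∀ c ∈ carrier, ∀ i, (if i = k then 1 else 0) - ∑ j, A i j * c j = -1 ∨
    (if i = k then 1 else 0) - ∑ j, A i j * c j = 0 ∨
    (if i = k then 1 else 0) - ∑ j, A i j * c j = 1
  refl_mem : ∀ c ∈ carrier, ∀ i,
    c + Pi.single i ((if i = k then 1 else 0) - ∑ j, A i j * c j) ∈ carrier
  exists_descent : ∀ c ∈ carrier, ∀ d ∈ carrier, d ≤ c → d ≠ c →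
    ∃ i, d i < c i ∧ (if i = k then 1 else 0) - ∑ j, A i j * c j = -1

namespace WeightSystem

variable {B : Type*} [Fintype B] [DecidableEq B] {M : CoxeterMatrix B} (S : WeightSystem M)

/-- The pairing of the weight `c` with the simple coroot `i`. -/
def wt (i : B) (c : B → ℤ) : ℤ := (if i = S.k then 1 else 0) - ∑ j, S.A i j * c j

theorem wt_add_single (i j : B) (c : B → ℤ) (a : ℤ) :
    S.wt i (c + Pi.single j a) = S.wt i c - a * S.A i j := by
  simp only [wt, Pi.add_apply, mul_add, Finset.sum_add_distrib]
  have : ∑ x, S.A i x * (Pi.single j a : B → ℤ) x = S.A i j * a := by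
    rw [Finset.sum_eq_single j]
    · simp
    · intro b _ hb
      simp [Pi.single_eq_of_ne hb]
    · simp
  rw [this]
  ring

theorem wt_sub_single (i j : B) (c : B → ℤ) (a : ℤ) :
    S.wt i (c - Pi.single j a) = S.wt i c + a * S.A i j := by
  rw [sub_eq_add_neg, ← Pi.single_neg, wt_add_single]
  ring

theorem wt_zero (i : B) : S.wt i 0 = if i = S.k then 1 else 0 := by simp [wt]

/-- The simple reflections on weights. -/
def refl (i : B) (c : B → ℤ) : B → ℤ := c + Pi.single i (S.wt i c)

theorem wt_cases {c : B → ℤ} (hc : c ∈ S.carrier) (i : B) :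
    S.wt i c = -1 ∨ S.wt i c = 0 ∨ S.wt i c = 1 := S.wt_mem c hc i

theorem refl_mem_carrier {c : B → ℤ} (hc : c ∈ S.carrier) (i : B) : S.refl i c ∈ S.carrier :=
  S.refl_mem c hc i

theorem wt_refl (i j : B) (c : B → ℤ) : S.wt i (S.refl j c) = S.wt i c - S.wt j c * S.A i j :=
  S.wt_add_single i j c _

theorem refl_of_wt_one {i : B} {c : B → ℤ} (h : S.wt i c = 1) : S.refl i c = c + Pi.single i 1 := by
  rw [refl, h]

theorem refl_of_wt_neg {i : B} {c : B → ℤ} (h : S.wt i c = -1) :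
    S.refl i c = c - Pi.single i 1 := by
  rw [refl, h, Pi.single_neg, sub_eq_add_neg]

theorem refl_of_wt_zero {i : B} {c : B → ℤ} (h : S.wt i c = 0) : S.refl i c = c := by
  rw [refl, h, Pi.single_zero, add_zero]

theorem A_zero_symm {i j : B} (hij : i ≠ j) (h : S.A i j = 0) : S.A j i = 0 ∧ M i j = 2 := by
  rcases S.A_cases i j hij with h' | h' | h' | h' <;> omega

theorem A_nonpos {i j : B} (hij : i ≠ j) : S.A i j ≤ 0 := by
  rcases S.A_cases i j hij with h' | h' | h' | h' <;> omega

theorem refl_refl (i : B) (c : B → ℤ) : S.refl i (S.refl i c) = c := by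
  conv_lhs => rw [refl, wt_refl, S.A_diag]
  rw [refl, add_assoc, ← Pi.single_add]
  ring_nf
  simp

/-- The action of a simple reflection on weights, as an element of a monoid. -/
def reflEnd (i : B) : Function.End (B → ℤ) := S.refl i

/-- Both reflections move c only in the coordinates i and j, so each relation is a rank two
computation, carried out for M i j = 2, 3, 4. -/
theorem reflEnd_isLiftable : M.IsLiftable S.reflEnd := by
  intro i j
  by_cases hij : i = j
  · subst hij
    rw [M.diagonal, pow_one]
    funext c
    exact S.refl_refl i c
  have hstep : ∀ c a b, S.refl i (S.refl j (c + Pi.single i a + Pi.single j b)) =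
      c + Pi.single i (a + (S.wt i c - a * 2 - b * S.A i j -
        (S.wt j c - a * S.A j i - b * 2) * S.A i j)) +
        Pi.single j (b + (S.wt j c - a * S.A j i - b * 2)) := by
    intro c a b
    have h1 : S.refl j (c + Pi.single i a + Pi.single j b) = c + Pi.single i a +
        Pi.single j (b + (S.wt j c - a * S.A j i - b * 2)) := by
      rw [refl, wt_add_single, wt_add_single, S.A_diag, Pi.single_add, ← add_assoc]
    rw [h1, refl, wt_add_single, wt_add_single, S.A_diag, add_right_comm, add_assoc c,
      ← Pi.single_add]
    congr 3
    ring
  have h0 : ∀ c : B → ℤ, c = c + Pi.single i 0 + Pi.single j 0 := by simp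
  have hpow : ∀ m c, ((S.reflEnd i * S.reflEnd j) ^ (m + 1)) c =
      S.refl i (S.refl j (((S.reflEnd i * S.reflEnd j) ^ m) c)) := by
    intro m c
    rw [pow_succ']
    rfl
  have hone : ∀ c : B → ℤ, (1 : Function.End (B → ℤ)) c = c := fun _ => rfl
  funext c
  rw [hone]
  rcases S.A_cases i j hij with h | h | h | h <;> obtain ⟨hm, h1, h2⟩ := h <;>
  · rw [hm]
    simp only [hpow, pow_zero, hone]
    have hfirst := hstep c 0 0
    rw [← h0 c] at hfirst
    simp only [hfirst, hstep]
    rw [h1, h2]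
    conv_rhs => rw [h0 c]
    congr 3 <;> ring

/-- Weights reached from the highest one by lowering operators, together with the result of
applying the operators `T` to `e₀` along the way. -/
inductive Reach {E : Type*} (T : B → E → E) (e₀ : E) : (B → ℤ) → E → Prop
  | zero : Reach T e₀ 0 e₀
  | step (c : B → ℤ) (e : E) (i : B) : Reach T e₀ c e → S.wt i c = 1 →
      Reach T e₀ (c + Pi.single i 1) (T i e)

/-! ### Chains of lowering steps -/

variable {S}

section Reach

variable {E : Type*} {T : B → E → E} {e₀ : E} {c : B → ℤ} {e e' : E}

theorem Reach.mem (h : S.Reach T e₀ c e) : c ∈ S.carrier := by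
  induction h with
  | zero => exact S.zero_mem
  | step c e i _ hw ih => exact S.refl_of_wt_one hw ▸ S.refl_mem_carrier ih i

/-- If the last step is j ≠ i, the pairing with i before it is -1 + A i j. Minuscule pairings are at
least -1, so A i j = 0, the two steps commute, and i can be moved to the end. -/
theorem Reach.descent (hT : ∀ i j, i ≠ j → M i j = 2 → ∀ e, T i (T j e) = T j (T i e))
    (h : S.Reach T e₀ c e) {i : B} (hi : S.wt i c = -1) :
    ∃ e', S.Reach T e₀ (c - Pi.single i 1) e' ∧ e = T i e' := by
  induction h with
  | zero =>
    rw [wt_zero] at hi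
    split_ifs at hi
  | step c e j hr hw ih =>
    by_cases hij : i = j
    · subst hij
      exact ⟨e, by simpa using hr, rfl⟩
    · have hA := S.A_nonpos hij
      rw [wt_add_single] at hi
      have hwt := S.wt_cases hr.mem i
      have hA0 : S.A i j = 0 := by omega
      obtain ⟨hA1, hm⟩ := S.A_zero_symm hij hA0
      obtain ⟨e', hr', rfl⟩ := ih (by omega)
      refine ⟨T j e', ?_, (hT i j hij hm e').symm⟩
      have : c + Pi.single j 1 - Pi.single i 1 = (c - Pi.single i 1) + Pi.single j 1 := by abel
      rw [this]
      refine Reach.step _ _ _ hr' ?_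
      rw [wt_sub_single]
      omega

/-- Commutations alone suffice: this is the full commutativity of minuscule elements. -/
theorem Reach.unique (hT : ∀ i j, i ≠ j → M i j = 2 → ∀ e, T i (T j e) = T j (T i e))
    (h : S.Reach T e₀ c e) (h' : S.Reach T e₀ c e') : e = e' := by
  induction h generalizing e' with
  | zero =>
    generalize hc : (0 : B → ℤ) = d at h'
    cases h' with
    | zero => rfl
    | step c' _ i hr _ =>
      have h1 := S.nonneg _ hr.mem i
      have h2 := congrFun hc i
      simp only [Pi.zero_apply, Pi.add_apply, Pi.single_eq_same] at h1 h2
      omega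
  | step c e i hr hw ih =>
    obtain ⟨e'', hr'', rfl⟩ := h'.descent hT (i := i) (by rw [wt_add_single, S.A_diag]; omega)
    rw [add_sub_cancel_right] at hr''
    rw [ih hr'']

variable (S) in
/-- The number of boxes. -/
def size (c : B → ℤ) : ℤ := ∑ i, c i

theorem size_add_single (i : B) (a : ℤ) : size (c + Pi.single i a) = size c + a := by
  simp [size, Finset.sum_add_distrib]

theorem size_sub_single (i : B) (a : ℤ) : size (c - Pi.single i a) = size c - a := by
  simp [size, Finset.sum_sub_distrib]

theorem size_nonneg (hc : c ∈ S.carrier) : 0 ≤ size c :=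
  Finset.sum_nonneg fun i _ => S.nonneg c hc i

theorem exists_reach (T : B → E → E) (e₀ : E) (hc : c ∈ S.carrier) : ∃ e, S.Reach T e₀ c e := by
  generalize hn : (size c).toNat = n
  induction n generalizing c with
  | zero =>
    have h0 : c = 0 := by
      have := (Finset.sum_eq_zero_iff_of_nonneg fun i _ => S.nonneg c hc i).mp
        (le_antisymm (by rw [size] at hn; omega) (size_nonneg hc))
      funext i
      exact this i (Finset.mem_univ i)
    exact ⟨e₀, h0 ▸ Reach.zero⟩
  | succ n ih =>
    obtain ⟨i, -, hi⟩ := S.exists_descent c hc 0 S.zero_mem (S.nonneg c hc) (by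
      rintro rfl
      simp [size] at hn)
    change S.wt i c = -1 at hi
    have hc' := S.refl_of_wt_neg hi ▸ S.refl_mem_carrier hc i
    obtain ⟨e, he⟩ := ih hc' (by rw [size_sub_single]; omega)
    refine ⟨T i e, ?_⟩
    have := Reach.step _ _ i he (by rw [wt_sub_single, hi, S.A_diag]; norm_num)
    simpa using this

/-- If a simple reflection fixes a weight, then its operator acts on the corresponding element like
that of some simple reflection that fixes the highest weight acts on `e₀`. -/
theorem Reach.fixed (K : B → E → E)
    (h2 : ∀ i j, i ≠ j → M i j = 2 → ∀ e, T i (T j e) = T j (T i e))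
    (h3 : ∀ i j, i ≠ j → M i j = 3 → ∀ e, T i (T j (T i e)) = T j (T i (T j e)))
    (h4 : ∀ i j, i ≠ j → M i j = 4 → ∀ e, T i (T j (T i (T j e))) = T j (T i (T j (T i e))))
    (hK : ∀ i j e, T i (K j e) = K j (T i e)) (h0 : ∀ j, j ≠ S.k → T j e₀ = K j e₀)
    (h : S.Reach T e₀ c e) {i : B} (hi : S.wt i c = 0) : ∃ j, j ≠ S.k ∧ T i e = K j e := by
  generalize hn : (size c).toNat = n
  induction n using Nat.strong_induction_on generalizing c e i with
  | _ n ih =>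
  cases h with
  | zero =>
    refine ⟨i, ?_, ?_⟩
    · rintro rfl
      simp [wt_zero] at hi
    · refine h0 i ?_
      rintro rfl
      simp [wt_zero] at hi
  | step c e r hr hw =>
    have hne : i ≠ r := by
      rintro rfl
      rw [wt_add_single, S.A_diag] at hi
      omega
    have hs := size_nonneg hr.mem
    rw [size_add_single] at hn
    rw [wt_add_single] at hi
    have hwt := S.wt_cases hr.mem i
    rcases S.A_cases i r hne with ⟨hm, ha, hb⟩ | ⟨hm, ha, hb⟩ | ⟨hm, ha, hb⟩ | ⟨hm, ha, hb⟩
    · obtain ⟨j, hj, hje⟩ := ih _ (by omega) hr (i := i) (by omega) rfl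
      exact ⟨j, hj, by rw [h2 i r hne hm, hje, hK]⟩
    -- The pairing with i before the step r is -1, so a step i precedes it. Below both steps the
    -- pairing with r is 0, and the braid relation carries i past them as r.
    · obtain ⟨e1, hr1, rfl⟩ := hr.descent h2 (i := i) (by omega)
      have hs1 := size_nonneg hr1.mem
      rw [size_sub_single] at hs1
      obtain ⟨j, hj, hje⟩ := ih _ (by rw [size_sub_single]; omega) hr1 (i := r)
        (by rw [wt_sub_single]; omega) rfl
      exact ⟨j, hj, by rw [h3 i r hne hm, hje, hK, hK]⟩
    -- With A r i = -2 the chain ends in r, i, r. Below these three steps the pairing with i is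
    -- again 0, and the braid relation of length four applies.
    · obtain ⟨e1, hr1, rfl⟩ := hr.descent h2 (i := i) (by omega)
      obtain ⟨e2, hr2, rfl⟩ := hr1.descent h2 (i := r) (by rw [wt_sub_single]; omega)
      have hs1 := size_nonneg hr2.mem
      rw [size_sub_single, size_sub_single] at hs1
      obtain ⟨j, hj, hje⟩ := ih _ (by rw [size_sub_single, size_sub_single]; omega) hr2 (i := i)
        (by rw [wt_sub_single, wt_sub_single, S.A_diag]; omega) rfl
      exact ⟨j, hj, by rw [h4 i r hne hm, hje, hK, hK, hK]⟩
    -- Here A i r = -2 would give c the pairing -2 with i, which is excluded.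
    · omega

end Reach

end WeightSystem

namespace WeightSystem

variable {B : Type*} [Fintype B] [DecidableEq B] {M : CoxeterMatrix B} (S : WeightSystem M)

/-! ### The operators that compute relative `R`-polynomials -/

/-- The action of a simple reflection on the weights of the system. -/
def reflect (i : B) (c : S.carrier) : S.carrier := ⟨S.refl i c, S.refl_mem_carrier c.2 i⟩

theorem coe_reflect (i : B) (c : S.carrier) : (S.reflect i c : B → ℤ) = S.refl i c := rfl

theorem wt_reflect (i j : B) (c : S.carrier) :
    S.wt i (S.reflect j c) = S.wt i c - S.wt j c * S.A i j := S.wt_refl i j c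

theorem reflect_reflect (i : B) (c : S.carrier) : S.reflect i (S.reflect i c) = c :=
  Subtype.ext (S.refl_refl i c)

theorem reflect_comm {i j : B} (h : S.A i j = 0) (h' : S.A j i = 0) (c : S.carrier) :
    S.reflect i (S.reflect j c) = S.reflect j (S.reflect i c) := by
  apply Subtype.ext
  simp only [coe_reflect, refl, wt_add_single, h, h', mul_zero, sub_zero]
  abel

/-- Deodhar's recursion for the relative `R`-polynomials, as an operator. -/
noncomputable def rOp (i : B) (f : S.carrier → ℤ[X]) (d : S.carrier) : ℤ[X] :=
  if S.wt i d = -1 then f (S.reflect i d)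
  else if S.wt i d = 1 then (X - 1) * f d + X * f (S.reflect i d)
  else X * f d

/-- This relation and the two braid relations below make the vector of R-polynomials independent of
the chain. Each is checked pointwise over the possible pairings with i and j, inconsistent
combinations being discarded by the minuscule bound. -/
theorem rOp_comm (i j : B) (hij : i ≠ j) (h : M i j = 2) (f : S.carrier → ℤ[X]) :
    S.rOp i (S.rOp j f) = S.rOp j (S.rOp i f) := by
  obtain ⟨h1, h2⟩ : S.A i j = 0 ∧ S.A j i = 0 := by
    rcases S.A_cases i j hij with h' | h' | h' | h' <;> omega
  funext d
  have hc := S.reflect_comm h1 h2 d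
  simp only [rOp, wt_reflect, h1, h2, mul_zero, sub_zero, hc]
  split_ifs <;> ring

theorem rOp_braid_three (i j : B) (hij : i ≠ j) (h : M i j = 3) (f : S.carrier → ℤ[X]) :
    S.rOp i (S.rOp j (S.rOp i f)) = S.rOp j (S.rOp i (S.rOp j f)) := by
  obtain ⟨h1, h2⟩ : S.A i j = -1 ∧ S.A j i = -1 := by
    rcases S.A_cases i j hij with h' | h' | h' | h' <;> omega
  funext d
  have hi := S.wt_cases d.2 i
  have hj := S.wt_cases d.2 j
  have hij' := S.wt_cases (S.reflect i d).2 j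
  rw [wt_reflect, h2] at hij'
  rcases hi with hi | hi | hi <;> rcases hj with hj | hj | hj <;> rw [hi, hj] at hij' <;>
    first
    | (exfalso; omega)
    | (simp [rOp, wt_reflect, h1, h2, hi, hj, S.A_diag, reflect_reflect]
       try ring)

theorem rOp_braid_four (i j : B) (hij : i ≠ j) (h : M i j = 4) (f : S.carrier → ℤ[X]) :
    S.rOp i (S.rOp j (S.rOp i (S.rOp j f))) = S.rOp j (S.rOp i (S.rOp j (S.rOp i f))) := by
  have h12 : (S.A i j = -1 ∧ S.A j i = -2) ∨ (S.A i j = -2 ∧ S.A j i = -1) := by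
    rcases S.A_cases i j hij with h' | h' | h' | h' <;> omega
  funext d
  have hi := S.wt_cases d.2 i
  have hj := S.wt_cases d.2 j
  have hij' := S.wt_cases (S.reflect i d).2 j
  have hji' := S.wt_cases (S.reflect j d).2 i
  rw [wt_reflect] at hij' hji'
  rcases h12 with ⟨h1, h2⟩ | ⟨h1, h2⟩ <;> rw [h2] at hij' <;> rw [h1] at hji' <;>
  rcases hi with hi | hi | hi <;> rcases hj with hj | hj | hj <;>
    rw [hi, hj] at hij' hji' <;>
    first
    | (exfalso; omega)
    | (simp [rOp, wt_reflect, h1, h2, hi, hj, S.A_diag, reflect_reflect]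
       try ring)

/-- The initial value for the recursion. -/
noncomputable def rInit (d : S.carrier) : ℤ[X] := open Classical in if (d : B → ℤ) = 0 then 1 else 0

/-- For j ≠ k the reflection fixes the highest weight, so the third case of the recursion applies
there. Weights that it moves are nonzero and stay nonzero. -/
theorem rOp_rInit {j : B} (hj : j ≠ S.k) : S.rOp j S.rInit = fun d => X * S.rInit d := by
  have h0 : S.wt j 0 = 0 := by simp [wt_zero, hj]
  funext d
  have key : S.wt j d ≠ 0 → S.rInit d = 0 ∧ S.rInit (S.reflect j d) = 0 := by
    intro hd
    constructor
    · rw [rInit, if_neg]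
      rintro h
      rw [h] at hd
      exact hd h0
    · rw [rInit, if_neg]
      rintro h
      have := S.wt_reflect j j d
      rw [h, h0, S.A_diag] at this
      omega
  rcases S.wt_cases d.2 j with h | h | h
  · simp [rOp, h, key]
  · simp [rOp, h]
  · simp [rOp, h, key]

/-- `f` is the vector of relative `R`-polynomials with upper weight `c`. -/
def IsRVector (c : B → ℤ) (f : S.carrier → ℤ[X]) : Prop := S.Reach S.rOp S.rInit c f

variable {S}

section RVector

variable {c : B → ℤ} {f g : S.carrier → ℤ[X]}

theorem IsRVector.unique (hf : S.IsRVector c f) (hg : S.IsRVector c g) : f = g :=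
  Reach.unique S.rOp_comm hf hg

theorem IsRVector.descent (hf : S.IsRVector c f) {i : B} (hi : S.wt i c = -1) :
    ∃ g, S.IsRVector (c - Pi.single i 1) g ∧ f = S.rOp i g :=
  Reach.descent S.rOp_comm hf hi

/-- `Reach.fixed` with K the multiplication by `X`, which is the same for every generator of the
parabolic subgroup. -/
theorem IsRVector.fixed (hf : S.IsRVector c f) {i : B} (hi : S.wt i c = 0) :
    S.rOp i f = fun d => X * f d := by
  obtain ⟨j, -, h⟩ := Reach.fixed (K := fun _ f d => X * f d) S.rOp_comm S.rOp_braid_three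
    S.rOp_braid_four (by
      intro i _ e
      funext d
      simp only [rOp]
      split_ifs <;> ring) (fun j hj => S.rOp_rInit hj) hf hi
  exact h

theorem IsRVector.eq_zero (hf : S.IsRVector c f) (d : S.carrier) (hd : ¬ (d : B → ℤ) ≤ c) :
    f d = 0 := by
  induction hf generalizing d with
  | zero =>
    rw [rInit, if_neg]
    rintro h
    exact hd h.le
  | step c f i hr hw ih =>
    have h1 : f d = 0 := ih d fun h => hd (h.trans (by simp))
    rcases S.wt_cases d.2 i with h | h | h
    · rw [rOp, if_pos h]
      refine ih _ fun h' => hd ?_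
      rw [coe_reflect, S.refl_of_wt_neg h] at h'
      exact sub_le_iff_le_add.mp h'
    · simp [rOp, h, h1]
    · have h2 : f (S.reflect i d) = 0 := by
        refine ih _ fun h' => hd ?_
        rw [coe_reflect, S.refl_of_wt_one h] at h'
        exact (le_add_of_nonneg_right (by simp)).trans (h'.trans (by simp))
      simp [rOp, h, h1, h2]

theorem IsRVector.eq_one (hf : S.IsRVector c f) (d : S.carrier) (hd : (d : B → ℤ) = c) :
    f d = 1 := by
  induction hf generalizing d with
  | zero => rw [rInit, if_pos hd]
  | step c f i hr hw ih =>
    have h : S.wt i d = -1 := by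
      rw [hd, wt_add_single, hw, S.A_diag]
      norm_num
    rw [rOp, if_pos h]
    refine ih _ ?_
    rw [coe_reflect, S.refl_of_wt_neg h, hd, add_sub_cancel_right]

end RVector

/-! ### Weights and elements of the Coxeter group -/

variable {W : Type*} [Group W] (cs : CoxeterSystem M W)

variable (S) in
/-- The action of the Coxeter group on weights. -/
def act : W →* Function.End (B → ℤ) := cs.lift ⟨S.reflEnd, S.reflEnd_isLiftable⟩

theorem act_simple_mul (i : B) (w : W) (c : B → ℤ) :
    S.act cs (cs.simple i * w) c = S.refl i (S.act cs w c) := by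
  rw [map_mul, act, cs.lift_apply_simple]
  rfl

theorem act_one (c : B → ℤ) : S.act cs 1 c = c := by
  rw [map_one]
  rfl

theorem act_mul (v w : W) (c : B → ℤ) : S.act cs (v * w) c = S.act cs v (S.act cs w c) := by
  rw [map_mul]
  rfl

theorem act_mem {c : B → ℤ} (hc : c ∈ S.carrier) (w : W) : S.act cs w c ∈ S.carrier := by
  induction w using cs.simple_induction_left with
  | one => rwa [act_one]
  | mul_simple_left w i ih =>
    rw [act_simple_mul]
    exact S.refl_mem_carrier ih i

/-- Each letter changes one coordinate by at most 1. -/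
theorem size_act_le_length (w : W) : size (S.act cs w 0) ≤ cs.length w := by
  obtain ⟨ω, hω, rfl⟩ := cs.exists_isReduced w
  rw [hω.eq]
  clear hω
  induction ω with
  | nil => simp [act_one, size]
  | cons i ω ih =>
    rw [cs.wordProd_cons, act_simple_mul, refl, size_add_single]
    have := S.wt_cases (act_mem cs S.zero_mem (cs.wordProd ω)) i
    push_cast [List.length_cons]
    omega

variable (S) in
/-- `x` is the minimal coset representative with weight `c`. -/
def IsRep (c : B → ℤ) (x : W) : Prop := S.Reach (fun i x => cs.simple i * x) 1 c x

section Rep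

section Braid

variable {B W : Type*} [Group W] {M : CoxeterMatrix B} (cs : CoxeterSystem M W)

theorem mul_comm_of_two (i j : B) (_ : i ≠ j) (h : M i j = 2) (e : W) :
    cs.simple i * (cs.simple j * e) = cs.simple j * (cs.simple i * e) := by
  have := cs.simple_mul_simple_pow i j
  rw [h, pow_two] at this
  have h' : cs.simple i * cs.simple j = cs.simple j * cs.simple i := by
    conv_lhs => rw [mul_eq_one_iff_eq_inv.mp this]
    simp
  rw [← mul_assoc, h', mul_assoc]

theorem mul_braid_three (i j : B) (_ : i ≠ j) (h : M i j = 3) (e : W) :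
    cs.simple i * (cs.simple j * (cs.simple i * e)) =
      cs.simple j * (cs.simple i * (cs.simple j * e)) := by
  have := cs.simple_mul_simple_pow i j
  rw [h, pow_succ', pow_two] at this
  have h' : cs.simple i * cs.simple j * cs.simple i =
      cs.simple j * cs.simple i * cs.simple j := by
    have h2 : (cs.simple i * cs.simple j * cs.simple i) *
      (cs.simple j * cs.simple i * cs.simple j) = 1 := by simpa [mul_assoc] using this
    conv_lhs => rw [mul_eq_one_iff_eq_inv.mp h2]
    simp [mul_assoc]
  simpa [mul_assoc] using congrArg (· * e) h'

theorem mul_braid_four (i j : B) (_ : i ≠ j) (h : M i j = 4) (e : W) :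
    cs.simple i * (cs.simple j * (cs.simple i * (cs.simple j * e))) =
      cs.simple j * (cs.simple i * (cs.simple j * (cs.simple i * e))) := by
  have := cs.simple_mul_simple_pow i j
  rw [h, show 4 = 2 + 2 by rfl, pow_add, pow_two] at this
  have h' := mul_eq_one_iff_eq_inv.mp this
  simpa [mul_assoc] using congrArg (· * e) h'

end Braid

variable {cs} {c d : B → ℤ} {u v x : W}

theorem IsRep.mem (h : S.IsRep cs c x) : c ∈ S.carrier := Reach.mem h

theorem IsRep.descent (h : S.IsRep cs c x) {i : B} (hi : S.wt i c = -1) :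
    S.IsRep cs (c - Pi.single i 1) (cs.simple i * x) := by
  obtain ⟨e, he, rfl⟩ := Reach.descent (mul_comm_of_two cs) h hi
  rw [cs.simple_mul_simple_cancel_left]
  exact he

theorem IsRep.ascent (h : S.IsRep cs c x) {i : B} (hi : S.wt i c = 1) :
    S.IsRep cs (c + Pi.single i 1) (cs.simple i * x) := Reach.step _ _ i h hi

/-- `Reach.fixed` with K j the right multiplication by the simple reflection j. -/
theorem IsRep.fixed (h : S.IsRep cs c x) {i : B} (hi : S.wt i c = 0) :
    ∃ j, j ≠ S.k ∧ cs.simple i * x = x * cs.simple j :=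
  Reach.fixed (K := fun j x => x * cs.simple j) (mul_comm_of_two cs) (mul_braid_three cs)
    (mul_braid_four cs) (fun i j e => (mul_assoc _ _ _).symm) (by simp) h hi

theorem IsRep.unique (h : S.IsRep cs c u) (h' : S.IsRep cs c v) : u = v :=
  Reach.unique (mul_comm_of_two cs) h h'

theorem IsRep.act_eq (h : S.IsRep cs c x) : S.act cs x 0 = c := by
  induction h with
  | zero => rw [act_one]
  | step c x i _ hw ih => rw [act_simple_mul, ih, S.refl_of_wt_one hw]

theorem IsRep.length_eq (h : S.IsRep cs c x) : (cs.length x : ℤ) = size c := by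
  apply le_antisymm
  · induction h with
    | zero => simp [size]
    | step c x i _ hw ih =>
      rw [size_add_single]
      have := cs.length_mul_le (cs.simple i) x
      rw [cs.length_simple] at this
      change (cs.length (cs.simple i * x) : ℤ) ≤ _
      omega
  · conv_lhs => rw [← h.act_eq]
    exact size_act_le_length cs x

/-- A simple reflection j ≠ k fixes the highest weight, so x and x s_j have the same weight. Its
size equals the length of x and bounds the length of x s_j from below. -/
theorem IsRep.mem_minReps (h : S.IsRep cs c x) : x ∈ minReps cs {i | i ≠ S.k} := by
  intro j hj
  have h1 : S.act cs (x * cs.simple j) 0 = c := by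
    have h2 : S.act cs (cs.simple j) 0 = 0 := by
      have := act_simple_mul (S := S) cs j 1 0
      rw [mul_one, act_one] at this
      rw [this, S.refl_of_wt_zero]
      simpa [wt_zero] using hj
    rw [act_mul, h2, h.act_eq]
  have h3 := size_act_le_length (S := S) cs (x * cs.simple j)
  rw [h1, ← h.length_eq] at h3
  have := cs.length_mul_simple_ne x j
  omega

theorem IsRep.isLeftDescent_iff (h : S.IsRep cs c x) (i : B) :
    cs.IsLeftDescent x i ↔ S.wt i c = -1 := by
  rw [CoxeterSystem.IsLeftDescent]
  constructor
  · intro hlt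
    have h1 := size_act_le_length (S := S) cs (cs.simple i * x)
    rw [act_simple_mul, h.act_eq, refl, size_add_single, ← h.length_eq] at h1
    have := S.wt_cases h.mem i
    omega
  · intro hi
    have h1 := (h.descent hi).length_eq
    rw [size_sub_single, ← h.length_eq] at h1
    omega

/-- At pairing 0 the product is x s_j with j in J, which is not minimal because x is shorter. -/
theorem IsRep.simple_mul_mem_minReps_iff (h : S.IsRep cs c x) (i : B) :
    cs.simple i * x ∈ minReps cs {i | i ≠ S.k} ↔ S.wt i c ≠ 0 := by
  constructor
  · intro hm h0
    obtain ⟨j, hj, he⟩ := h.fixed h0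
    have h1 := hm j hj
    have h2 := h.mem_minReps j hj
    rw [he, mul_assoc, cs.simple_mul_simple_self, mul_one] at h1
    omega
  · intro h0
    rcases S.wt_cases h.mem i with hi | hi | hi
    · exact (h.descent hi).mem_minReps
    · exact absurd hi h0
    · exact (h.ascent hi).mem_minReps

/-- As long as d ≠ c, some descent of c lowers a coordinate in which c exceeds d; thus v is reached
from u by left multiplications by simple reflections. -/
theorem IsRep.bruhatLE (hu : S.IsRep cs d u) (hv : S.IsRep cs c v) (hle : d ≤ c) :
    BruhatLE cs u v := by
  generalize hn : (size c).toNat = n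
  induction n generalizing c v with
  | zero =>
    have h1 := size_nonneg hv.mem
    have h2 := size_nonneg hu.mem
    have h3 : size d ≤ size c := Finset.sum_le_sum fun i _ => hle i
    have h4 := hu.length_eq
    have h5 := hv.length_eq
    have h6 : cs.length u = 0 := by omega
    have h7 : cs.length v = 0 := by omega
    rw [cs.length_eq_zero_iff] at h6 h7
    rw [h6, h7]
    exact Relation.ReflTransGen.refl
  | succ n ih =>
    by_cases hdc : d = c
    · subst hdc
      rw [hu.unique hv]
      exact Relation.ReflTransGen.refl
    · obtain ⟨i, hlt, hi⟩ := S.exists_descent c hv.mem d hu.mem hle hdc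
      have hv' := hv.descent hi
      have hb := ih hv' (fun j => by
        by_cases hj : j = i
        · subst hj
          simp only [Pi.sub_apply, Pi.single_eq_same]
          omega
        · simpa [Pi.single_eq_of_ne hj] using hle j) (by rw [size_sub_single]; omega)
      refine hb.tail ⟨(hv.isLeftDescent_iff i).mpr hi, cs.simple i, cs.isReflection_simple i, ?_⟩
      simp

/-- Parabolic factorization. -/
theorem exists_factorization (w : W) : ∃ c u y, S.IsRep cs c u ∧ w = u * y ∧
    S.act cs w 0 = c ∧ cs.length w = cs.length u + cs.length y := by
  generalize hn : cs.length w = n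
  induction n generalizing w with
  | zero =>
    rw [cs.length_eq_zero_iff] at hn
    subst hn
    exact ⟨0, 1, 1, Reach.zero, by simp, act_one cs 0, by simp⟩
  | succ n ih =>
    obtain ⟨i, hi⟩ := cs.exists_leftDescent_of_ne_one (w := w) (by rintro rfl; simp at hn)
    rw [cs.isLeftDescent_iff] at hi
    obtain ⟨c, u, y, hu, hw, hact, hlen⟩ := ih (cs.simple i * w) (by omega)
    have hw' : w = cs.simple i * (u * y) := by rw [← hw]; simp
    have hact' : S.act cs w 0 = S.refl i c := by
      rw [← hact, ← act_simple_mul]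
      simp
    have hul := hu.length_eq
    rcases S.wt_cases hu.mem i with h | h | h
    · have h1 := (hu.descent h).length_eq
      rw [size_sub_single] at h1
      have h2 := cs.length_mul_le (cs.simple i * u) y
      rw [mul_assoc, ← hw'] at h2
      omega
    · obtain ⟨j, -, he⟩ := hu.fixed h
      have hw2 : w = u * (cs.simple j * y) := by
        rw [hw', ← mul_assoc, he, mul_assoc]
      refine ⟨c, u, cs.simple j * y, hu, hw2, ?_, ?_⟩
      · rw [hact', S.refl_of_wt_zero h]
      · have h2 := cs.length_mul_le u (cs.simple j * y)
        rw [← hw2] at h2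
        have h3 := cs.length_simple_mul y j
        omega
    · have h1 := (hu.ascent h).length_eq
      rw [size_add_single] at h1
      refine ⟨_, _, y, hu.ascent h, by rw [hw', mul_assoc], ?_, by omega⟩
      rw [hact', S.refl_of_wt_one h]

/-- A pairing -1 would shorten the minimal representative of the coset, and with it w. -/
theorem wt_act_nonneg {w : W} {i : B} (h : cs.length w < cs.length (cs.simple i * w)) :
    0 ≤ S.wt i (S.act cs w 0) := by
  obtain ⟨c, u, y, hu, hw, hact, hlen⟩ := exists_factorization (S := S) (cs := cs) w
  rw [hact]
  rcases S.wt_cases hu.mem i with h1 | h1 | h1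
  · have h2 := (hu.descent h1).length_eq
    rw [size_sub_single, ← hu.length_eq] at h2
    have h3 := cs.length_mul_le (cs.simple i * u) y
    rw [mul_assoc, ← hw] at h3
    omega
  · omega
  · omega

/-- Only coordinate i matters. If d and c differ there, the slack of 1 absorbs the change of d. If
they agree, nonpositivity of the off-diagonal Cartan entries compares the pairings. -/
theorem refl_mono (hd : d ∈ S.carrier) (hc : c ∈ S.carrier) (hle : d ≤ c) {i : B}
    (hi : 0 ≤ S.wt i c) : S.refl i d ≤ S.refl i c := by
  have hwd := S.wt_cases hd i
  have hwc := S.wt_cases hc i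
  intro j
  by_cases hj : j = i
  · subst hj
    have h1 : d j ≤ c j := hle j
    simp only [refl, Pi.add_apply, Pi.single_eq_same]
    by_cases heq : d j = c j
    · have h2 : S.wt j d ≤ S.wt j c := by
        simp only [wt]
        have : ∑ x, S.A j x * c x ≤ ∑ x, S.A j x * d x := by
          apply Finset.sum_le_sum
          intro x _
          by_cases hx : x = j
          · subst hx
            rw [heq]
          · exact mul_le_mul_of_nonpos_left (hle x) (S.A_nonpos (Ne.symm hx))
        omega
      omega
    · omega
  · simpa [refl, Pi.single_eq_of_ne hj] using hle j

theorem act_wordProd_mono (p q : List B) (hr : cs.IsReduced (p ++ q)) (hd : d ∈ S.carrier)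
    (hle : d ≤ S.act cs (cs.wordProd q) 0) :
    S.act cs (cs.wordProd p) d ≤ S.act cs (cs.wordProd (p ++ q)) 0 := by
  induction p with
  | nil => simpa [act_one] using hle
  | cons i p ih =>
    have hr' : cs.IsReduced (p ++ q) := by simpa using hr.drop 1
    rw [List.cons_append, cs.wordProd_cons, cs.wordProd_cons, act_simple_mul, act_simple_mul]
    refine refl_mono (act_mem cs hd _) (act_mem cs S.zero_mem _) (ih hr') (wt_act_nonneg ?_)
    rw [← cs.wordProd_cons, hr'.eq, ← List.cons_append, hr.eq]
    simp

/-- By strong exchange, a covering step down deletes one letter of a reduced word. Omitting this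
letter lowers the weight of the suffix, and the reduced prefix preserves the inequality. -/
theorem act_le_of_bruhatLE {a b : W} (h : BruhatLE cs a b) : S.act cs a 0 ≤ S.act cs b 0 := by
  induction h with
  | refl => exact le_rfl
  | tail _ hbc ih =>
    refine ih.trans ?_
    rename_i a b _
    obtain ⟨hlt, t, ht, rfl⟩ := hbc
    obtain ⟨ω, hω, he⟩ := cs.exists_isReduced (t * a)
    have hinv : cs.IsLeftInversion (cs.wordProd ω) t := by
      refine ⟨ht, ?_⟩
      rw [← he, ← mul_assoc, ht.mul_self, one_mul]
      exact hlt
    obtain ⟨j, hj, h⟩ := exists_eraseIdx_of_isLeftInversion cs hinv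
    rw [← he, ← mul_assoc, ht.mul_self, one_mul, List.eraseIdx_eq_take_drop_succ,
      cs.wordProd_append] at h
    have hsplit : ω = ω.take j ++ (ω[j] :: ω.drop (j + 1)) := by
      rw [List.getElem_cons_drop, List.take_append_drop]
    have hr : cs.IsReduced (ω[j] :: ω.drop (j + 1)) := by
      rw [List.getElem_cons_drop]
      exact hω.drop j
    have hr' : cs.IsReduced (ω.drop (j + 1)) := hω.drop _
    rw [he, h, act_mul]
    conv_rhs => rw [hsplit]
    refine act_wordProd_mono _ _ (hsplit ▸ hω) (act_mem cs S.zero_mem _) ?_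
    rw [cs.wordProd_cons, act_simple_mul, refl]
    have := wt_act_nonneg (S := S) (cs := cs) (w := cs.wordProd (ω.drop (j + 1))) (i := ω[j]) (by
      rw [← cs.wordProd_cons, hr'.eq, hr.eq]
      simp
      omega)
    exact le_add_of_nonneg_right (by simpa using this)

theorem IsRep.le_of_bruhatLE (hu : S.IsRep cs d u) (hv : S.IsRep cs c v) (h : BruhatLE cs u v) :
    d ≤ c := by
  rw [← hu.act_eq, ← hv.act_eq]
  exact act_le_of_bruhatLE h

/-- `relR` follows descents picked by choice; `IsRVector.descent` lets f follow the same ones. -/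
theorem IsRep.relR_eq (hv : S.IsRep cs c v) (hu : S.IsRep cs d u) {f : S.carrier → ℤ[X]}
    (hf : S.IsRVector c f) : relR cs {i | i ≠ S.k} u v = f ⟨d, hu.mem⟩ := by
  generalize hn : cs.length v = n
  induction n using Nat.strong_induction_on generalizing c d u v f with
  | _ n ih =>
  rw [relR]
  split_ifs with h1 h2 h3
  · refine (hf.eq_one _ ?_).symm
    exact hu.act_eq.symm.trans (h2 ▸ hv.act_eq)
  · have hi := h3.choose_spec
    set i := h3.choose with hidef
    have hlt := hi
    rw [hv.isLeftDescent_iff] at hi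
    obtain ⟨g, hg, rfl⟩ := hf.descent hi
    have hv' := hv.descent hi
    have hu' := hu.isLeftDescent_iff i
    rw [CoxeterSystem.IsLeftDescent] at hu' hlt
    simp only [hu', hu.simple_mul_mem_minReps_iff]
    rcases S.wt_cases hu.mem i with h | h | h
    · rw [if_pos h, rOp, if_pos h, ih _ (hn ▸ hlt) hv' (hu.descent h) hg rfl]
      congr 2
      exact (S.refl_of_wt_neg h).symm
    · rw [if_neg (by omega), if_neg (by omega), rOp, if_neg (by simp only; omega),
        if_neg (by simp only; omega), ih _ (hn ▸ hlt) hv' hu hg rfl]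
      ring
    · rw [if_neg (by omega), if_pos (by omega), rOp, if_neg (by simp only; omega), if_pos h,
        ih _ (hn ▸ hlt) hv' hu hg rfl, ih _ (hn ▸ hlt) hv' (hu.ascent h) hg rfl]
      congr 3
      exact Subtype.ext (S.refl_of_wt_one h).symm
  -- Without a left descent v is 1, and u ≤ 1 then forces u = v, a case already excluded.
  · exfalso
    have h4 : v = 1 := by
      by_contra hne
      exact h3 (cs.exists_leftDescent_of_ne_one hne)
    have h5 := act_le_of_bruhatLE (S := S) h1
    rw [h4, act_one, hu.act_eq] at h5
    have h6 : d = 0 := le_antisymm h5 (S.nonneg d hu.mem)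
    subst h6
    exact h2 (by rw [h4]; exact hu.unique Reach.zero)
  · refine (hf.eq_zero _ fun h => h1 (hu.bruhatLE hv h)).symm

end Rep

end WeightSystem

/-! ### Minuscule heaps in the plane -/

instance decidableBoxLT (x y : ℕ × ℕ) : Decidable (x < y) :=
  decidable_of_iff (x ≤ y ∧ ¬ y ≤ x) lt_iff_le_not_ge.symm

/-- A labelled finite set of boxes in the plane whose ideals index a minuscule orbit of weights. The
last four fields relate the labels to the position of the boxes. -/
structure MinusculeHeap {B : Type*} [Fintype B] [DecidableEq B] (M : CoxeterMatrix B) where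
  A : B → B → ℤ
  k : B
  A_diag : ∀ i, A i i = 2
  A_cases : ∀ i j, i ≠ j → (M i j = 2 ∧ A i j = 0 ∧ A j i = 0) ∨
    (M i j = 3 ∧ A i j = -1 ∧ A j i = -1) ∨
    (M i j = 4 ∧ A i j = -1 ∧ A j i = -2) ∨ (M i j = 4 ∧ A i j = -2 ∧ A j i = -1)
  boxes : Finset (ℕ × ℕ)
  label : ℕ × ℕ → B
  comparable : ∀ x ∈ boxes, ∀ y ∈ boxes, A (label x) (label y) ≠ 0 → x ≤ y ∨ y ≤ x
  adj_below : ∀ x ∈ boxes, ∀ y ∈ boxes, x < y →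
    ∃ z ∈ boxes, x ≤ z ∧ z < y ∧ A (label y) (label z) < 0
  adj_above : ∀ x ∈ boxes, ∀ y ∈ boxes, x < y →
    ∃ z ∈ boxes, x < z ∧ z ≤ y ∧ A (label x) (label z) < 0
  wt_below : ∀ x ∈ boxes, (if label x = k then 1 else 0) -
    ∑ z ∈ boxes with z < x, A (label x) (label z) = 1
  wt_top : ∀ i, (if i = k then 1 else 0) - ∑ z ∈ boxes, A i (label z) ≤ 0
  label_diag : ∀ a b, (a, b) ∈ boxes → (a + 1, b) ∈ boxes → (a, b + 1) ∈ boxes →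
    (a + 1, b + 1) ∈ boxes → label (a + 1, b + 1) = label (a, b)
  label_line : ∀ x ∈ boxes, ∀ y ∈ boxes, label x = label y → x.1 = y.1 ∨ x.2 = y.2 → x = y
  above_row : ∀ x ∈ boxes, ∀ a b, (a, b) ∈ boxes → (a, b + 1) ∈ boxes → x < (a, b + 1) →
    label x = label (a, b + 1) → ∃ w ∈ boxes, x < w ∧ w < (a, b + 1) ∧ w.1 < a
  right_col : ∀ x ∈ boxes, ∀ a b, (a, b) ∈ boxes → (a + 1, b) ∈ boxes → (a, b) < x →
    label x = label (a, b) → ∃ w ∈ boxes, (a, b) < w ∧ w < x ∧ b < w.2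

/-! ### Order ideals of a heap and their weights -/

namespace MinusculeHeap

variable {B : Type*} [Fintype B] [DecidableEq B] {M : CoxeterMatrix B} (H : MinusculeHeap M)

theorem A_nonpos {i j : B} (hij : i ≠ j) : H.A i j ≤ 0 := by
  rcases H.A_cases i j hij with h' | h' | h' | h' <;> omega

theorem comparable_of_label_eq {x y : ℕ × ℕ} (hx : x ∈ H.boxes) (hy : y ∈ H.boxes)
    (h : H.label x = H.label y) : x ≤ y ∨ y ≤ x :=
  H.comparable x hx y hy (by rw [h, H.A_diag]; norm_num)

/-- Order ideals. -/
def IsIdeal (D : Finset (ℕ × ℕ)) : Prop :=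
  D ⊆ H.boxes ∧ ∀ b ∈ D, ∀ c ∈ H.boxes, c ≤ b → c ∈ D

/-- The box `y` can be added to `D`. -/
def Addable (D : Finset (ℕ × ℕ)) (y : ℕ × ℕ) : Prop :=
  y ∈ H.boxes ∧ y ∉ D ∧ ∀ z ∈ H.boxes, z < y → z ∈ D

/-- The box `x` is a maximal box of `D`. -/
def Removable (D : Finset (ℕ × ℕ)) (x : ℕ × ℕ) : Prop := x ∈ D ∧ ∀ z ∈ D, ¬ x < z

/-- The pairing of the weight of `D` with the simple coroot `i`. -/
def wt (i : B) (D : Finset (ℕ × ℕ)) : ℤ := (if i = H.k then 1 else 0) - ∑ z ∈ D, H.A i (H.label z)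

variable {H} {D : Finset (ℕ × ℕ)} {i : B} {x y : ℕ × ℕ}

theorem IsIdeal.insert (hD : H.IsIdeal D) (hy : H.Addable D y) : H.IsIdeal (insert y D) := by
  refine ⟨Finset.insert_subset hy.1 hD.1, ?_⟩
  intro b hb c hc hcb
  rcases Finset.mem_insert.mp hb with rfl | hb
  · rcases hcb.eq_or_lt with rfl | h
    · exact hb
    · exact Finset.mem_insert_of_mem (hy.2.2 c hc h)
  · exact Finset.mem_insert_of_mem (hD.2 b hb c hc hcb)

theorem IsIdeal.erase (hD : H.IsIdeal D) (hx : Removable D x) : H.IsIdeal (D.erase x) := by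
  refine ⟨(Finset.erase_subset _ _).trans hD.1, ?_⟩
  intro b hb c hc hcb
  rw [Finset.mem_erase] at hb ⊢
  refine ⟨?_, hD.2 b hb.2 c hc hcb⟩
  rintro rfl
  exact hx.2 b hb.2 (lt_of_le_of_ne hcb (Ne.symm hb.1))

/-- Comparison of the weight of an ideal with that of the ideal below a box outside of it. -/
theorem IsIdeal.wt_eq_add (hD : H.IsIdeal D) (hy : y ∈ H.boxes) (hyD : y ∉ D) :
    H.wt (H.label y) D = 1 + ∑ z ∈ H.boxes with z < y ∧ z ∉ D, H.A (H.label y) (H.label z) := by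
  have h1 := H.wt_below y hy
  have h2 : ∑ z ∈ H.boxes with z < y, H.A (H.label y) (H.label z) =
      ∑ z ∈ H.boxes with z < y ∧ z ∈ D, H.A (H.label y) (H.label z) +
      ∑ z ∈ H.boxes with z < y ∧ z ∉ D, H.A (H.label y) (H.label z) := by
    rw [← Finset.sum_filter_add_sum_filter_not _ (· ∈ D), Finset.filter_filter,
      Finset.filter_filter]
  have h3 : ∑ z ∈ D, H.A (H.label y) (H.label z) =
      ∑ z ∈ H.boxes with z < y ∧ z ∈ D, H.A (H.label y) (H.label z) := by
    symm
    apply Finset.sum_subset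
    · intro z hz
      exact (Finset.mem_filter.mp hz).2.2
    · intro z hz hz'
      by_contra hne
      apply hz'
      rw [Finset.mem_filter]
      refine ⟨hD.1 hz, ?_, hz⟩
      rcases H.comparable y hy z (hD.1 hz) hne with h | h
      · exact absurd (hD.2 z hz y hy h) hyD
      · refine lt_of_le_of_ne h ?_
        rintro rfl
        exact hyD hz
  rw [wt, h3]
  linarith

/-- Comparison of the weight of an ideal with that of the ideal generated by one of its boxes. -/
theorem IsIdeal.wt_eq_sub (hD : H.IsIdeal D) (hx : x ∈ D) :
    H.wt (H.label x) D = -1 - ∑ z ∈ D with ¬ z ≤ x, H.A (H.label x) (H.label z) := by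
  have h1 := H.wt_below x (hD.1 hx)
  have h2 : D.filter (· ≤ x) = Insert.insert x (H.boxes.filter (· < x)) := by
    ext z
    simp only [Finset.mem_filter, Finset.mem_insert]
    constructor
    · rintro ⟨h, h'⟩
      rcases h'.eq_or_lt with h' | h'
      · exact Or.inl h'
      · exact Or.inr ⟨hD.1 h, h'⟩
    · rintro (rfl | ⟨h, h'⟩)
      · exact ⟨hx, le_rfl⟩
      · exact ⟨hD.2 x hx z h h'.le, h'.le⟩
  have h3 : ∑ z ∈ D with z ≤ x, H.A (H.label x) (H.label z) =
      2 + ∑ z ∈ H.boxes with z < x, H.A (H.label x) (H.label z) := by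
    rw [h2, Finset.sum_insert (by simp), H.A_diag]
  rw [wt, ← Finset.sum_filter_add_sum_filter_not D (· ≤ x), h3]
  linarith

theorem IsIdeal.wt_of_addable (hD : H.IsIdeal D) (hy : H.Addable D y) :
    H.wt (H.label y) D = 1 := by
  rw [hD.wt_eq_add hy.1 hy.2.1, Finset.filter_eq_empty_iff.mpr]
  · simp
  · rintro z hz ⟨h, h'⟩
    exact h' (hy.2.2 z hz h)

theorem IsIdeal.wt_of_removable (hD : H.IsIdeal D) (hx : Removable D x) :
    H.wt (H.label x) D = -1 := by
  rw [hD.wt_eq_sub hx.1, Finset.sum_eq_zero]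
  · simp
  · intro z hz
    rw [Finset.mem_filter] at hz
    by_contra hne
    rcases H.comparable x (hD.1 hx.1) z (hD.1 hz.1) hne with h | h
    · exact hx.2 z hz.1 (lt_of_le_not_ge h hz.2)
    · exact hz.2 h

/-- Let y be a minimal box of label i outside D. Missing boxes below y contribute nonpositively, and
not at all only if none is missing, since one of them would be adjacent to y. If there is no such y,
then D is compared with the whole heap. -/
theorem IsIdeal.wt_le (hD : H.IsIdeal D) (i : B) :
    H.wt i D ≤ 0 ∨ H.wt i D = 1 ∧ ∃ y, H.label y = i ∧ H.Addable D y := by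
  by_cases hne : (H.boxes.filter fun z => z ∉ D ∧ H.label z = i).Nonempty
  · obtain ⟨y, hy⟩ := Finset.exists_minimal hne
    obtain ⟨hym, hymin⟩ := hy
    rw [Finset.mem_filter] at hym
    obtain ⟨hyb, hyD, rfl⟩ := hym
    rw [hD.wt_eq_add hyb hyD]
    have hneg : ∀ z ∈ H.boxes.filter (fun z => z < y ∧ z ∉ D),
        H.A (H.label y) (H.label z) ≤ 0 := by
      intro z hz
      rw [Finset.mem_filter] at hz
      apply H.A_nonpos
      intro h
      exact absurd (hymin (Finset.mem_filter.mpr ⟨hz.1, hz.2.2, h.symm⟩) hz.2.1.le)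
        (not_le_of_gt hz.2.1)
    rcases (Finset.sum_nonpos hneg).lt_or_eq with h | h
    · left
      omega
    · right
      refine ⟨by omega, y, rfl, hyb, hyD, ?_⟩
      intro z hz hzy
      by_contra hzD
      obtain ⟨w, hw, hzw, hwy, hneg'⟩ := H.adj_below z hz y hyb hzy
      have := (Finset.sum_eq_zero_iff_of_nonpos hneg).mp h w
        (Finset.mem_filter.mpr ⟨hw, hwy, fun hwD => hzD (hD.2 w hwD z hz hzw)⟩)
      omega
  · left
    rw [Finset.not_nonempty_iff_eq_empty, Finset.filter_eq_empty_iff] at hne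
    refine le_trans ?_ (H.wt_top i)
    have h1 : ∑ z ∈ H.boxes \ D, H.A i (H.label z) ≤ 0 := by
      apply Finset.sum_nonpos
      intro z hz
      rw [Finset.mem_sdiff] at hz
      exact H.A_nonpos fun h => hne hz.1 ⟨hz.2, h.symm⟩
    have h2 := Finset.sum_sdiff (f := fun z => H.A i (H.label z)) hD.1
    rw [wt]
    linarith

/-- Dual to `IsIdeal.wt_le`, with a maximal box of label i in D; if D has no box of label i, every
Cartan entry in the sum is nonpositive. -/
theorem IsIdeal.le_wt (hD : H.IsIdeal D) (i : B) :
    0 ≤ H.wt i D ∨ H.wt i D = -1 ∧ ∃ x, H.label x = i ∧ Removable D x := by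
  by_cases hne : (D.filter fun z => H.label z = i).Nonempty
  · obtain ⟨x, hx⟩ := Finset.exists_maximal hne
    obtain ⟨hxm, hxmax⟩ := hx
    rw [Finset.mem_filter] at hxm
    obtain ⟨hxD, rfl⟩ := hxm
    rw [hD.wt_eq_sub hxD]
    have hneg : ∀ z ∈ D.filter (fun z => ¬ z ≤ x), H.A (H.label x) (H.label z) ≤ 0 := by
      intro z hz
      rw [Finset.mem_filter] at hz
      apply H.A_nonpos
      intro h
      rcases H.comparable_of_label_eq (hD.1 hxD) (hD.1 hz.1) h with h' | h'
      · exact hz.2 (hxmax (Finset.mem_filter.mpr ⟨hz.1, h.symm⟩) h')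
      · exact hz.2 h'
    rcases (Finset.sum_nonpos hneg).lt_or_eq with h | h
    · left
      omega
    · right
      refine ⟨by omega, x, rfl, hxD, ?_⟩
      intro z hz hxz
      obtain ⟨w, hw, hxw, hwz, hneg'⟩ := H.adj_above x (hD.1 hxD) z (hD.1 hz) hxz
      have := (Finset.sum_eq_zero_iff_of_nonpos hneg).mp h w
        (Finset.mem_filter.mpr ⟨hD.2 z hz w hw hwz, not_le_of_gt hxw⟩)
      omega
  · left
    rw [Finset.not_nonempty_iff_eq_empty, Finset.filter_eq_empty_iff] at hne
    have h1 : ∑ z ∈ D, H.A i (H.label z) ≤ 0 :=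
      Finset.sum_nonpos fun z hz => H.A_nonpos fun h => hne hz h.symm
    rw [wt]
    split_ifs <;> omega

variable (H) in
/-- The number of boxes of each label. -/
def count (D : Finset (ℕ × ℕ)) : B → ℤ := ∑ z ∈ D, Pi.single (H.label z) 1

theorem count_insert (hy : y ∉ D) : H.count (insert y D) = H.count D + Pi.single (H.label y) 1 := by
  rw [count, Finset.sum_insert hy, add_comm, count]

theorem count_erase (hx : x ∈ D) : H.count (D.erase x) = H.count D - Pi.single (H.label x) 1 := by
  rw [eq_sub_iff_add_eq, count, Finset.sum_erase_add _ _ hx, count]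

theorem count_apply (D : Finset (ℕ × ℕ)) (i : B) :
    H.count D i = ((D.filter fun z => H.label z = i).card : ℤ) := by
  rw [count, Finset.sum_apply, Finset.card_filter]
  push_cast
  refine Finset.sum_congr rfl fun z _ => ?_
  rw [Pi.single_apply]
  simp only [eq_comm]

theorem wt_eq (i : B) (D : Finset (ℕ × ℕ)) :
    (if i = H.k then 1 else 0) - ∑ j, H.A i j * H.count D j = H.wt i D := by
  rw [wt]
  congr 1
  simp only [count, Finset.sum_apply, Finset.mul_sum]
  rw [Finset.sum_comm]
  refine Finset.sum_congr rfl fun z _ => ?_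
  rw [Finset.sum_eq_single (H.label z)]
  · simp
  · intro b _ hb
    simp [Pi.single_eq_of_ne hb]
  · simp

/-- Boxes of equal label form a chain, which an ideal meets in an initial segment, so the counts
determine the ideal. -/
theorem IsIdeal.subset_of_count_le {D' : Finset (ℕ × ℕ)} (hD : H.IsIdeal D) (hD' : H.IsIdeal D')
    (h : H.count D' ≤ H.count D) : D' ⊆ D := by
  intro b hb
  by_contra hbD
  have h1 := h (H.label b)
  rw [count_apply, count_apply, Nat.cast_le] at h1
  refine absurd h1 (not_le_of_gt (Finset.card_lt_card ?_))
  rw [Finset.ssubset_iff_of_subset]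
  · exact ⟨b, by simpa using hb, by simp [hbD]⟩
  · intro z hz
    rw [Finset.mem_filter] at hz ⊢
    refine ⟨?_, hz.2⟩
    rcases H.comparable_of_label_eq (hD.1 hz.1) (hD'.1 hb) hz.2 with h' | h'
    · exact hD'.2 b hb z (hD.1 hz.1) h'
    · exact absurd (hD.2 z hz.1 b (hD'.1 hb) h') hbD

theorem IsIdeal.exists_removable {D' : Finset (ℕ × ℕ)} (hD : H.IsIdeal D) (hD' : H.IsIdeal D')
    (h : D' ⊂ D) : ∃ x, Removable D x ∧ x ∉ D' := by
  have hne : (D \ D').Nonempty := Finset.sdiff_nonempty.mpr h.2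
  obtain ⟨x, hx, hmax⟩ := Finset.exists_maximal hne
  rw [Finset.mem_sdiff] at hx
  refine ⟨x, ⟨hx.1, fun z hz hxz => ?_⟩, hx.2⟩
  by_cases hzD : z ∈ D'
  · exact hx.2 (hD'.2 z hzD x (hD.1 hx.1) hxz.le)
  · exact absurd (hmax (Finset.mem_sdiff.mpr ⟨hz, hzD⟩) hxz.le) (not_le_of_gt hxz)

theorem count_mono {D' : Finset (ℕ × ℕ)} (h : D' ⊆ D) : H.count D' ≤ H.count D := by
  intro i
  rw [count_apply, count_apply, Nat.cast_le]
  exact Finset.card_le_card (Finset.filter_subset_filter _ h)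

variable (H) in
theorem isIdeal_empty : H.IsIdeal ∅ := ⟨by simp, by simp⟩

variable (H) in
/-- The weights of the ideals of a heap. -/
def weightSystem : WeightSystem M where
  A := H.A
  k := H.k
  A_diag := H.A_diag
  A_cases := H.A_cases
  carrier := {c | ∃ D, H.IsIdeal D ∧ c = H.count D}
  zero_mem := ⟨∅, H.isIdeal_empty, by simp [count]⟩
  nonneg := by
    rintro c ⟨D, -, rfl⟩ i
    rw [count_apply]
    simp
  wt_mem := by
    rintro c ⟨D, hD, rfl⟩ i
    rw [wt_eq]
    rcases hD.wt_le i with h | h <;> rcases hD.le_wt i with h' | h' <;> omega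
  refl_mem := by
    rintro c ⟨D, hD, rfl⟩ i
    rw [wt_eq]
    rcases hD.wt_le i with h | ⟨h, y, rfl, hy⟩
    · rcases hD.le_wt i with h' | ⟨h', x, rfl, hx⟩
      · rw [le_antisymm h h', Pi.single_zero, add_zero]
        exact ⟨D, hD, rfl⟩
      · refine ⟨_, hD.erase hx, ?_⟩
        rw [h', count_erase hx.1, Pi.single_neg, sub_eq_add_neg]
    · refine ⟨_, hD.insert hy, ?_⟩
      rw [h, count_insert hy.2.1]
  exists_descent := by
    rintro c ⟨D, hD, rfl⟩ d ⟨D', hD', rfl⟩ hle hne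
    have hsub := hD.subset_of_count_le hD' hle
    obtain ⟨x, hx, hxD⟩ := hD.exists_removable hD' (hsub.ssubset_of_ne (by rintro rfl; exact hne rfl))
    refine ⟨H.label x, ?_, ?_⟩
    · have h1 : H.count (insert x D') (H.label x) ≤ H.count D (H.label x) :=
        count_mono (Finset.insert_subset hx.1 hsub) _
      rw [count_insert hxD, Pi.add_apply, Pi.single_eq_same] at h1
      omega
    · rw [wt_eq, hD.wt_of_removable hx]

theorem wt_weightSystem (i : B) (D : Finset (ℕ × ℕ)) :
    H.weightSystem.wt i (H.count D) = H.wt i D := wt_eq i D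

theorem IsIdeal.mem (hD : H.IsIdeal D) : H.count D ∈ H.weightSystem.carrier := ⟨D, hD, rfl⟩

variable (H) in
open Classical in
/-- The relative `R`-polynomial of a pair of ideals. -/
noncomputable def relRIdeal (L D : Finset (ℕ × ℕ)) : ℤ[X] :=
  if h : H.IsIdeal L ∧ H.IsIdeal D then
    (WeightSystem.exists_reach H.weightSystem.rOp H.weightSystem.rInit h.2.mem).choose
      ⟨H.count L, h.1.mem⟩
  else 0

variable {L : Finset (ℕ × ℕ)}

theorem relRIdeal_eq (hL : H.IsIdeal L) (hD : H.IsIdeal D) {f : H.weightSystem.carrier → ℤ[X]}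
    (hf : H.weightSystem.IsRVector (H.count D) f) : H.relRIdeal L D = f ⟨H.count L, hL.mem⟩ := by
  rw [relRIdeal, dif_pos ⟨hL, hD⟩]
  exact congrFun (WeightSystem.IsRVector.unique (WeightSystem.exists_reach H.weightSystem.rOp
    H.weightSystem.rInit hD.mem).choose_spec hf) _

theorem exists_isRVector (hD : H.IsIdeal D) :
    ∃ f, H.weightSystem.IsRVector (H.count D) f := WeightSystem.exists_reach _ _ hD.mem

theorem relRIdeal_self (hD : H.IsIdeal D) : H.relRIdeal D D = 1 := by
  obtain ⟨f, hf⟩ := exists_isRVector hD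
  rw [relRIdeal_eq hD hD hf, hf.eq_one _ rfl]

theorem relRIdeal_erase_of_wt_zero (hL : H.IsIdeal L) (hD : H.IsIdeal D) (hx : Removable D x)
    (h : H.wt (H.label x) L = 0) : H.relRIdeal L D = X * H.relRIdeal L (D.erase x) := by
  obtain ⟨f, hf⟩ := exists_isRVector hD
  obtain ⟨g, hg, rfl⟩ := hf.descent (i := H.label x) (by
    rw [wt_weightSystem, hD.wt_of_removable hx])
  rw [relRIdeal_eq hL hD hf]
  rw [← count_erase hx.1] at hg
  rw [relRIdeal_eq hL (hD.erase hx) hg, WeightSystem.rOp]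
  simp only [wt_weightSystem, h]
  simp

theorem relRIdeal_erase_of_addable (hL : H.IsIdeal L) (hD : H.IsIdeal D) (hx : Removable D x)
    (hy : H.Addable L y) (hxy : H.label x = H.label y) :
    H.relRIdeal L D = (X - 1) * H.relRIdeal L (D.erase x) +
      X * H.relRIdeal (insert y L) (D.erase x) := by
  obtain ⟨f, hf⟩ := exists_isRVector hD
  obtain ⟨g, hg, rfl⟩ := hf.descent (i := H.label x) (by
    rw [wt_weightSystem, hD.wt_of_removable hx])
  rw [relRIdeal_eq hL hD hf]
  rw [← count_erase hx.1] at hg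
  have hw : H.weightSystem.wt (H.label x) (H.count L) = 1 := by
    rw [wt_weightSystem, hxy, hL.wt_of_addable hy]
  rw [relRIdeal_eq hL (hD.erase hx) hg, relRIdeal_eq (hL.insert hy) (hD.erase hx) hg,
    WeightSystem.rOp, if_neg (by rw [hw]; norm_num), if_pos hw]
  congr 3
  apply Subtype.ext
  rw [WeightSystem.coe_reflect, WeightSystem.refl_of_wt_one _ hw, hxy]
  exact (count_insert hy.2.1).symm

/-- The upper ideal is fixed by the reflection, so `IsRVector.fixed` applies. Evaluated at the lower
ideal enlarged by y, where the pairing is -1, the operator returns the value at L. -/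
theorem relRIdeal_insert (hL : H.IsIdeal L) (hD : H.IsIdeal D) (hy : H.Addable L y)
    (h : H.wt (H.label y) D = 0) : H.relRIdeal L D = X * H.relRIdeal (insert y L) D := by
  obtain ⟨f, hf⟩ := exists_isRVector hD
  have hfix := hf.fixed (i := H.label y) (by rw [wt_weightSystem, h])
  rw [relRIdeal_eq hL hD hf, relRIdeal_eq (hL.insert hy) hD hf]
  have h1 := congrFun hfix ⟨H.count (insert y L), (hL.insert hy).mem⟩
  rw [← h1, WeightSystem.rOp, if_pos]
  · congr 1
    apply Subtype.ext
    rw [WeightSystem.coe_reflect, WeightSystem.refl_of_wt_neg]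
    · simp [count_insert hy.2.1]
    · simp only [wt_weightSystem]
      rw [(hL.insert hy).wt_of_removable]
      refine ⟨Finset.mem_insert_self _ _, fun z hz hlt => ?_⟩
      rcases Finset.mem_insert.mp hz with rfl | hz
      · exact lt_irrefl _ hlt
      · exact hy.2.1 (hL.2 z hz y hy.1 hlt.le)
  · simp only [wt_weightSystem]
    rw [(hL.insert hy).wt_of_removable]
    refine ⟨Finset.mem_insert_self _ _, fun z hz hlt => ?_⟩
    rcases Finset.mem_insert.mp hz with rfl | hz
    · exact lt_irrefl _ hlt
    · exact hy.2.1 (hL.2 z hz y hy.1 hlt.le)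

end MinusculeHeap

/-! ### Convex sets of boxes and their corners -/

/-- Order convexity in the plane. -/
def IsConvexShape (S : Finset (ℕ × ℕ)) : Prop :=
  ∀ x ∈ S, ∀ y ∈ S, ∀ z, x ≤ z → z ≤ y → z ∈ S

/-- The first row of `S` is row `r` and starts at column `e`; the last column of `S` is column
`e + l` and ends at row `r + k`. -/
structure IsCorner (S : Finset (ℕ × ℕ)) (r e k l : ℕ) : Prop where
  bound : ∀ z ∈ S, r ≤ z.1 ∧ z.2 ≤ e + l
  top : (r, e) ∈ S
  bottom : (r + k, e + l) ∈ S
  left : ∀ z ∈ S, z.1 = r → e ≤ z.2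
  low : ∀ z ∈ S, z.2 = e + l → z.1 ≤ r + k

theorem exists_isCorner {S : Finset (ℕ × ℕ)} (hS : S.Nonempty) : ∃ r e k l, IsCorner S r e k l := by
  obtain ⟨x, hx, hxmin⟩ := S.exists_min_image Prod.fst hS
  obtain ⟨y, hy, hymin⟩ := (S.filter fun z => z.1 = x.1).exists_min_image Prod.snd
    ⟨x, by simp [hx]⟩
  obtain ⟨u, hu, humax⟩ := S.exists_max_image Prod.snd hS
  obtain ⟨v, hv, hvmax⟩ := (S.filter fun z => z.2 = u.2).exists_max_image Prod.fst
    ⟨u, by simp [hu]⟩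
  rw [Finset.mem_filter] at hy hv
  have h1 := humax y hy.1
  have h2 := hxmin v hv.1
  refine ⟨x.1, y.2, v.1 - x.1, u.2 - y.2, ?_⟩
  have e1 : x.1 + (v.1 - x.1) = v.1 := by omega
  have e2 : y.2 + (u.2 - y.2) = u.2 := by omega
  constructor
  · intro z hz
    rw [e2]
    exact ⟨hxmin z hz, humax z hz⟩
  · rw [← hy.2]
    exact hy.1
  · rw [e1, e2, ← hv.2]
    exact hv.1
  · intro z hz hzr
    exact hymin z (by simp [hz, hzr])
  · intro z hz hzc
    rw [e1]
    rw [e2] at hzc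
    exact hvmax z (by simp [hz, hzc])

theorem IsCorner.rect {S : Finset (ℕ × ℕ)} {r e k l : ℕ} (h : IsCorner S r e k l)
    (hS : IsConvexShape S) {a b : ℕ} (ha : r ≤ a) (ha' : a ≤ r + k) (hb : e ≤ b)
    (hb' : b ≤ e + l) : (a, b) ∈ S :=
  hS _ h.top _ h.bottom _ ⟨ha, hb⟩ ⟨ha', hb'⟩

theorem IsConvexShape.erase_maximal {S : Finset (ℕ × ℕ)} (hS : IsConvexShape S) {x : ℕ × ℕ}
    (hx : ∀ z ∈ S, ¬ x < z) : IsConvexShape (S.erase x) := by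
  intro a ha b hb z haz hzb
  rw [Finset.mem_erase] at ha hb ⊢
  refine ⟨?_, hS a ha.2 b hb.2 z haz hzb⟩
  rintro rfl
  exact hx b hb.2 (lt_of_le_of_ne hzb (Ne.symm hb.1))

theorem IsConvexShape.erase_minimal {S : Finset (ℕ × ℕ)} (hS : IsConvexShape S) {x : ℕ × ℕ}
    (hx : ∀ z ∈ S, ¬ z < x) : IsConvexShape (S.erase x) := by
  intro a ha b hb z haz hzb
  rw [Finset.mem_erase] at ha hb ⊢
  refine ⟨?_, hS a ha.2 b hb.2 z haz hzb⟩
  rintro rfl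
  exact hx a ha.2 (lt_of_le_of_ne haz ha.1)

theorem IsCorner.top_minimal {S : Finset (ℕ × ℕ)} {r e k l : ℕ} (h : IsCorner S r e k l) :
    ∀ z ∈ S, ¬ z < (r, e) := by
  intro z hz hlt
  obtain ⟨h1, h2⟩ := hlt.le
  simp only at h1 h2
  have h3 := (h.bound z hz).1
  have h4 := h.left z hz (by omega)
  exact hlt.ne (Prod.ext (by simp only; omega) (by simp only; omega))

theorem IsCorner.bottom_maximal {S : Finset (ℕ × ℕ)} {r e k l : ℕ} (h : IsCorner S r e k l) :
    ∀ z ∈ S, ¬ (r + k, e + l) < z := by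
  intro z hz hlt
  obtain ⟨h1, h2⟩ := hlt.le
  simp only at h1 h2
  have h3 := (h.bound z hz).2
  have h4 := h.low z hz (by omega)
  exact hlt.ne (Prod.ext (by simp only; omega) (by simp only; omega))

/-! ### The recursion at the corners of a convex skew shape -/

namespace MinusculeHeap

variable {B : Type*} [Fintype B] [DecidableEq B] {M : CoxeterMatrix B} {H : MinusculeHeap M}
  {L D : Finset (ℕ × ℕ)} {x y : ℕ × ℕ} {r e k l : ℕ}

theorem label_square (a b m : ℕ)
    (h : ∀ p q, a ≤ p → p ≤ a + m → b ≤ q → q ≤ b + m → (p, q) ∈ H.boxes) :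
    H.label (a + m, b + m) = H.label (a, b) := by
  induction m with
  | zero => rfl
  | succ m ih =>
    rw [← ih fun p q h1 h2 h3 h4 => h p q h1 (by omega) h3 (by omega), ← add_assoc, ← add_assoc]
    exact H.label_diag _ _ (h _ _ (by omega) (by omega) (by omega) (by omega))
      (h _ _ (by omega) (by omega) (by omega) (by omega))
      (h _ _ (by omega) (by omega) (by omega) (by omega))
      (h _ _ (by omega) (by omega) (by omega) (by omega))

theorem removable_of_maximal (hL : H.IsIdeal L) (hD : H.IsIdeal D) (hx : x ∈ D \ L)
    (hmax : ∀ z ∈ D \ L, ¬ x < z) : Removable D x := by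
  rw [Finset.mem_sdiff] at hx
  refine ⟨hx.1, fun z hz hxz => ?_⟩
  by_cases hzL : z ∈ L
  · exact hx.2 (hL.2 z hzL x (hD.1 hx.1) hxz.le)
  · exact hmax z (Finset.mem_sdiff.mpr ⟨hz, hzL⟩) hxz

theorem addable_of_minimal (hD : H.IsIdeal D) (hx : x ∈ D \ L)
    (hmin : ∀ z ∈ D \ L, ¬ z < x) : H.Addable L x := by
  rw [Finset.mem_sdiff] at hx
  refine ⟨hD.1 hx.1, hx.2, fun z hz hzx => ?_⟩
  by_contra hzL
  exact hmin z (Finset.mem_sdiff.mpr ⟨hD.2 x hx.1 z hz hzx.le, hzL⟩) hzx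

/-- If the first row is longer than the last column, then the weight of the lower ideal is fixed by
the label of the last box of the last column. -/
theorem wt_lower_eq_zero (hL : H.IsIdeal L) (hD : H.IsIdeal D)
    (hS : IsConvexShape (D \ L)) (hc : IsCorner (D \ L) r e k l) (hkl : k < l) :
    H.wt (H.label (r + k, e + l)) L = 0 := by
  have hbox : ∀ z ∈ D \ L, z ∈ H.boxes := fun z hz => hD.1 (Finset.mem_sdiff.mp hz).1
  have hx := Finset.mem_sdiff.mp hc.bottom
  have hrem := removable_of_maximal hL hD hc.bottom hc.bottom_maximal
  -- Move k steps up the diagonal inside the rectangle. As k < l, the box reached in the first row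
  -- still has a left neighbour (r, b) in the skew shape.
  have hlab : H.label (r + k, e + l) = H.label (r, e + (l - k)) := by
    have h := label_square (H := H) r (e + (l - k)) k fun p q h1 h2 h3 h4 =>
      hbox _ (hc.rect hS h1 h2 (by omega) (by omega))
    rwa [show e + (l - k) + k = e + l by omega] at h
  have hz : (r, e + (l - k)) ∈ D \ L :=
    hc.rect hS (by omega) (by omega) (by omega) (by omega)
  obtain ⟨b, hb⟩ : ∃ b, e + (l - k) = b + 1 := ⟨e + (l - k) - 1, by omega⟩
  rw [hb] at hlab hz
  have hz' : (r, b) ∈ D \ L := hc.rect hS (by omega) (by omega) (by omega) (by omega)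
  have hzs := Finset.mem_sdiff.mp hz
  have hzs' := Finset.mem_sdiff.mp hz'
  have hlt : (r, b) < (r, b + 1) := by
    rw [Prod.lt_iff]
    right
    simp
  rcases hL.wt_le (H.label (r + k, e + l)) with h | ⟨-, y0, hy0, hadd⟩
  · rcases hL.le_wt (H.label (r + k, e + l)) with h' | ⟨-, x0, hx0, hrem0⟩
    · omega
    -- A maximal box x0 of L with this label lies below (r, b + 1). Some box strictly between them
    -- lies above row r, hence in L, against maximality.
    · exfalso
      rw [hlab] at hx0
      have hlt0 : x0 < (r, b + 1) := by
        have hne : x0 ≠ (r, b + 1) := by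
          rintro rfl
          exact hzs.2 hrem0.1
        rcases H.comparable_of_label_eq (hL.1 hrem0.1) (hbox _ hz) hx0 with h1 | h1
        · exact lt_of_le_of_ne h1 hne
        · exact absurd (hL.2 _ hrem0.1 _ (hbox _ hz) h1) hzs.2
      obtain ⟨w, hw, h1, h2, h3⟩ := H.above_row x0 (hL.1 hrem0.1) r b (hbox _ hz') (hbox _ hz)
        hlt0 hx0
      have hwD := hD.2 _ hzs.1 w hw h2.le
      have hwL : w ∈ L := by
        by_contra hwL
        have := (hc.bound w (Finset.mem_sdiff.mpr ⟨hwD, hwL⟩)).1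
        omega
      exact hrem0.2 w hwL h1
  -- An addable box y0 with this label lies in the first row and so equals (r, b + 1), but its left
  -- neighbour is missing from L.
  · exfalso
    have hy0D : y0 ∈ D := by
      rcases H.comparable_of_label_eq hadd.1 (hbox _ hc.bottom) hy0 with h1 | h1
      · exact hD.2 _ hx.1 _ hadd.1 h1
      · rcases h1.eq_or_lt with h1 | h1
        · rw [← h1]
          exact hx.1
        · exact absurd (hadd.2.2 _ (hbox _ hc.bottom) h1) hx.2
    have hy0S : y0 ∈ D \ L := Finset.mem_sdiff.mpr ⟨hy0D, hadd.2.1⟩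
    have hle : y0 ≤ (r, b + 1) := by
      rcases H.comparable_of_label_eq hadd.1 (hbox _ hz) (hy0.trans hlab) with h1 | h1
      · exact h1
      · rcases h1.eq_or_lt with h1 | h1
        · exact h1.ge
        · exact absurd (hadd.2.2 _ (hbox _ hz) h1) hzs.2
    have hrow : y0.1 = r := le_antisymm hle.1 (hc.bound _ hy0S).1
    have heq := H.label_line y0 hadd.1 _ (hbox _ hz) (hy0.trans hlab) (Or.inl hrow)
    subst heq
    exact hzs'.2 (hadd.2.2 _ (hbox _ hz') hlt)

/-- If the last column is longer than the first row, then the weight of the upper ideal is fixed by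
the label of the first box of the first row. -/
theorem wt_upper_eq_zero (hL : H.IsIdeal L) (hD : H.IsIdeal D)
    (hS : IsConvexShape (D \ L)) (hc : IsCorner (D \ L) r e k l) (hkl : l < k) :
    H.wt (H.label (r, e)) D = 0 := by
  have hbox : ∀ z ∈ D \ L, z ∈ H.boxes := fun z hz => hD.1 (Finset.mem_sdiff.mp hz).1
  have hy := Finset.mem_sdiff.mp hc.top
  have hlab : H.label (r, e) = H.label (r + l, e + l) :=
    (label_square (H := H) r e l fun p q h1 h2 h3 h4 =>
      hbox _ (hc.rect hS h1 (by omega) (by omega) (by omega))).symm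
  have hw : (r + l, e + l) ∈ D \ L :=
    hc.rect hS (by omega) (by omega) (by omega) (by omega)
  have hw' : (r + l + 1, e + l) ∈ D \ L :=
    hc.rect hS (by omega) (by omega) (by omega) (by omega)
  have hws := Finset.mem_sdiff.mp hw
  have hws' := Finset.mem_sdiff.mp hw'
  have hlt : (r + l, e + l) < (r + l + 1, e + l) := by
    rw [Prod.lt_iff]
    left
    simp
  rcases hD.le_wt (H.label (r, e)) with h | ⟨-, x0, hx0, hrem⟩
  · rcases hD.wt_le (H.label (r, e)) with h' | ⟨-, y0, hy0, hadd⟩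
    · omega
    -- The argument of `wt_lower_eq_zero` turned around: a box between (r + l, e + l) and y0 to the
    -- right of the last column would be in D but not in L.
    · exfalso
      rw [hlab] at hy0
      have hlt0 : (r + l, e + l) < y0 := by
        have hne : (r + l, e + l) ≠ y0 := by
          rintro rfl
          exact hadd.2.1 hws.1
        rcases H.comparable_of_label_eq (hbox _ hw) hadd.1 hy0.symm with h1 | h1
        · exact lt_of_le_of_ne h1 hne
        · exact absurd (hD.2 _ hws.1 _ hadd.1 h1) hadd.2.1
      obtain ⟨w, hwb, h1, h2, h3⟩ := H.right_col y0 hadd.1 (r + l) (e + l) (hbox _ hw)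
        (hbox _ hw') hlt0 hy0
      have hwD := hadd.2.2 w hwb h2
      have hwL : w ∉ L := fun hwL => hws.2 (hL.2 w hwL _ (hbox _ hw) h1.le)
      have := (hc.bound w (Finset.mem_sdiff.mpr ⟨hwD, hwL⟩)).2
      omega
  -- A removable box with this label would be (r + l, e + l), which still has a box of D directly
  -- below it.
  · exfalso
    have hx0b := hD.1 hrem.1
    have hx0L : x0 ∉ L := by
      intro hx0L
      rcases H.comparable_of_label_eq (hbox _ hc.top) hx0b hx0.symm with h1 | h1
      · exact hy.2 (hL.2 _ hx0L _ (hbox _ hc.top) h1)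
      · rcases h1.eq_or_lt with h1 | h1
        · rw [h1] at hx0L
          exact hy.2 hx0L
        · exact hrem.2 _ hy.1 h1
    have hx0S : x0 ∈ D \ L := Finset.mem_sdiff.mpr ⟨hrem.1, hx0L⟩
    have hle : (r + l, e + l) ≤ x0 := by
      rcases H.comparable_of_label_eq (hbox _ hw) hx0b (hlab.symm.trans hx0.symm) with h1 | h1
      · exact h1
      · rcases h1.eq_or_lt with h1 | h1
        · exact h1.ge
        · exact absurd h1 (hrem.2 _ hws.1)
    have hcol : x0.2 = e + l := le_antisymm (hc.bound _ hx0S).2 hle.2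
    have heq := H.label_line x0 hx0b _ (hbox _ hw) (hx0.trans hlab) (Or.inr hcol)
    subst heq
    exact hrem.2 _ hws'.1 hlt

theorem relRIdeal_eq_zero (hL : H.IsIdeal L) (hD : H.IsIdeal D) (h : ¬ L ⊆ D) :
    H.relRIdeal L D = 0 := by
  obtain ⟨f, hf⟩ := exists_isRVector hD
  rw [relRIdeal_eq hL hD hf]
  exact hf.eq_zero _ fun hle => h (hD.subset_of_count_le hL hle)

theorem relRIdeal_of_lt (hL : H.IsIdeal L) (hD : H.IsIdeal D)
    (hS : IsConvexShape (D \ L)) (hc : IsCorner (D \ L) r e k l) (hkl : k < l) :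
    H.relRIdeal L D = X * H.relRIdeal L (D.erase (r + k, e + l)) :=
  relRIdeal_erase_of_wt_zero hL hD (removable_of_maximal hL hD hc.bottom hc.bottom_maximal)
    (wt_lower_eq_zero hL hD hS hc hkl)

theorem relRIdeal_of_gt (hL : H.IsIdeal L) (hD : H.IsIdeal D)
    (hS : IsConvexShape (D \ L)) (hc : IsCorner (D \ L) r e k l) (hkl : l < k) :
    H.relRIdeal L D = X * H.relRIdeal (insert (r, e) L) D :=
  relRIdeal_insert hL hD (addable_of_minimal hD hc.top hc.top_minimal)
    (wt_upper_eq_zero hL hD hS hc hkl)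

/-- The rectangle is a square, so its opposite corners share a label, and one reflection both
removes the last box from D and adds the first box to L. -/
theorem relRIdeal_of_eq (hL : H.IsIdeal L) (hD : H.IsIdeal D)
    (hS : IsConvexShape (D \ L)) (hc : IsCorner (D \ L) r e k k) :
    H.relRIdeal L D = (X - 1) * H.relRIdeal L (D.erase (r + k, e + k)) +
      X * H.relRIdeal (insert (r, e) L) (D.erase (r + k, e + k)) :=
  relRIdeal_erase_of_addable hL hD (removable_of_maximal hL hD hc.bottom hc.bottom_maximal)
    (addable_of_minimal hD hc.top hc.top_minimal)
    (label_square r e k fun _ _ h1 h2 h3 h4 =>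
      hD.1 (Finset.mem_sdiff.mp (hc.rect hS h1 h2 h3 h4)).1)

end MinusculeHeap

/-! ### Comparison of heaps -/

theorem isConvexShape_image_add {S : Finset (ℕ × ℕ)} {a : ℕ × ℕ} :
    IsConvexShape (S.image (· + a)) ↔ IsConvexShape S := by
  have hmem : ∀ z, z + a ∈ S.image (· + a) ↔ z ∈ S := by
    intro z
    simp
  constructor
  · intro h x hx y hy z hxz hzy
    exact (hmem z).mp (h _ ((hmem x).mpr hx) _ ((hmem y).mpr hy) _ (by gcongr) (by gcongr))
  · intro h x' hx' y' hy' z hxz hzy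
    obtain ⟨x, hx, rfl⟩ := Finset.mem_image.mp hx'
    obtain ⟨y, hy, rfl⟩ := Finset.mem_image.mp hy'
    obtain ⟨c, rfl⟩ := le_iff_exists_add.mp hxz
    rw [add_right_comm] at hzy ⊢
    exact (hmem _).mpr (h x hx y hy _ (by simp) (by simpa using hzy))

theorem IsCorner.of_image_add {S : Finset (ℕ × ℕ)} {a : ℕ × ℕ} {r e k l : ℕ}
    (h : IsCorner (S.image (· + a)) r e k l) :
    ∃ r' e', r = r' + a.1 ∧ e = e' + a.2 ∧ IsCorner S r' e' k l := by
  have hmem : ∀ z, z + a ∈ S.image (· + a) ↔ z ∈ S := by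
    intro z
    simp
  obtain ⟨⟨r', e'⟩, hz, hza⟩ := Finset.mem_image.mp h.top
  obtain ⟨rfl, rfl⟩ := Prod.ext_iff.mp hza.symm
  refine ⟨r', e', rfl, rfl, ?_⟩
  constructor
  · intro z hz
    have := h.bound _ ((hmem z).mpr hz)
    simp only [Prod.fst_add, Prod.snd_add] at this
    omega
  · exact hz
  · rw [← hmem]
    convert h.bottom using 1
    ext <;> simp <;> omega
  · intro z hz hzr
    have := h.left _ ((hmem z).mpr hz) (by simpa using hzr)
    simpa using this
  · intro z hz hzr
    have := h.low _ ((hmem z).mpr hz) (by simp only [Prod.snd_add]; omega)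
    simp only [Prod.fst_add] at this
    omega

/-- Two skew diagrams of the same convex shape have the same relative `R`-polynomial. -/
theorem relRIdeal_eq_of_shape {B B' : Type*} [Fintype B] [DecidableEq B] [Fintype B']
    [DecidableEq B'] {M : CoxeterMatrix B} {M' : CoxeterMatrix B'} (H : MinusculeHeap M)
    (H' : MinusculeHeap M') {L D L' D' U : Finset (ℕ × ℕ)} {a a' : ℕ × ℕ}
    (hL : H.IsIdeal L) (hD : H.IsIdeal D) (hLD : L ⊆ D) (hL' : H'.IsIdeal L')
    (hD' : H'.IsIdeal D') (hLD' : L' ⊆ D') (hU : (D \ L).image (· + a) = U)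
    (hU' : (D' \ L').image (· + a') = U) (hconv : IsConvexShape U) :
    H.relRIdeal L D = H'.relRIdeal L' D' := by
  generalize hn : U.card = n
  induction n using Nat.strong_induction_on generalizing L D L' D' U with
  | _ n ih =>
  rcases U.eq_empty_or_nonempty with rfl | hne
  · have h1 : L = D := by
      rw [Finset.image_eq_empty, Finset.sdiff_eq_empty_iff_subset] at hU
      exact hLD.antisymm hU
    have h2 : L' = D' := by
      rw [Finset.image_eq_empty, Finset.sdiff_eq_empty_iff_subset] at hU'
      exact hLD'.antisymm hU'
    subst h1 h2
    rw [MinusculeHeap.relRIdeal_self hL, MinusculeHeap.relRIdeal_self hL']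
  obtain ⟨r, e, k, l, hc⟩ := exists_isCorner hne
  have hS : IsConvexShape (D \ L) := isConvexShape_image_add.mp (hU ▸ hconv)
  have hS' : IsConvexShape (D' \ L') := isConvexShape_image_add.mp (hU' ▸ hconv)
  obtain ⟨r1, e1, hr1, he1, hc1⟩ := IsCorner.of_image_add (hU ▸ hc)
  obtain ⟨r2, e2, hr2, he2, hc2⟩ := IsCorner.of_image_add (hU' ▸ hc)
  have top1 : (r1, e1) + a = (r, e) := by rw [hr1, he1]; rfl
  have top2 : (r2, e2) + a' = (r, e) := by rw [hr2, he2]; rfl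
  have bot1 : (r1 + k, e1 + l) + a = (r + k, e + l) := by
    rw [hr1, he1]
    ext <;> simp <;> omega
  have bot2 : (r2 + k, e2 + l) + a' = (r + k, e + l) := by
    rw [hr2, he2]
    ext <;> simp <;> omega
  have himg : ∀ (S V : Finset (ℕ × ℕ)) (b z w : ℕ × ℕ), S.image (· + b) = V → z + b = w →
      (S.erase z).image (· + b) = V.erase w := by
    rintro S V b z w rfl rfl
    exact Finset.image_erase (add_left_injective b) _ _
  have herase : ∀ (D L : Finset (ℕ × ℕ)) (x : ℕ × ℕ), D.erase x \ L = (D \ L).erase x :=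
    fun D L x => Finset.erase_sdiff_comm D L x
  have hinsert : ∀ (D L : Finset (ℕ × ℕ)) (x : ℕ × ℕ), D \ insert x L = (D \ L).erase x :=
    fun D L x => Finset.sdiff_insert D L x
  have hrem := MinusculeHeap.removable_of_maximal hL hD hc1.bottom hc1.bottom_maximal
  have hrem' := MinusculeHeap.removable_of_maximal hL' hD' hc2.bottom hc2.bottom_maximal
  have hadd := MinusculeHeap.addable_of_minimal hD hc1.top hc1.top_minimal
  have hadd' := MinusculeHeap.addable_of_minimal hD' hc2.top hc2.top_minimal
  have hsub1 : L ⊆ D.erase (r1 + k, e1 + l) :=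
    Finset.subset_erase.mpr ⟨hLD, (Finset.mem_sdiff.mp hc1.bottom).2⟩
  have hsub2 : L' ⊆ D'.erase (r2 + k, e2 + l) :=
    Finset.subset_erase.mpr ⟨hLD', (Finset.mem_sdiff.mp hc2.bottom).2⟩
  have hcard1 : (U.erase (r + k, e + l)).card < n :=
    hn ▸ Finset.card_erase_lt_of_mem hc.bottom
  have hcard2 : (U.erase (r, e)).card < n := hn ▸ Finset.card_erase_lt_of_mem hc.top
  have hstep1 : H.relRIdeal L (D.erase (r1 + k, e1 + l)) =
      H'.relRIdeal L' (D'.erase (r2 + k, e2 + l)) :=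
    ih _ hcard1 hL (hD.erase hrem) hsub1 hL' (hD'.erase hrem') hsub2
      (by rw [herase]; exact himg _ _ _ _ _ hU bot1) (by rw [herase]; exact himg _ _ _ _ _ hU' bot2)
      (hconv.erase_maximal hc.bottom_maximal) rfl
  rcases lt_trichotomy k l with hkl | rfl | hkl
  · rw [MinusculeHeap.relRIdeal_of_lt hL hD hS hc1 hkl,
      MinusculeHeap.relRIdeal_of_lt hL' hD' hS' hc2 hkl, hstep1]
  · rw [MinusculeHeap.relRIdeal_of_eq hL hD hS hc1, MinusculeHeap.relRIdeal_of_eq hL' hD' hS' hc2,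
      hstep1]
    congr 2
    -- For k = 0 the two corners coincide and cannot be removed twice: the lower ideal is no longer
    -- contained in the upper one, and the last term vanishes.
    by_cases hk : k = 0
    · subst hk
      rw [MinusculeHeap.relRIdeal_eq_zero (hL.insert hadd) (hD.erase hrem),
        MinusculeHeap.relRIdeal_eq_zero (hL'.insert hadd') (hD'.erase hrem')]
      · exact fun h => Finset.notMem_erase _ _ (h (Finset.mem_insert_self _ _))
      · exact fun h => Finset.notMem_erase _ _ (h (Finset.mem_insert_self _ _))
    · have hne1 : (r, e) ≠ (r + k, e + k) := by
        intro h
        have := congrArg Prod.fst h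
        simp only at this
        omega
      have hmin : ∀ z ∈ U.erase (r + k, e + k), ¬ z < (r, e) :=
        fun z hz => hc.top_minimal z (Finset.mem_of_mem_erase hz)
      have hsub1' : insert (r1, e1) L ⊆ D.erase (r1 + k, e1 + k) := by
        refine Finset.insert_subset (Finset.mem_erase.mpr ⟨?_, (Finset.mem_sdiff.mp hc1.top).1⟩) hsub1
        intro h
        have := congrArg Prod.fst h
        simp only at this
        omega
      have hsub2' : insert (r2, e2) L' ⊆ D'.erase (r2 + k, e2 + k) := by
        refine Finset.insert_subset (Finset.mem_erase.mpr ⟨?_, (Finset.mem_sdiff.mp hc2.top).1⟩) hsub2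
        intro h
        have := congrArg Prod.fst h
        simp only at this
        omega
      refine ih _ ((Finset.card_erase_le).trans_lt hcard1) (hL.insert hadd) (hD.erase hrem) hsub1'
        (hL'.insert hadd') (hD'.erase hrem') hsub2'
        (by rw [hinsert, herase]; exact himg _ _ _ _ _ (himg _ _ _ _ _ hU bot1) top1)
        (by rw [hinsert, herase]; exact himg _ _ _ _ _ (himg _ _ _ _ _ hU' bot2) top2)
        ((hconv.erase_maximal hc.bottom_maximal).erase_minimal hmin) rfl
  · rw [MinusculeHeap.relRIdeal_of_gt hL hD hS hc1 hkl,
      MinusculeHeap.relRIdeal_of_gt hL' hD' hS' hc2 hkl]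
    congr 1
    refine ih _ hcard2 (hL.insert hadd) hD (Finset.insert_subset
      (Finset.mem_sdiff.mp hc1.top).1 hLD) (hL'.insert hadd') hD' (Finset.insert_subset
      (Finset.mem_sdiff.mp hc2.top).1 hLD') (by rw [hinsert]; exact himg _ _ _ _ _ hU top1)
      (by rw [hinsert]; exact himg _ _ _ _ _ hU' top2)
      (hconv.erase_minimal hc.top_minimal) rfl

/-! ### The heaps of the Hermitian quotients -/

/-- A minuscule heap on the diagram of a Hermitian quotient, with labels that are numbers. -/
structure DiagramHeap (t : HermitianType) where
  a : ℕ → ℕ → ℤ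
  boxes : Finset (ℕ × ℕ)
  mem_iff : ∀ b, b ∈ boxes ↔ t.entry b ≠ 0
  entry_le : ∀ x ∈ boxes, t.entry x ≤ t.rank
  a_diag : ∀ i, a i i = 2
  a_cases : ∀ i j : Fin t.rank, i ≠ j →
    (t.coxeterMatrix i j = 2 ∧ a (i + 1) (j + 1) = 0 ∧ a (j + 1) (i + 1) = 0) ∨
    (t.coxeterMatrix i j = 3 ∧ a (i + 1) (j + 1) = -1 ∧ a (j + 1) (i + 1) = -1) ∨
    (t.coxeterMatrix i j = 4 ∧ a (i + 1) (j + 1) = -1 ∧ a (j + 1) (i + 1) = -2) ∨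
    (t.coxeterMatrix i j = 4 ∧ a (i + 1) (j + 1) = -2 ∧ a (j + 1) (i + 1) = -1)
  comparable : ∀ x ∈ boxes, ∀ y ∈ boxes, a (t.entry x) (t.entry y) ≠ 0 → x ≤ y ∨ y ≤ x
  adj_below : ∀ x ∈ boxes, ∀ y ∈ boxes, x < y →
    ∃ z ∈ boxes, x ≤ z ∧ z < y ∧ a (t.entry y) (t.entry z) < 0
  adj_above : ∀ x ∈ boxes, ∀ y ∈ boxes, x < y →
    ∃ z ∈ boxes, x < z ∧ z ≤ y ∧ a (t.entry x) (t.entry z) < 0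
  wt_below : ∀ x ∈ boxes, (if t.entry x = t.node then 1 else 0) -
    ∑ z ∈ boxes with z < x, a (t.entry x) (t.entry z) = 1
  wt_top : ∀ i ∈ Finset.Icc 1 t.rank,
    (if i = t.node then 1 else 0) - ∑ z ∈ boxes, a i (t.entry z) ≤ 0
  label_diag : ∀ x ∈ boxes, (x.1 + 1, x.2) ∈ boxes → (x.1, x.2 + 1) ∈ boxes →
    (x.1 + 1, x.2 + 1) ∈ boxes → t.entry (x.1 + 1, x.2 + 1) = t.entry x
  label_line : ∀ x ∈ boxes, ∀ y ∈ boxes, t.entry x = t.entry y → x.1 = y.1 ∨ x.2 = y.2 → x = y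
  above_row : ∀ x ∈ boxes, ∀ y ∈ boxes, (y.1, y.2 + 1) ∈ boxes → x < (y.1, y.2 + 1) →
    t.entry x = t.entry (y.1, y.2 + 1) → ∃ w ∈ boxes, x < w ∧ w < (y.1, y.2 + 1) ∧ w.1 < y.1
  right_col : ∀ x ∈ boxes, ∀ y ∈ boxes, (y.1 + 1, y.2) ∈ boxes → y < x →
    t.entry x = t.entry y → ∃ w ∈ boxes, y < w ∧ w < x ∧ y.2 < w.2

theorem HermitianType.node_mem (t : HermitianType) : 1 ≤ t.node ∧ t.node ≤ t.rank := by
  cases t <;> simp only [HermitianType.node, HermitianType.rank] <;> omega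

namespace DiagramHeap

variable {t : HermitianType} (H : DiagramHeap t)

theorem label_add_one {x : ℕ × ℕ} (hx : x ∈ H.boxes) : (t.label x : ℕ) + 1 = t.entry x := by
  have h1 := (H.mem_iff x).mp hx
  have h2 := H.entry_le x hx
  have h3 : (t.label x : ℕ) = t.entry x - 1 := Nat.mod_eq_of_lt (by omega)
  omega

theorem label_eq_iff {x y : ℕ × ℕ} (hx : x ∈ H.boxes) (hy : y ∈ H.boxes) :
    t.label x = t.label y ↔ t.entry x = t.entry y := by
  rw [Fin.ext_iff, ← H.label_add_one hx, ← H.label_add_one hy]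
  omega

/-- The node of the weight. -/
def topNode (t : HermitianType) : Fin t.rank := ⟨t.node - 1, by have := t.node_mem; omega⟩

theorem eq_topNode_iff (i : Fin t.rank) : i = topNode t ↔ (i : ℕ) + 1 = t.node := by
  have := t.node_mem
  rw [Fin.ext_iff, topNode]
  simp only
  omega

/-- The heap of a Hermitian quotient. -/
def toHeap : MinusculeHeap t.coxeterMatrix where
  A i j := H.a (i + 1) (j + 1)
  k := topNode t
  A_diag _ := H.a_diag _
  A_cases := H.a_cases
  boxes := H.boxes
  label := t.label
  comparable x hx y hy h := by
    rw [H.label_add_one hx, H.label_add_one hy] at h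
    exact H.comparable x hx y hy h
  adj_below x hx y hy h := by
    obtain ⟨z, hz, h1, h2, h3⟩ := H.adj_below x hx y hy h
    refine ⟨z, hz, h1, h2, ?_⟩
    rwa [H.label_add_one hz, H.label_add_one hy]
  adj_above x hx y hy h := by
    obtain ⟨z, hz, h1, h2, h3⟩ := H.adj_above x hx y hy h
    refine ⟨z, hz, h1, h2, ?_⟩
    rwa [H.label_add_one hz, H.label_add_one hx]
  wt_below x hx := by
    simp only [eq_topNode_iff]
    rw [H.label_add_one hx]
    refine Eq.trans ?_ (H.wt_below x hx)
    congr 1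
    apply Finset.sum_congr rfl
    intro z hz
    rw [H.label_add_one (Finset.mem_filter.mp hz).1]
  wt_top i := by
    simp only [eq_topNode_iff]
    refine le_of_eq_of_le ?_ (H.wt_top (i + 1) (by rw [Finset.mem_Icc]; omega))
    congr 1
    apply Finset.sum_congr rfl
    intro z hz
    rw [H.label_add_one hz]
  label_diag a b h1 h2 h3 h4 := by
    rw [H.label_eq_iff h4 h1]
    exact H.label_diag (a, b) h1 h2 h3 h4
  label_line x hx y hy h := by
    rw [H.label_eq_iff hx hy] at h
    exact H.label_line x hx y hy h
  above_row x hx a b h1 h2 h3 h4 := by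
    rw [H.label_eq_iff hx h2] at h4
    exact H.above_row x hx (a, b) h1 h2 h3 h4
  right_col x hx a b h1 h2 h3 h4 := by
    rw [H.label_eq_iff hx h1] at h4
    exact H.right_col x hx (a, b) h1 h2 h3 h4

end DiagramHeap

/-! ### Local criteria for minuscule heaps -/

/-- It suffices to compare each box with the preceding one of the same label. -/
theorem wt_below_of_local (P : Finset (ℕ × ℕ)) (e : ℕ × ℕ → ℕ) (a : ℕ → ℕ → ℤ) (k : ℕ)
    (ha : ∀ i, a i i = 2)
    (h : ∀ x ∈ P, ∃ Y : Finset (ℕ × ℕ), (∀ y ∈ Y, y ∈ P ∧ y < x) ∧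
      (((∀ z ∈ P, z < x → z ∉ Y → a (e x) (e z) = 0) ∧
        (if e x = k then 1 else 0) - ∑ y ∈ Y, a (e x) (e y) = 1) ∨
      ∃ x₀ ∈ P, x₀ < x ∧ e x₀ = e x ∧ (∀ y ∈ Y, ¬ y ≤ x₀) ∧
        (∀ z ∈ P, z < x → ¬ z ≤ x₀ → z ∉ Y → a (e x) (e z) = 0) ∧
        ∑ y ∈ Y, a (e x) (e y) = -2)) :
    ∀ x ∈ P, (if e x = k then 1 else 0) - ∑ z ∈ P with z < x, a (e x) (e z) = 1 := by
  intro x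
  induction x using WellFoundedLT.induction with
  | _ x ih =>
  intro hx
  obtain ⟨Y, hY, ⟨h1, h2⟩ | ⟨x₀, hx₀, hlt, he, h1, h2, h3⟩⟩ := h x hx
  · have h3 : ∑ y ∈ Y, a (e x) (e y) = ∑ z ∈ P with z < x, a (e x) (e z) := by
      apply Finset.sum_subset
      · intro y hy
        exact Finset.mem_filter.mpr (hY y hy)
      · intro z hz hzY
        rw [Finset.mem_filter] at hz
        exact h1 z hz.1 hz.2 hzY
    rw [← h3, h2]
  -- From the boxes below x₀ to those below x, the sum gains 2 from x₀ and -2 from Y.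
  · have h4 := ih x₀ hlt hx₀
    rw [he] at h4
    have h5 : ∑ z ∈ P with z < x, a (e x) (e z) =
        ∑ z ∈ (insert x₀ (P.filter (· < x₀))) ∪ Y, a (e x) (e z) := by
      symm
      apply Finset.sum_subset
      · intro z hz
        rw [Finset.mem_filter]
        rcases Finset.mem_union.mp hz with hz | hz
        · rcases Finset.mem_insert.mp hz with rfl | hz
          · exact ⟨hx₀, hlt⟩
          · rw [Finset.mem_filter] at hz
            exact ⟨hz.1, hz.2.trans hlt⟩
        · exact hY z hz
      · intro z hz hzY
        rw [Finset.mem_filter] at hz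
        rw [Finset.mem_union, Finset.mem_insert, Finset.mem_filter] at hzY
        refine h2 z hz.1 hz.2 (fun hle => hzY (Or.inl ?_)) fun hzY' => hzY (Or.inr hzY')
        rcases hle.eq_or_lt with h | h
        · exact Or.inl h
        · exact Or.inr ⟨hz.1, h⟩
    rw [h5, Finset.sum_union, Finset.sum_insert (by simp), h3, he, ha]
    · linarith
    · rw [Finset.disjoint_left]
      intro z hz hzY
      apply h1 z hzY
      rcases Finset.mem_insert.mp hz with rfl | hz
      · exact le_rfl
      · exact (Finset.mem_filter.mp hz).2.le

/-- It suffices to look beyond the last box of each label. -/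
theorem wt_top_of_local (P : Finset (ℕ × ℕ)) (e : ℕ × ℕ → ℕ) (a : ℕ → ℕ → ℤ) (k n : ℕ)
    (ha : ∀ i, a i i = 2)
    (hb : ∀ x ∈ P, (if e x = k then 1 else 0) - ∑ z ∈ P with z < x, a (e x) (e z) = 1)
    (h : ∀ i ∈ Finset.Icc 1 n, ∃ x ∈ P, e x = i ∧ ∃ y, (y ∈ P → -1 ≤ a i (e y)) ∧
      ∀ z ∈ P, ¬ z ≤ x → z ≠ y → a i (e z) = 0) :
    ∀ i ∈ Finset.Icc 1 n, (if i = k then 1 else 0) - ∑ z ∈ P, a i (e z) ≤ 0 := by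
  intro i hi
  obtain ⟨x, hx, rfl, y, hy, hz⟩ := h i hi
  have h1 := hb x hx
  have h2 : P.filter (· ≤ x) = insert x (P.filter (· < x)) := by
    ext z
    simp only [Finset.mem_filter, Finset.mem_insert, le_iff_eq_or_lt]
    constructor
    · rintro ⟨h, h' | h'⟩
      · exact Or.inl h'
      · exact Or.inr ⟨h, h'⟩
    · rintro (rfl | ⟨h, h'⟩)
      · exact ⟨hx, Or.inl rfl⟩
      · exact ⟨h, Or.inr h'⟩
  rw [← Finset.sum_filter_add_sum_filter_not P (· ≤ x), h2, Finset.sum_insert (by simp), ha]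
  -- Including x turns the pairing 1 into -1, and the boxes beyond x may raise it by at most 1.
  have h3 : -1 ≤ ∑ z ∈ P with ¬ z ≤ x, a (e x) (e z) := by
    by_cases hyP : y ∈ P.filter (¬ · ≤ x)
    · rw [Finset.sum_eq_single_of_mem y hyP]
      · exact hy (Finset.mem_filter.mp hyP).1
      · intro z hz' hne
        rw [Finset.mem_filter] at hz'
        exact hz z hz'.1 hz'.2 hne
    · rw [Finset.sum_eq_zero]
      · norm_num
      · intro z hz'
        have hne : z ≠ y := by
          rintro rfl
          exact hyP hz'
        rw [Finset.mem_filter] at hz'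
        exact hz z hz'.1 hz'.2 hne
  linarith

/-- A description of the diagram of a Hermitian quotient by the relation `S i j m`, that `m` is the
label of the box `(i, j)`, with local conditions that make it a minuscule heap. -/
structure LocalDiagram (t : HermitianType) where
  a : ℕ → ℕ → ℤ
  S : ℕ → ℕ → ℕ → Prop
  spec : ∀ i j m, S i j m ↔ t.entry (i, j) = m ∧ m ≠ 0
  bound : ∀ i j m, S i j m → i ≤ t.rank ∧ j ≤ t.rank ∧ m ≤ t.rank
  a_diag : ∀ i, a i i = 2
  a_cases : ∀ i j : Fin t.rank, i ≠ j →
    (t.coxeterMatrix i j = 2 ∧ a (i + 1) (j + 1) = 0 ∧ a (j + 1) (i + 1) = 0) ∨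
    (t.coxeterMatrix i j = 3 ∧ a (i + 1) (j + 1) = -1 ∧ a (j + 1) (i + 1) = -1) ∨
    (t.coxeterMatrix i j = 4 ∧ a (i + 1) (j + 1) = -1 ∧ a (j + 1) (i + 1) = -2) ∨
    (t.coxeterMatrix i j = 4 ∧ a (i + 1) (j + 1) = -2 ∧ a (j + 1) (i + 1) = -1)
  near : ℕ → ℕ → Prop
  near_of_ne : ∀ m m', a m m' ≠ 0 → near m m'
  neg_of_vertical : ∀ i j m m', S i j m → S (i + 1) j m' → a m m' < 0 ∧ a m' m < 0
  neg_of_horizontal : ∀ i j m m', S i j m → S i (j + 1) m' → a m m' < 0 ∧ a m' m < 0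
  comparable : ∀ i j m i' j' m', S i j m → S i' j' m' → near m m' →
    i ≤ i' ∧ j ≤ j' ∨ i' ≤ i ∧ j' ≤ j
  up : ∀ i j m i' j' m', S i j m → S (i' + 1) j' m' → i < i' + 1 → j ≤ j' → ∃ m'', S i' j' m''
  left : ∀ i j m j' m', S i j m → S i (j' + 1) m' → j < j' + 1 → ∃ m'', S i j' m''
  right : ∀ i j m i' j' m', S i j m → S i' j' m' → i ≤ i' → j < j' → ∃ m'', S i (j + 1) m''
  down : ∀ i j m i' m', S i j m → S i' j m' → i < i' → ∃ m'', S (i + 1) j m''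
  origin : S 0 0 t.node
  preceding : ∀ i j m, S i j m → (i = 0 ∧ j = 0) ∨
    (m ≠ t.node ∧ ∃ i₁ j₁ m₁, S i₁ j₁ m₁ ∧ i₁ ≤ i ∧ j₁ ≤ j ∧ a m m₁ = -1 ∧
      ∀ i' j' m', S i' j' m' → i' ≤ i → j' ≤ j → near m m' →
        (i' = i ∧ j' = j) ∨ (i' = i₁ ∧ j' = j₁)) ∨
    ∃ i₀ j₀, S i₀ j₀ m ∧ i₀ ≤ i ∧ j₀ ≤ j ∧ (i₀ ≠ i ∨ j₀ ≠ j) ∧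
      ((∃ i₁ j₁ m₁, S i₁ j₁ m₁ ∧ i₁ ≤ i ∧ j₁ ≤ j ∧ ¬ (i₁ ≤ i₀ ∧ j₁ ≤ j₀) ∧ a m m₁ = -2 ∧
        ∀ i' j' m', S i' j' m' → i' ≤ i → j' ≤ j → near m m' →
          (i' = i ∧ j' = j) ∨ (i' ≤ i₀ ∧ j' ≤ j₀) ∨ (i' = i₁ ∧ j' = j₁)) ∨
      (∃ i₁ j₁ m₁ i₂ j₂ m₂, S i₁ j₁ m₁ ∧ i₁ ≤ i ∧ j₁ ≤ j ∧ ¬ (i₁ ≤ i₀ ∧ j₁ ≤ j₀) ∧ a m m₁ = -1 ∧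
        S i₂ j₂ m₂ ∧ i₂ ≤ i ∧ j₂ ≤ j ∧ ¬ (i₂ ≤ i₀ ∧ j₂ ≤ j₀) ∧ a m m₂ = -1 ∧
        (i₁ ≠ i₂ ∨ j₁ ≠ j₂) ∧
        ∀ i' j' m', S i' j' m' → i' ≤ i → j' ≤ j → near m m' →
          (i' = i ∧ j' = j) ∨ (i' ≤ i₀ ∧ j' ≤ j₀) ∨ (i' = i₁ ∧ j' = j₁) ∨ (i' = i₂ ∧ j' = j₂)))
  last : ∀ m, 1 ≤ m → m ≤ t.rank → ∃ i j, S i j m ∧ ∃ i₁ j₁,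
    (∀ m₁, S i₁ j₁ m₁ → -1 ≤ a m m₁) ∧
    ∀ i' j' m', S i' j' m' → near m m' → (i' ≤ i ∧ j' ≤ j) ∨ (i' = i₁ ∧ j' = j₁)
  label_diag : ∀ i j m m' m₁ m₂, S i j m → S (i + 1) (j + 1) m' → S i (j + 1) m₁ →
    S (i + 1) j m₂ → m = m'
  label_row : ∀ i j j' m, S i j m → S i j' m → j = j'
  label_col : ∀ i i' j m, S i j m → S i' j m → i = i'
  above_row : ∀ i j i' j' m m', S i j m → S (i' + 1) (j' + 1) m → S (i' + 1) j' m' →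
    i ≤ i' + 1 → j ≤ j' + 1 → i < i' + 1 → i ≤ i' ∧ ∃ m'', S i' (j' + 1) m''
  right_col : ∀ i j i' j' m m', S i' j' m → S i j m → S (i + 1) j m' →
    i ≤ i' → j ≤ j' → j < j' → j + 1 ≤ j' ∧ ∃ m'', S i (j + 1) m''

namespace LocalDiagram

variable {t : HermitianType} (H : LocalDiagram t)

variable (t) in
/-- The boxes of the diagram. -/
def boxes : Finset (ℕ × ℕ) :=
  (Finset.range (t.rank + 1) ×ˢ Finset.range (t.rank + 1)).filter fun b => t.entry b ≠ 0

theorem S_entry {b : ℕ × ℕ} (h : t.entry b ≠ 0) : H.S b.1 b.2 (t.entry b) :=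
  (H.spec _ _ _).mpr ⟨rfl, h⟩

theorem mem_boxes (H : LocalDiagram t) (b : ℕ × ℕ) : b ∈ boxes t ↔ t.entry b ≠ 0 := by
  rw [boxes, Finset.mem_filter, Finset.mem_product, Finset.mem_range, Finset.mem_range]
  refine ⟨fun h => h.2, fun h => ⟨?_, h⟩⟩
  have := H.bound _ _ _ (H.S_entry h)
  omega

theorem S_of_mem {b : ℕ × ℕ} (h : b ∈ boxes t) : H.S b.1 b.2 (t.entry b) :=
  H.S_entry ((H.mem_boxes b).mp h)

theorem mem_of_S {i j m : ℕ} (h : H.S i j m) : (i, j) ∈ boxes t := by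
  rw [H.mem_boxes]
  obtain ⟨h1, h2⟩ := (H.spec _ _ _).mp h
  rwa [h1]

theorem entry_of_S {i j m : ℕ} (h : H.S i j m) : t.entry (i, j) = m := ((H.spec _ _ _).mp h).1

theorem a_eq_zero {m m' : ℕ} (h : ¬ H.near m m') : H.a m m' = 0 := by
  by_contra hne
  exact h (H.near_of_ne m m' hne)

theorem wt_below (H : LocalDiagram t) (x : ℕ × ℕ) (hx : x ∈ boxes t) :
    (if t.entry x = t.node then 1 else 0) -
      ∑ z ∈ boxes t with z < x, H.a (t.entry x) (t.entry z) = 1 := by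
  refine wt_below_of_local (boxes t) t.entry H.a t.node H.a_diag ?_ x hx
  have lt_iff : ∀ (i j i' j' : ℕ), (i, j) < (i', j') ↔ i ≤ i' ∧ j ≤ j' ∧ (i ≠ i' ∨ j ≠ j') := by
    intro i j i' j'
    rw [Prod.mk_lt_mk]
    omega
  have hself : ∀ {m i j i' j' : ℕ} {c : ℤ}, H.S i j m → ∀ {m'}, H.S i' j' m' → H.a m m' = c →
      c ≠ 2 → i' ≠ i ∨ j' ≠ j := by
    intro m i j i' j' c h m' h' ha hc
    by_contra hcon
    have h1 : i' = i := by omega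
    have h2 : j' = j := by omega
    subst h1 h2
    have h3 := H.entry_of_S h
    have h4 := H.entry_of_S h'
    rw [h3] at h4
    subst h4
    rw [H.a_diag] at ha
    exact hc ha.symm
  rintro ⟨i, j⟩ hx
  have hS := H.S_of_mem hx
  simp only at hS
  generalize hm : t.entry (i, j) = m at hS
  rcases H.preceding i j m hS with ⟨rfl, rfl⟩ | ⟨hn, i₁, j₁, m₁, h1, h2, h3, h4, h5⟩ |
    ⟨i₀, j₀, h0, hi0, hj0, hne0, ⟨i₁, j₁, m₁, h1, h2, h3, h4, h5, h6⟩ |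
      ⟨i₁, j₁, m₁, i₂, j₂, m₂, h1, h2, h3, h4, h5, k1, k2, k3, k4, k5, hne, h6⟩⟩
  · refine ⟨∅, by simp, Or.inl ⟨?_, ?_⟩⟩
    · rintro ⟨i', j'⟩ _ hlt
      rw [lt_iff] at hlt
      omega
    · rw [H.entry_of_S H.origin] at hm
      simp [hm]
  · refine ⟨{(i₁, j₁)}, ?_, Or.inl ⟨?_, ?_⟩⟩
    · intro y hy
      rw [Finset.mem_singleton] at hy
      subst hy
      exact ⟨H.mem_of_S h1, (lt_iff _ _ _ _).mpr ⟨h2, h3, hself hS h1 h4 (by norm_num)⟩⟩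
    · rintro ⟨i', j'⟩ hz hlt hzY
      rw [lt_iff] at hlt
      rw [Finset.mem_singleton, Prod.mk.injEq] at hzY
      apply H.a_eq_zero
      intro hnear
      have := h5 i' j' _ (H.S_of_mem hz) hlt.1 hlt.2.1 hnear
      omega
    · rw [if_neg hn, Finset.sum_singleton, H.entry_of_S h1, h4]
      norm_num
  · refine ⟨{(i₁, j₁)}, ?_, Or.inr ⟨(i₀, j₀), H.mem_of_S h0, (lt_iff _ _ _ _).mpr ⟨hi0, hj0, hne0⟩,
      by rw [H.entry_of_S h0], ?_, ?_, ?_⟩⟩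
    · intro y hy
      rw [Finset.mem_singleton] at hy
      subst hy
      exact ⟨H.mem_of_S h1, (lt_iff _ _ _ _).mpr ⟨h2, h3, hself hS h1 h5 (by norm_num)⟩⟩
    · intro y hy
      rw [Finset.mem_singleton] at hy
      subst hy
      rwa [Prod.mk_le_mk]
    · rintro ⟨i', j'⟩ hz hlt hle hzY
      rw [lt_iff] at hlt
      rw [Prod.mk_le_mk] at hle
      rw [Finset.mem_singleton, Prod.mk.injEq] at hzY
      apply H.a_eq_zero
      intro hnear
      have := h6 i' j' _ (H.S_of_mem hz) hlt.1 hlt.2.1 hnear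
      omega
    · rw [Finset.sum_singleton, H.entry_of_S h1, h5]
  · refine ⟨{(i₁, j₁), (i₂, j₂)}, ?_, Or.inr ⟨(i₀, j₀), H.mem_of_S h0,
      (lt_iff _ _ _ _).mpr ⟨hi0, hj0, hne0⟩, by rw [H.entry_of_S h0], ?_, ?_, ?_⟩⟩
    · intro y hy
      rw [Finset.mem_insert, Finset.mem_singleton] at hy
      rcases hy with rfl | rfl
      · exact ⟨H.mem_of_S h1, (lt_iff _ _ _ _).mpr ⟨h2, h3, hself hS h1 h5 (by norm_num)⟩⟩
      · exact ⟨H.mem_of_S k1, (lt_iff _ _ _ _).mpr ⟨k2, k3, hself hS k1 k5 (by norm_num)⟩⟩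
    · intro y hy
      rw [Finset.mem_insert, Finset.mem_singleton] at hy
      rcases hy with rfl | rfl <;> rwa [Prod.mk_le_mk]
    · rintro ⟨i', j'⟩ hz hlt hle hzY
      rw [lt_iff] at hlt
      rw [Prod.mk_le_mk] at hle
      rw [Finset.mem_insert, Finset.mem_singleton, Prod.mk.injEq, Prod.mk.injEq] at hzY
      apply H.a_eq_zero
      intro hnear
      have := h6 i' j' _ (H.S_of_mem hz) hlt.1 hlt.2.1 hnear
      omega
    · rw [Finset.sum_pair, H.entry_of_S h1, H.entry_of_S k1, h5, k5]
      · norm_num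
      · rw [ne_eq, Prod.mk.injEq]
        omega

/-- The heap of a Hermitian quotient with a local description. -/
def toDiagramHeap : DiagramHeap t where
  a := H.a
  boxes := boxes t
  mem_iff := H.mem_boxes
  entry_le x hx := (H.bound _ _ _ (H.S_of_mem hx)).2.2
  a_diag := H.a_diag
  a_cases := H.a_cases
  comparable := fun x hx y hy h =>
    H.comparable _ _ _ _ _ _ (H.S_of_mem hx) (H.S_of_mem hy) (H.near_of_ne _ _ h)
  adj_below := by
    rintro ⟨i, j⟩ hx ⟨i', j'⟩ hy hlt
    have h := hlt.le
    rw [Prod.mk_le_mk] at h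
    have hxS := H.S_of_mem hx
    have hyS := H.S_of_mem hy
    simp only at hxS hyS
    by_cases hi : i < i'
    · obtain ⟨i', rfl⟩ : ∃ r, i' = r + 1 := ⟨i' - 1, by omega⟩
      obtain ⟨m, hm⟩ := H.up _ _ _ _ _ _ hxS hyS hi h.2
      refine ⟨(i', j'), H.mem_of_S hm, ?_, ?_, ?_⟩
      · rw [Prod.mk_le_mk]
        omega
      · rw [Prod.mk_lt_mk]
        omega
      · rw [H.entry_of_S hm]
        exact (H.neg_of_vertical _ _ _ _ hm hyS).2
    · rw [Prod.mk_lt_mk] at hlt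
      obtain ⟨j', rfl⟩ : ∃ r, j' = r + 1 := ⟨j' - 1, by omega⟩
      obtain rfl : i = i' := by omega
      obtain ⟨m, hm⟩ := H.left _ _ _ _ _ hxS hyS (by omega)
      refine ⟨(i, j'), H.mem_of_S hm, ?_, ?_, ?_⟩
      · rw [Prod.mk_le_mk]
        omega
      · rw [Prod.mk_lt_mk]
        omega
      · rw [H.entry_of_S hm]
        exact (H.neg_of_horizontal _ _ _ _ hm hyS).2
  adj_above := by
    rintro ⟨i, j⟩ hx ⟨i', j'⟩ hy hlt
    have h := hlt.le
    rw [Prod.mk_le_mk] at h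
    have hxS := H.S_of_mem hx
    have hyS := H.S_of_mem hy
    simp only at hxS hyS
    by_cases hj : j < j'
    · obtain ⟨m, hm⟩ := H.right _ _ _ _ _ _ hxS hyS h.1 hj
      refine ⟨(i, j + 1), H.mem_of_S hm, ?_, ?_, ?_⟩
      · rw [Prod.mk_lt_mk]
        omega
      · rw [Prod.mk_le_mk]
        omega
      · rw [H.entry_of_S hm]
        exact (H.neg_of_horizontal _ _ _ _ hxS hm).1
    · rw [Prod.mk_lt_mk] at hlt
      obtain rfl : j = j' := by omega
      obtain ⟨m, hm⟩ := H.down _ _ _ _ _ hxS hyS (by omega)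
      refine ⟨(i + 1, j), H.mem_of_S hm, ?_, ?_, ?_⟩
      · rw [Prod.mk_lt_mk]
        omega
      · rw [Prod.mk_le_mk]
        omega
      · rw [H.entry_of_S hm]
        exact (H.neg_of_vertical _ _ _ _ hxS hm).1
  wt_below := H.wt_below
  wt_top := by
    apply wt_top_of_local (boxes t) t.entry H.a t.node t.rank H.a_diag H.wt_below
    intro m hm
    rw [Finset.mem_Icc] at hm
    obtain ⟨i, j, hS, i₁, j₁, h1, h2⟩ := H.last m hm.1 hm.2
    refine ⟨(i, j), H.mem_of_S hS, H.entry_of_S hS, (i₁, j₁), fun h => h1 _ (H.S_of_mem h), ?_⟩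
    rintro ⟨i', j'⟩ hz hle hne
    apply H.a_eq_zero
    intro hnear
    rw [Prod.mk_le_mk] at hle
    rw [ne_eq, Prod.mk.injEq] at hne
    have := h2 i' j' _ (H.S_of_mem hz) hnear
    omega
  label_diag := by
    rintro ⟨i, j⟩ h1 h2 h3 h4
    exact (H.label_diag _ _ _ _ _ _ (H.S_of_mem h1) (H.S_of_mem h4) (H.S_of_mem h3)
      (H.S_of_mem h2)).symm
  label_line := by
    rintro ⟨i, j⟩ hx ⟨i', j'⟩ hy h h'
    have hxS := H.S_of_mem hx
    have hyS := H.S_of_mem hy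
    rw [← h] at hyS
    rcases h' with h' | h'
    · simp only at h'
      subst h'
      exact Prod.ext rfl (H.label_row _ _ _ _ hxS hyS)
    · simp only at h'
      subst h'
      exact Prod.ext (H.label_col _ _ _ _ hxS hyS) rfl
  above_row := by
    rintro ⟨i, j⟩ hx ⟨i', j'⟩ hy hz hlt h
    have hxS := H.S_of_mem hx
    have hyS := H.S_of_mem hy
    have hzS := H.S_of_mem hz
    simp only at hxS hyS hzS h hlt hz ⊢
    rw [← h] at hzS
    have hle := hlt.le
    rw [Prod.mk_le_mk] at hle
    have hi : i ≠ i' := by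
      rintro rfl
      have := H.label_row _ _ _ _ hxS hzS
      subst this
      exact lt_irrefl _ hlt
    obtain ⟨i', rfl⟩ : ∃ r, i' = r + 1 := ⟨i' - 1, by omega⟩
    obtain ⟨h1, m, hm⟩ := H.above_row _ _ _ _ _ _ hxS hzS hyS hle.1 hle.2 (by omega)
    refine ⟨(i', j' + 1), H.mem_of_S hm, ?_, ?_, by simp only; omega⟩
    · refine lt_of_le_of_ne (Prod.mk_le_mk.mpr ⟨h1, hle.2⟩) ?_
      intro he
      rw [Prod.mk.injEq] at he
      obtain ⟨rfl, rfl⟩ := he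
      have := H.label_col _ _ _ _ hxS hzS
      omega
    · rw [Prod.mk_lt_mk]
      omega
  right_col := by
    rintro ⟨i', j'⟩ hx ⟨i, j⟩ hy hz hlt h
    have hxS := H.S_of_mem hx
    have hyS := H.S_of_mem hy
    have hzS := H.S_of_mem hz
    simp only at hxS hyS hzS h hlt hz ⊢
    rw [h] at hxS
    have hle := hlt.le
    rw [Prod.mk_le_mk] at hle
    have hj : j ≠ j' := by
      rintro rfl
      have := H.label_col _ _ _ _ hxS hyS
      subst this
      exact lt_irrefl _ hlt
    obtain ⟨h1, m, hm⟩ := H.right_col _ _ _ _ _ _ hxS hyS hzS hle.1 hle.2 (by omega)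
    refine ⟨(i, j + 1), H.mem_of_S hm, ?_, ?_, by simp only; omega⟩
    · rw [Prod.mk_lt_mk]
      omega
    · refine lt_of_le_of_ne (Prod.mk_le_mk.mpr ⟨hle.1, h1⟩) ?_
      intro he
      rw [Prod.mk.injEq] at he
      obtain ⟨rfl, rfl⟩ := he
      have := H.label_row _ _ _ _ hxS hyS
      omega

end LocalDiagram

/-! ### The exceptional types, by finite computation -/

/-- The Cartan matrices of types `E_6` and `E_7`. -/
def cartanE (i j : ℕ) : ℤ :=
  if i = j then 2
  else if (i, j) ∈ [(1, 3), (3, 1), (3, 4), (4, 3), (4, 5), (5, 4), (5, 6), (6, 5), (6, 7), (7, 6),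
    (2, 4), (4, 2)] then -1 else 0

/-- The boxes of a diagram in the first `n` rows and columns. -/
def boxesBelow (t : HermitianType) (n : ℕ) : Finset (ℕ × ℕ) :=
  (Finset.range n ×ˢ Finset.range n).filter fun b => t.entry b ≠ 0

/-- An entry of a Coxeter matrix. -/
def matrixEntry {n : ℕ} (M : CoxeterMatrix (Fin n)) (i j : Fin n) : ℕ := M i j

theorem mem_range_of_ofRows_ne_zero (rows : List (ℕ × List ℕ)) (n : ℕ) (h : rows.length ≤ n)
    (h' : ∀ r ∈ rows, r.1 + r.2.length ≤ n) (b : ℕ × ℕ) (hb : HermitianType.ofRows rows b ≠ 0) :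
    b ∈ Finset.range n ×ˢ Finset.range n := by
  rw [Finset.mem_product, Finset.mem_range, Finset.mem_range]
  rw [HermitianType.ofRows] at hb
  by_cases h1 : b.1 < rows.length
  · rw [List.getD_eq_getElem _ _ h1] at hb
    have h2 := h' _ (List.getElem_mem h1)
    have h3 : ¬ b.2 < rows[b.1].1 := fun h3 => hb (if_pos h3)
    simp only [if_neg h3] at hb
    refine ⟨by omega, ?_⟩
    by_contra h4
    rw [List.getD_eq_default _ _ (by omega)] at hb
    exact hb rfl
  · rw [List.getD_eq_default _ _ (by omega)] at hb
    simp at hb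

/-- The heap of `E_6 / D_5`. -/
def diagramHeapE6 : DiagramHeap .E6 where
  a := cartanE
  boxes := boxesBelow .E6 9
  mem_iff b := by
    rw [boxesBelow, Finset.mem_filter]
    exact ⟨fun h => h.2, fun h => ⟨mem_range_of_ofRows_ne_zero _ 9 (by decide) (by decide) b h, h⟩⟩
  entry_le := by decide +kernel
  a_diag i := by simp [cartanE]
  a_cases := by
    have h : ∀ i j : Fin 6, i ≠ j →
      (matrixEntry CoxeterMatrix.E₆ i j = 2 ∧
        cartanE (i + 1) (j + 1) = 0 ∧ cartanE (j + 1) (i + 1) = 0) ∨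
      (matrixEntry CoxeterMatrix.E₆ i j = 3 ∧
        cartanE (i + 1) (j + 1) = -1 ∧ cartanE (j + 1) (i + 1) = -1) := by
      decide +kernel
    exact fun i j hij => (h i j hij).imp_right Or.inl
  comparable := by decide +kernel
  adj_below := by decide +kernel
  adj_above := by decide +kernel
  wt_below := by decide +kernel
  wt_top := by decide +kernel
  label_diag := by decide +kernel
  label_line := by decide +kernel
  above_row := by decide +kernel
  right_col := by decide +kernel

/-- The heap of `E_7 / E_6`. -/
def diagramHeapE7 : DiagramHeap .E7 where
  a := cartanE
  boxes := boxesBelow .E7 9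
  mem_iff b := by
    rw [boxesBelow, Finset.mem_filter]
    exact ⟨fun h => h.2, fun h => ⟨mem_range_of_ofRows_ne_zero _ 9 (by decide) (by decide) b h, h⟩⟩
  entry_le := by decide +kernel
  a_diag i := by simp [cartanE]
  a_cases := by
    have h : ∀ i j : Fin 7, i ≠ j →
      (matrixEntry CoxeterMatrix.E₇ i j = 2 ∧
        cartanE (i + 1) (j + 1) = 0 ∧ cartanE (j + 1) (i + 1) = 0) ∨
      (matrixEntry CoxeterMatrix.E₇ i j = 3 ∧
        cartanE (i + 1) (j + 1) = -1 ∧ cartanE (j + 1) (i + 1) = -1) := by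
      decide +kernel
    exact fun i j hij => (h i j hij).imp_right Or.inl
  comparable := by decide +kernel
  adj_below := by decide +kernel
  adj_above := by decide +kernel
  wt_below := by decide +kernel
  wt_top := by decide +kernel
  label_diag := by decide +kernel
  label_line := by decide +kernel
  above_row := by decide +kernel
  right_col := by decide +kernel

/-! ### The classical types -/

/-- The Cartan matrix of a path, with a double bond at `(u, v)`. -/
def cartanPath (u v m m' : ℕ) : ℤ :=
  if m = m' then 2 else if m = u ∧ m' = v then -2 else if m + 1 = m' ∨ m' + 1 = m then -1 else 0

theorem cartanPath_self (u v m : ℕ) : cartanPath u v m m = 2 := if_pos rfl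

theorem cartanPath_near {u v m m' : ℕ} (huv : u + 1 = v ∨ v + 1 = u ∨ u = v)
    (h : cartanPath u v m m' ≠ 0) : m = m' ∨ m + 1 = m' ∨ m' + 1 = m := by
  rw [cartanPath] at h
  split_ifs at h <;> omega

theorem cartanPath_neg {u v m m' : ℕ} (h : m + 1 = m' ∨ m' + 1 = m) : cartanPath u v m m' < 0 := by
  rw [cartanPath]
  split_ifs <;> omega

theorem cartanPath_eq_neg_one {u v m m' : ℕ} (h : m + 1 = m' ∨ m' + 1 = m)
    (h' : ¬ (m = u ∧ m' = v)) : cartanPath u v m m' = -1 := by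
  rw [cartanPath, if_neg (by omega), if_neg h', if_pos h]

theorem coxeterMatrix_A_apply (n : ℕ) (i j : Fin n) (hij : i ≠ j) : CoxeterMatrix.A n i j =
    if (j : ℕ) + 1 = i ∨ (i : ℕ) + 1 = j then 3 else 2 := if_neg hij

theorem coxeterMatrix_B_apply (n : ℕ) (i j : Fin n) (hij : i ≠ j) : CoxeterMatrix.B n i j =
    if (i : ℕ) = n - 1 ∧ (j : ℕ) = n - 2 ∨ (j : ℕ) = n - 1 ∧ (i : ℕ) = n - 2 then 4
    else if (j : ℕ) + 1 = i ∨ (i : ℕ) + 1 = j then 3 else 2 := if_neg hij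

/-- The diagram of `A_n / (A_{p-1} × A_{n-p})`. -/
def localDiagramA (n p : ℕ) (hp : 1 ≤ p) (hpn : p ≤ n) : LocalDiagram (.A n p hp hpn) where
  -- Equality of the labels is tested first, so a double bond at (0, 0) never occurs and the path is
  -- simply laced.
  a := cartanPath 0 0
  S i j m := i < n + 1 - p ∧ j < p ∧ m + j = p + i
  spec i j m := by
    simp only [HermitianType.entry]
    split_ifs <;> omega
  bound i j m h := by
    simp only [HermitianType.rank]
    omega
  a_diag := cartanPath_self 0 0
  a_cases := by
    intro i j hij
    have hij' : (i : ℕ) ≠ j := fun h => hij (Fin.ext h)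
    rw [HermitianType.coxeterMatrix, coxeterMatrix_A_apply n i j hij]
    simp only [cartanPath, Nat.add_eq_zero_iff, one_ne_zero, and_false, if_false]
    split_ifs <;> omega
  near m m' := m = m' ∨ m + 1 = m' ∨ m' + 1 = m
  near_of_ne m m' := cartanPath_near (by omega)
  neg_of_vertical i j m m' h h' := ⟨cartanPath_neg (by omega), cartanPath_neg (by omega)⟩
  neg_of_horizontal i j m m' h h' := ⟨cartanPath_neg (by omega), cartanPath_neg (by omega)⟩
  comparable := by intros; omega
  up i j m i' j' m' h h' _ _ := ⟨p + i' - j', by omega⟩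
  left i j m j' m' h h' _ := ⟨p + i - j', by omega⟩
  right i j m i' j' m' h h' _ _ := ⟨p + i - (j + 1), by omega⟩
  down i j m i' m' h h' _ := ⟨p + (i + 1) - j, by omega⟩
  origin := by
    change 0 < n + 1 - p ∧ 0 < p ∧ p + 0 = p + 0
    omega
  -- A box in the first row or column, other than the origin, has one earlier neighbour. Any other
  -- box repeats the label of its diagonal predecessor, with the boxes above and to the left in
  -- between.
  preceding i j m h := by
    simp only [HermitianType.node]
    by_cases hi : i = 0
    · by_cases hj : j = 0
      · exact Or.inl ⟨hi, hj⟩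
      · exact Or.inr (Or.inl ⟨by omega, i, j - 1, m + 1, by omega, by omega, by omega,
          cartanPath_eq_neg_one (by omega) (by omega), by intros; omega⟩)
    · by_cases hj : j = 0
      · exact Or.inr (Or.inl ⟨by omega, i - 1, j, m - 1, by omega, by omega, by omega,
          cartanPath_eq_neg_one (by omega) (by omega), by intros; omega⟩)
      · exact Or.inr (Or.inr ⟨i - 1, j - 1, by omega, by omega, by omega, by omega, Or.inr
          ⟨i - 1, j, m - 1, i, j - 1, m + 1, by omega, by omega, by omega, by omega,
            cartanPath_eq_neg_one (by omega) (by omega), by omega, by omega, by omega, by omega,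
            cartanPath_eq_neg_one (by omega) (by omega), by omega, by intros; omega⟩⟩)
  last m h1 h2 := by
    simp only [HermitianType.rank] at h2
    by_cases hm : m ≤ n - p
    · exact ⟨m - 1, p - 1, by omega, m, p - 1,
        fun m₁ h => (cartanPath_eq_neg_one (by omega) (by omega)).ge, by intros; omega⟩
    -- Larger labels end in the last row, the smaller ones in the last column. The next position may
    -- lie outside the diagram, and then the bound on its label is vacuous.
    · exact ⟨n - p, n - m, by omega, n - p, n - m + 1,
        fun m₁ h => (cartanPath_eq_neg_one (by omega) (by omega)).ge, by intros; omega⟩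
  label_diag := by intros; omega
  label_row := by intros; omega
  label_col := by intros; omega
  above_row i j i' j' m m' h1 h2 h3 _ _ _ := ⟨by omega, p + i' - (j' + 1), by omega⟩
  right_col i j i' j' m m' h1 h2 h3 _ _ _ := ⟨by omega, p + i - (j + 1), by omega⟩

/-- The diagram of `C_n / A_{n-1}`. -/
def localDiagramC (n : ℕ) (hn : 2 ≤ n) : LocalDiagram (.C n hn) where
  -- The weights are those of the spin representation, so the last simple root is the short one: the
  -- root system is of type B_n, with the same Coxeter group as C_n.
  a := cartanPath n (n - 1)
  S i j m := i ≤ j ∧ j < n ∧ m + j = n + i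
  spec i j m := by
    simp only [HermitianType.entry]
    split_ifs <;> omega
  bound i j m h := by
    simp only [HermitianType.rank]
    omega
  a_diag := cartanPath_self _ _
  a_cases := by
    intro i j hij
    have hij' : (i : ℕ) ≠ j := fun h => hij (Fin.ext h)
    have hi := i.2
    have hj := j.2
    simp only [HermitianType.rank] at hi hj
    rw [HermitianType.coxeterMatrix, coxeterMatrix_B_apply n i j hij]
    simp only [cartanPath]
    split_ifs <;> omega
  near m m' := m = m' ∨ m + 1 = m' ∨ m' + 1 = m
  near_of_ne m m' := cartanPath_near (by omega)
  neg_of_vertical i j m m' h h' := ⟨cartanPath_neg (by omega), cartanPath_neg (by omega)⟩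
  neg_of_horizontal i j m m' h h' := ⟨cartanPath_neg (by omega), cartanPath_neg (by omega)⟩
  comparable := by intros; omega
  up i j m i' j' m' h h' _ _ := ⟨n + i' - j', by omega⟩
  left i j m j' m' h h' _ := ⟨n + i - j', by omega⟩
  right i j m i' j' m' h h' _ _ := ⟨n + i - (j + 1), by omega⟩
  down i j m i' m' h h' _ := ⟨n + (i + 1) - j, by omega⟩
  origin := by
    change 0 ≤ 0 ∧ 0 < n ∧ n + 0 = n + 0
    omega
  preceding i j m h := by
    simp only [HermitianType.node]
    by_cases hi : i = 0
    · by_cases hj : j = 0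
      · exact Or.inl ⟨hi, hj⟩
      · exact Or.inr (Or.inl ⟨by omega, i, j - 1, m + 1, by omega, by omega, by omega,
          cartanPath_eq_neg_one (by omega) (by omega), by intros; omega⟩)
    · by_cases hj : i = j
      · exact Or.inr (Or.inr ⟨i - 1, j - 1, by omega, by omega, by omega, by omega, Or.inl
          ⟨i - 1, j, m - 1, by omega, by omega, by omega, by omega, by
            rw [cartanPath, if_neg (by omega), if_pos (by omega)], by intros; omega⟩⟩)
      · exact Or.inr (Or.inr ⟨i - 1, j - 1, by omega, by omega, by omega, by omega, Or.inr
          ⟨i - 1, j, m - 1, i, j - 1, m + 1, by omega, by omega, by omega, by omega,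
            cartanPath_eq_neg_one (by omega) (by omega), by omega, by omega, by omega, by omega,
            cartanPath_eq_neg_one (by omega) (by omega), by omega, by intros; omega⟩⟩)
  last m h1 h2 := by
    simp only [HermitianType.rank] at h2
    exact ⟨m - 1, n - 1, by omega, m, n - 1,
      fun m₁ h => (cartanPath_eq_neg_one (by omega) (by omega)).ge, by intros; omega⟩
  label_diag := by intros; omega
  label_row := by intros; omega
  label_col := by intros; omega
  above_row i j i' j' m m' h1 h2 h3 _ _ _ := ⟨by omega, n + i' - (j' + 1), by omega⟩
  right_col i j i' j' m m' h1 h2 h3 _ _ _ := ⟨by omega, n + i - (j + 1), by omega⟩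

/-- The diagram of `B_n / B_{n-1}`. -/
def localDiagramB (n : ℕ) (hn : 2 ≤ n) : LocalDiagram (.B n hn) where
  -- Dually to the spin case, the weight is that of the vector representation of type C_n, whose
  -- last simple root is long.
  a := cartanPath (n - 1) n
  S i j m := (i = 0 ∧ j < n ∧ m = j + 1) ∨ (0 < i ∧ i < n ∧ j + 1 = n ∧ m + i = n)
  spec i j m := by
    simp only [HermitianType.entry]
    split_ifs <;> omega
  bound i j m h := by
    simp only [HermitianType.rank]
    omega
  a_diag := cartanPath_self _ _
  a_cases := by
    intro i j hij
    have hij' : (i : ℕ) ≠ j := fun h => hij (Fin.ext h)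
    have hi := i.2
    have hj := j.2
    simp only [HermitianType.rank] at hi hj
    rw [HermitianType.coxeterMatrix, coxeterMatrix_B_apply n i j hij]
    simp only [cartanPath]
    split_ifs <;> omega
  near m m' := m = m' ∨ m + 1 = m' ∨ m' + 1 = m
  near_of_ne m m' := cartanPath_near (by omega)
  neg_of_vertical i j m m' h h' := ⟨cartanPath_neg (by omega), cartanPath_neg (by omega)⟩
  neg_of_horizontal i j m m' h h' := ⟨cartanPath_neg (by omega), cartanPath_neg (by omega)⟩
  comparable := by intros; omega
  up i j m i' j' m' h h' _ _ := ⟨n - i', by omega⟩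
  left i j m j' m' h h' _ := ⟨j' + 1, by omega⟩
  right i j m i' j' m' h h' _ _ := ⟨j + 2, by omega⟩
  down i j m i' m' h h' _ := ⟨n - (i + 1), by omega⟩
  origin := by
    change (0 = 0 ∧ 0 < n ∧ 1 = 0 + 1) ∨ (0 < 0 ∧ 0 < n ∧ 0 + 1 = n ∧ 1 + 0 = n)
    omega
  preceding i j m h := by
    simp only [HermitianType.node]
    by_cases hi : i = 0
    · by_cases hj : j = 0
      · exact Or.inl ⟨hi, hj⟩
      · exact Or.inr (Or.inl ⟨by omega, i, j - 1, m - 1, by omega, by omega, by omega,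
          cartanPath_eq_neg_one (by omega) (by omega), by intros; omega⟩)
    · by_cases hi' : i = 1
      -- In the column, label m repeats that of the box (0, m - 1). For m = n - 1 the only neighbour
      -- in between is the corner box of label n, which counts twice.
      · exact Or.inr (Or.inr ⟨0, m - 1, by omega, by omega, by omega, by omega, Or.inl
          ⟨0, n - 1, n, by omega, by omega, by omega, by omega, by
            rw [cartanPath, if_neg (by omega), if_pos (by omega)], by intros; omega⟩⟩)
      · exact Or.inr (Or.inr ⟨0, m - 1, by omega, by omega, by omega, by omega, Or.inr
          ⟨0, m, m + 1, i - 1, j, m + 1, by omega, by omega, by omega, by omega,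
            cartanPath_eq_neg_one (by omega) (by omega), by omega, by omega, by omega, by omega,
            cartanPath_eq_neg_one (by omega) (by omega), by omega, by intros; omega⟩⟩)
  last m h1 h2 := by
    simp only [HermitianType.rank] at h2
    exact ⟨n - m, n - 1, by omega, n - m + 1, n - 1,
      fun m₁ h => (cartanPath_eq_neg_one (by omega) (by omega)).ge, by intros; omega⟩
  label_diag := by intros; omega
  label_row := by intros; omega
  label_col := by intros; omega
  above_row i j i' j' m m' h1 h2 h3 _ _ _ := ⟨by omega, n - i', by omega⟩
  right_col i j i' j' m m' h1 h2 h3 _ _ _ := ⟨by omega, j + 2, by omega⟩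

/-- The Cartan matrix of type `D_n`. -/
def cartanD (n m m' : ℕ) : ℤ :=
  if m = m' then 2
  else if (m + 1 = m' ∧ m' < n) ∨ (m' + 1 = m ∧ m < n) ∨ (m + 2 = m' ∧ m' = n) ∨
    (m' + 2 = m ∧ m = n) then -1 else 0

theorem cartanD_self (n m : ℕ) : cartanD n m m = 2 := if_pos rfl

theorem cartanD_near {n m m' : ℕ} (h : cartanD n m m' ≠ 0) :
    m = m' ∨ (m + 1 = m' ∧ m' < n) ∨ (m' + 1 = m ∧ m < n) ∨ (m + 2 = m' ∧ m' = n) ∨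
      (m' + 2 = m ∧ m = n) := by
  rw [cartanD] at h
  split_ifs at h <;> omega

theorem cartanD_eq_neg_one {n m m' : ℕ} (h : (m + 1 = m' ∧ m' < n) ∨ (m' + 1 = m ∧ m < n) ∨
    (m + 2 = m' ∧ m' = n) ∨ (m' + 2 = m ∧ m = n)) : cartanD n m m' = -1 := by
  rw [cartanD, if_neg (by omega), if_pos h]

theorem cartanD_neg {n m m' : ℕ} (h : (m + 1 = m' ∧ m' < n) ∨ (m' + 1 = m ∧ m < n) ∨
    (m + 2 = m' ∧ m' = n) ∨ (m' + 2 = m ∧ m = n)) : cartanD n m m' < 0 := by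
  rw [cartanD_eq_neg_one h]
  norm_num

theorem cartanD_cases (n : ℕ) (i j : Fin n) (hij : i ≠ j) :
    (typeD n i j = 2 ∧ cartanD n (i + 1) (j + 1) = 0 ∧ cartanD n (j + 1) (i + 1) = 0) ∨
    (typeD n i j = 3 ∧ cartanD n (i + 1) (j + 1) = -1 ∧ cartanD n (j + 1) (i + 1) = -1) := by
  have hij' : (i : ℕ) ≠ j := fun h => hij (Fin.ext h)
  have h : typeD n i j = if dAdj n i j ∨ dAdj n j i then 3 else 2 := if_neg hij
  have hi := i.2
  have hj := j.2
  by_cases hd : dAdj n i j ∨ dAdj n j i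
  · rw [if_pos hd] at h
    simp only [dAdj] at hd
    exact Or.inr ⟨h, cartanD_eq_neg_one (by omega), cartanD_eq_neg_one (by omega)⟩
  · rw [if_neg hd] at h
    simp only [dAdj] at hd
    refine Or.inl ⟨h, ?_, ?_⟩ <;> rw [cartanD, if_neg (by omega), if_neg (by omega)]

set_option maxHeartbeats 4000000 in
/-- The diagram of `D_n / A_{n-1}`. -/
def localDiagramDA (n : ℕ) (hn : 3 ≤ n) : LocalDiagram (.DA n hn) where
  a := cartanD n
  S i j m := (i = j ∧ j + 1 < n ∧ i % 2 = 0 ∧ m = n) ∨ (i = j ∧ j + 1 < n ∧ i % 2 = 1 ∧ m + 1 = n) ∨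
    (i < j ∧ j + 1 < n ∧ m + 1 + j = n + i)
  spec i j m := by
    simp only [HermitianType.entry, Nat.even_iff]
    split_ifs <;> omega
  bound i j m h := by
    simp only [HermitianType.rank]
    omega
  a_diag := cartanD_self n
  a_cases := fun i j hij => (cartanD_cases n i j hij).imp_right Or.inl
  near m m' := m = m' ∨ (m + 1 = m' ∧ m' < n) ∨ (m' + 1 = m ∧ m < n) ∨ (m + 2 = m' ∧ m' = n) ∨
    (m' + 2 = m ∧ m = n)
  near_of_ne m m' := cartanD_near
  neg_of_vertical i j m m' h h' := ⟨cartanD_neg (by omega), cartanD_neg (by omega)⟩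
  neg_of_horizontal i j m m' h h' := ⟨cartanD_neg (by omega), cartanD_neg (by omega)⟩
  comparable := by intros; omega
  up i j m i' j' m' h h' _ _ := ⟨n - 1 + i' - j', by omega⟩
  left i j m j' m' h h' _ := ⟨if i < j' then n - 1 + i - j' else if i % 2 = 0 then n else n - 1, by
    split_ifs <;> omega⟩
  right i j m i' j' m' h h' _ _ := ⟨n - 1 + i - (j + 1), by omega⟩
  down i j m i' m' h h' _ := ⟨if i + 1 < j then n - 1 + (i + 1) - j
    else if i % 2 = 0 then n - 1 else n, by split_ifs <;> omega⟩
  origin := by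
    change (0 = 0 ∧ 0 + 1 < n ∧ 0 % 2 = 0 ∧ n = n) ∨ (0 = 0 ∧ 0 + 1 < n ∧ 0 % 2 = 1 ∧ n + 1 = n) ∨
      (0 < 0 ∧ 0 + 1 < n ∧ n + 1 + 0 = n + 0)
    omega
  preceding i j m h := by
    change _ ∨ (m ≠ n ∧ _) ∨ _
    by_cases hi : i = 0
    · by_cases hj : j = 0
      · exact Or.inl ⟨hi, hj⟩
      · by_cases hj' : j = 1
        · exact Or.inr (Or.inl ⟨by omega, 0, 0, n, by omega, by omega, by omega,
            cartanD_eq_neg_one (by omega), by intros; omega⟩)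
        · exact Or.inr (Or.inl ⟨by omega, i, j - 1, m + 1, by omega, by omega, by omega,
            cartanD_eq_neg_one (by omega), by intros; omega⟩)
    · by_cases hj : i = j
      · by_cases hi' : i = 1
        · exact Or.inr (Or.inl ⟨by omega, 0, 1, n - 2, by omega, by omega, by omega,
            cartanD_eq_neg_one (by omega), by intros; omega⟩)
        -- Labels on the main diagonal alternate between n and n - 1, so the preceding equal label
        -- is two steps up, with two boxes of label n - 2 in between.
        · exact Or.inr (Or.inr ⟨i - 2, j - 2, by omega, by omega, by omega, by omega, Or.inr
          ⟨i - 2, j - 1, n - 2, i - 1, j, n - 2, by omega, by omega, by omega, by omega,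
            cartanD_eq_neg_one (by omega), by omega, by omega, by omega, by omega,
            cartanD_eq_neg_one (by omega), by omega, by intros; omega⟩⟩)
      · by_cases hj' : i + 1 = j
        · have hpar : (if i % 2 = 0 then n else n - 1) = n ∧ i % 2 = 0 ∨
            (if i % 2 = 0 then n else n - 1) = n - 1 ∧ i % 2 = 1 := by split_ifs <;> omega
          exact Or.inr (Or.inr ⟨i - 1, j - 1, by omega, by omega, by omega, by omega, Or.inr
          ⟨i - 1, j, m - 1, i, j - 1, if i % 2 = 0 then n else n - 1, by omega, by omega, by omega,
            by omega, cartanD_eq_neg_one (by omega), by omega, by omega, by omega, by omega,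
            cartanD_eq_neg_one (by omega), by omega, by intros; omega⟩⟩)
        · exact Or.inr (Or.inr ⟨i - 1, j - 1, by omega, by omega, by omega, by omega, Or.inr
          ⟨i - 1, j, m - 1, i, j - 1, m + 1, by omega, by omega, by omega, by omega,
            cartanD_eq_neg_one (by omega), by omega, by omega, by omega, by omega,
            cartanD_eq_neg_one (by omega), by omega, by intros; omega⟩⟩)
  last m h1 h2 := by
    change m ≤ n at h2
    by_cases hm : m + 2 ≤ n
    · refine ⟨m - 1, n - 2, by omega, m, n - 2, fun m₁ h => ?_, by intros; omega⟩
      exact (cartanD_eq_neg_one (by omega)).ge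
    · by_cases hp : (n % 2 = 0 ∧ m = n) ∨ (n % 2 = 1 ∧ m + 1 = n)
      -- This is the very last box, with nothing beyond it; (n, n) is a dummy position outside the
      -- diagram.
      · exact ⟨n - 2, n - 2, by omega, n, n, fun m₁ h => by omega, by intros; omega⟩
      · exact ⟨n - 3, n - 3, by omega, n - 3, n - 2,
          fun m₁ h => (cartanD_eq_neg_one (by omega)).ge, by intros; omega⟩
  label_diag := by intros; omega
  label_row := by intros; omega
  label_col := by intros; omega
  above_row i j i' j' m m' h1 h2 h3 _ _ _ := ⟨by omega, n - 1 + i' - (j' + 1), by omega⟩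
  right_col i j i' j' m m' h1 h2 h3 _ _ _ := ⟨by omega, n - 1 + i - (j + 1), by omega⟩

set_option maxHeartbeats 4000000 in
/-- The diagram of `D_n / D_{n-1}`. -/
def localDiagramDD (n : ℕ) (hn : 3 ≤ n) : LocalDiagram (.DD n hn) where
  a := cartanD n
  S i j m := (i = 0 ∧ j + 2 < n ∧ m = j + 1) ∨ (i = 0 ∧ j + 2 = n ∧ m = n) ∨
    (i = 1 ∧ j + 3 = n ∧ m + 1 = n) ∨ (0 < i ∧ i + 1 < n ∧ j + 2 = n ∧ m + i + 1 = n)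
  spec i j m := by
    simp only [HermitianType.entry]
    split_ifs <;> omega
  bound i j m h := by
    simp only [HermitianType.rank]
    omega
  a_diag := cartanD_self n
  a_cases := fun i j hij => (cartanD_cases n i j hij).imp_right Or.inl
  near m m' := m = m' ∨ (m + 1 = m' ∧ m' < n) ∨ (m' + 1 = m ∧ m < n) ∨ (m + 2 = m' ∧ m' = n) ∨
    (m' + 2 = m ∧ m = n)
  near_of_ne m m' := cartanD_near
  neg_of_vertical i j m m' h h' := ⟨cartanD_neg (by omega), cartanD_neg (by omega)⟩
  neg_of_horizontal i j m m' h h' := ⟨cartanD_neg (by omega), cartanD_neg (by omega)⟩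
  comparable := by intros; omega
  up i j m i' j' m' h h' _ _ := ⟨if 0 < i' then n - 1 - i' else if j' + 2 = n then n else j' + 1, by
    split_ifs <;> omega⟩
  left i j m j' m' h h' _ := ⟨if 0 < i then n - 1 else j' + 1, by split_ifs <;> omega⟩
  right i j m i' j' m' h h' _ _ := ⟨if 0 < i then n - 2 else if j + 3 = n then n else j + 2, by
    split_ifs <;> omega⟩
  down i j m i' m' h h' _ := ⟨if j + 3 = n then n - 1 else n - 1 - (i + 1), by split_ifs <;> omega⟩
  origin := by
    change (0 = 0 ∧ 0 + 2 < n ∧ 1 = 0 + 1) ∨ (0 = 0 ∧ 0 + 2 = n ∧ 1 = n) ∨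
      (0 = 1 ∧ 0 + 3 = n ∧ 1 + 1 = n) ∨ (0 < 0 ∧ 0 + 1 < n ∧ 0 + 2 = n ∧ 1 + 0 + 1 = n)
    omega
  preceding i j m h := by
    change _ ∨ (m ≠ 1 ∧ _) ∨ _
    by_cases hi : i = 0
    · by_cases hj : j = 0
      · exact Or.inl ⟨hi, hj⟩
      · exact Or.inr (Or.inl ⟨by omega, i, j - 1, j, by omega, by omega, by omega,
          cartanD_eq_neg_one (by omega), by intros; omega⟩)
    · by_cases hj : j + 3 = n
      · exact Or.inr (Or.inl ⟨by omega, 0, j, j + 1, by omega, by omega, by omega,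
          cartanD_eq_neg_one (by omega), by intros; omega⟩)
      · by_cases hi' : i = 1
        · exact Or.inr (Or.inr ⟨0, j - 1, by omega, by omega, by omega, by omega, Or.inr
          ⟨0, j, n, i, j - 1, n - 1, by omega, by omega, by omega, by omega,
            cartanD_eq_neg_one (by omega), by omega, by omega, by omega, by omega,
            cartanD_eq_neg_one (by omega), by omega, by intros; omega⟩⟩)
        · exact Or.inr (Or.inr ⟨0, m - 1, by omega, by omega, by omega, by omega, Or.inr
          ⟨0, m, m + 1, i - 1, j, m + 1, by omega, by omega, by omega, by omega,
            cartanD_eq_neg_one (by omega), by omega, by omega, by omega, by omega,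
            cartanD_eq_neg_one (by omega), by omega, by intros; omega⟩⟩)
  last m h1 h2 := by
    change m ≤ n at h2
    by_cases hm : m + 2 ≤ n
    · exact ⟨n - 1 - m, n - 2, by omega, n - m, n - 2,
        fun m₁ h => (cartanD_eq_neg_one (by omega)).ge, by intros; omega⟩
    · by_cases hp : m = n
      · exact ⟨0, n - 2, by omega, 1, n - 2,
          fun m₁ h => (cartanD_eq_neg_one (by omega)).ge, by intros; omega⟩
      · exact ⟨1, n - 3, by omega, 1, n - 2,
          fun m₁ h => (cartanD_eq_neg_one (by omega)).ge, by intros; omega⟩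
  label_diag := by intros; omega
  label_row := by intros; omega
  label_col := by intros; omega
  -- Below the first row, horizontally adjacent boxes occur only in the 2 × 2 square; its upper
  -- right box, of label n, is the witness here and in `right_col`.
  above_row i j i' j' m m' h1 h2 h3 _ _ _ := ⟨by omega, n, by omega⟩
  right_col i j i' j' m m' h1 h2 h3 _ _ _ := ⟨by omega, n, by omega⟩

/-- The heap of a Hermitian quotient. -/
def diagramHeap : (t : HermitianType) → DiagramHeap t
  | .A n p hp hpn => (localDiagramA n p hp hpn).toDiagramHeap
  | .B n hn => (localDiagramB n hn).toDiagramHeap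
  | .C n hn => (localDiagramC n hn).toDiagramHeap
  | .DA n hn => (localDiagramDA n hn).toDiagramHeap
  | .DD n hn => (localDiagramDD n hn).toDiagramHeap
  | .E6 => diagramHeapE6
  | .E7 => diagramHeapE7

/-! ### From diagrams and reading words to coset representatives -/

namespace HermitianType

/-- The heap of a Hermitian quotient. -/
def heap (t : HermitianType) : MinusculeHeap t.coxeterMatrix := (diagramHeap t).toHeap

theorem mem_heap_boxes {t : HermitianType} {b : ℕ × ℕ} : b ∈ t.heap.boxes ↔ t.entry b ≠ 0 :=
  (diagramHeap t).mem_iff b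

theorem J_eq (t : HermitianType) : t.J = {i | i ≠ t.heap.weightSystem.k} := by
  ext i
  exact (DiagramHeap.eq_topNode_iff i).symm.not

theorem isSubdiagram_iff {t : HermitianType} {D : Finset (ℕ × ℕ)} :
    t.IsSubdiagram D ↔ t.heap.IsIdeal D := by
  refine and_congr ?_ ?_
  · exact forall₂_congr fun b _ => mem_heap_boxes.symm
  · exact forall₃_congr fun b _ c => by rw [mem_heap_boxes]

theorem readingWord_insert (t : HermitianType) {D : Finset (ℕ × ℕ)} {b : ℕ × ℕ}
    (hb : b ∉ D) (h : ∀ z ∈ D, toLex z ≤ toLex b) :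
    t.readingWord (insert b D) = t.readingWord D ++ [t.label b] := by
  have hmem : ∀ z, z ∈ (D.map (toLex : ℕ × ℕ ≃ ℕ ×ₗ ℕ).toEmbedding) ↔ ofLex z ∈ D := by
    intro z
    rw [Finset.mem_map_equiv]
    rfl
  have hsort : ((insert b D).map (toLex : ℕ × ℕ ≃ ℕ ×ₗ ℕ).toEmbedding).sort (· ≤ ·) =
      (D.map (toLex : ℕ × ℕ ≃ ℕ ×ₗ ℕ).toEmbedding).sort (· ≤ ·) ++ [toLex b] := by
    have hnd : ((D.map (toLex : ℕ × ℕ ≃ ℕ ×ₗ ℕ).toEmbedding).sort (· ≤ ·) ++ [toLex b]).Nodup := by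
      rw [List.nodup_append']
      refine ⟨Finset.sort_nodup _ _, List.nodup_singleton _, ?_⟩
      rw [List.disjoint_singleton, Finset.mem_sort, hmem]
      exact hb
    have h1 := (List.toFinset_sort (r := (· ≤ ·)) hnd).mpr (by
      rw [List.pairwise_append]
      refine ⟨Finset.pairwise_sort _ _, List.pairwise_singleton _ _, ?_⟩
      intro z hz w hw
      rw [Finset.mem_sort, hmem] at hz
      rw [List.mem_singleton] at hw
      subst hw
      exact h _ hz)
    rw [← h1]
    congr 1
    ext z
    rw [List.mem_toFinset, List.mem_append, Finset.mem_sort, List.mem_singleton, hmem,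
      Finset.mem_map_equiv, Finset.mem_insert, or_comm]
    exact Iff.rfl
  rw [readingWord, hsort, List.map_append]
  rfl

variable {W : Type*} [Group W]

theorem isRep_readingWord (t : HermitianType) (cs : CoxeterSystem t.coxeterMatrix W)
    {D : Finset (ℕ × ℕ)} (hD : t.heap.IsIdeal D) :
    t.heap.weightSystem.IsRep cs (t.heap.count D) (cs.wordProd (t.readingWord D))⁻¹ := by
  induction D using Finset.induction_on_max_value (toLex : ℕ × ℕ → ℕ ×ₗ ℕ) with
  | empty =>
    have h1 : t.heap.count ∅ = 0 := by simp [MinusculeHeap.count]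
    have h2 : t.readingWord ∅ = [] := by simp [readingWord]
    rw [h1, h2, CoxeterSystem.wordProd_nil, inv_one]
    exact WeightSystem.Reach.zero
  | insert b D hb hmax ih =>
    have hrem : MinusculeHeap.Removable (insert b D) b := by
      refine ⟨Finset.mem_insert_self _ _, fun z hz hlt => ?_⟩
      rcases Finset.mem_insert.mp hz with rfl | hz
      · exact lt_irrefl _ hlt
      -- The reading order refines the order of boxes, so the box read last is maximal in the ideal.
      · exact absurd (Prod.Lex.toLex_strictMono hlt) (not_lt_of_ge (hmax z hz))
    have hD' : t.heap.IsIdeal D := by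
      have := hD.erase hrem
      rwa [Finset.erase_insert hb] at this
    have hadd : t.heap.Addable D b := by
      refine ⟨hD.1 (Finset.mem_insert_self _ _), hb, fun z hz hlt => ?_⟩
      exact Finset.mem_of_mem_insert_of_ne
        (hD.2 b (Finset.mem_insert_self _ _) z hz hlt.le) hlt.ne
    have h := WeightSystem.Reach.step _ _ (t.heap.label b) (ih hD')
      ((MinusculeHeap.wt_weightSystem _ _).trans (hD'.wt_of_addable hadd))
    rw [← MinusculeHeap.count_insert hb] at h
    -- The inverse turns the last letter read into a left factor, which is a lowering step.
    rw [readingWord_insert t hb hmax, CoxeterSystem.wordProd_append,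
      CoxeterSystem.wordProd_singleton, mul_inv_rev, CoxeterSystem.inv_simple]
    exact h

variable {t : HermitianType} {cs : CoxeterSystem t.coxeterMatrix W} {u v : W}
  {M L D : Finset (ℕ × ℕ)}

theorem IsDiagramOf.isIdeal (h : t.IsDiagramOf cs D u) : t.heap.IsIdeal D :=
  isSubdiagram_iff.mp h.1

theorem IsDiagramOf.isRep (h : t.IsDiagramOf cs D u) :
    t.heap.weightSystem.IsRep cs (t.heap.count D) u := by
  rw [h.2]
  exact isRep_readingWord t cs h.isIdeal

theorem IsSkewDiagram.subset (h : t.IsSkewDiagram cs u v M L) : M ⊆ L :=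
  h.right_diagram.isIdeal.subset_of_count_le h.left_diagram.isIdeal
    (h.left_diagram.isRep.le_of_bruhatLE h.right_diagram.isRep h.lt.1)

theorem IsSkewDiagram.nonempty (h : t.IsSkewDiagram cs u v M L) : (L \ M).Nonempty := by
  rw [Finset.sdiff_nonempty]
  intro hsub
  apply h.lt.2
  rw [h.left_diagram.2, h.right_diagram.2, h.subset.antisymm hsub]

theorem IsSkewDiagram.relR_eq (h : t.IsSkewDiagram cs u v M L) :
    relR cs t.J u v = t.heap.relRIdeal M L := by
  obtain ⟨f, hf⟩ := MinusculeHeap.exists_isRVector h.right_diagram.isIdeal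
  rw [MinusculeHeap.relRIdeal_eq h.left_diagram.isIdeal h.right_diagram.isIdeal hf, J_eq,
    h.right_diagram.isRep.relR_eq h.left_diagram.isRep hf]

theorem isSkewDiagram_of_ssubset (cs : CoxeterSystem t.coxeterMatrix W) (hM : t.IsSubdiagram M)
    (hL : t.IsSubdiagram L) (h : M ⊂ L) : t.IsSkewDiagram cs (cs.wordProd (t.readingWord M))⁻¹
      (cs.wordProd (t.readingWord L))⁻¹ M L := by
  have hM' : t.IsDiagramOf cs M (cs.wordProd (t.readingWord M))⁻¹ := ⟨hM, rfl⟩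
  have hL' : t.IsDiagramOf cs L (cs.wordProd (t.readingWord L))⁻¹ := ⟨hL, rfl⟩
  refine ⟨?_, ?_, ⟨hM'.isRep.bruhatLE hL'.isRep (MinusculeHeap.count_mono h.1), fun he => ?_⟩,
    hM', hL'⟩
  · rw [J_eq]
    exact hM'.isRep.mem_minReps
  · rw [J_eq]
    exact hL'.isRep.mem_minReps
  -- Distinct ideals give distinct elements, because the action on the highest weight recovers the
  -- counts.
  · apply h.2
    apply hM'.isIdeal.subset_of_count_le hL'.isIdeal
    rw [← hM'.isRep.act_eq, ← hL'.isRep.act_eq, he]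

end HermitianType

/-! ### Standard skew shapes and their realisation in type A -/

theorem isConvexShape_of_isStandardSkew {S : Finset (ℕ × ℕ)} (h : IsStandardSkew S) :
    IsConvexShape S := by
  obtain ⟨l, m, -, a, b, hab⟩ := h
  rw [← isConvexShape_image_add (a := a), hab, isConvexShape_image_add]
  intro x hx y hy z hxz hzy
  rw [Finset.mem_sdiff, YoungDiagram.mem_cells, YoungDiagram.mem_cells] at *
  exact ⟨l.isLowerSet hzy hy.1, fun hz => hx.2 (m.isLowerSet hxz hz)⟩

/-- A convex set of boxes is a skew diagram of type `A`. -/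
theorem exists_isSkewDiagram_typeA {S : Finset (ℕ × ℕ)} (hS : IsConvexShape S)
    (hne : S.Nonempty) : ∃ (n p : ℕ) (hp : 1 ≤ p) (hpn : p ≤ n)
      (u v : (HermitianType.A n p hp hpn).coxeterMatrix.Group) (M L : Finset (ℕ × ℕ)),
      (HermitianType.A n p hp hpn).IsSkewDiagram
        (HermitianType.A n p hp hpn).coxeterMatrix.toCoxeterSystem u v M L ∧ L \ M = S := by
  -- The N × N square, which is the diagram for p = N and n = 2N - 1, contains S. Take the lower
  -- closure of S as upper ideal; removing S leaves an ideal by convexity.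
  set N := S.sup (fun z => max z.1 z.2) + 1 with hN
  have hle : ∀ z ∈ S, z.1 < N ∧ z.2 < N := by
    intro z hz
    have := Finset.le_sup (f := fun z : ℕ × ℕ => max z.1 z.2) hz
    omega
  set L := S.biUnion Finset.Iic with hLdef
  have hL : ∀ z, z ∈ L ↔ ∃ s ∈ S, z ≤ s := by
    intro z
    simp [hLdef]
  have hSL : S ⊆ L := fun z hz => (hL z).mpr ⟨z, hz, le_rfl⟩
  have hbox : ∀ z ∈ L, (HermitianType.A (2 * N - 1) N (by omega) (by omega)).entry z ≠ 0 := by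
    intro z hz
    obtain ⟨s, hs, hzs⟩ := (hL z).mp hz
    have h1 := hle s hs
    have h2 := Prod.le_def.mp hzs
    simp only [HermitianType.entry]
    rw [if_pos (by omega)]
    omega
  refine ⟨2 * N - 1, N, by omega, by omega, _, _, L \ S, L,
    HermitianType.isSkewDiagram_of_ssubset _ ⟨fun b hb => hbox b (Finset.mem_sdiff.mp hb).1, ?_⟩
      ⟨hbox, ?_⟩ ?_, ?_⟩
  · intro b hb c _ hcb
    rw [Finset.mem_sdiff, hL] at hb ⊢
    obtain ⟨⟨s, hs, hbs⟩, hbS⟩ := hb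
    exact ⟨⟨s, hs, hcb.trans hbs⟩, fun hcS => hbS (hS c hcS s hs b hcb hbs)⟩
  · intro b hb c _ hcb
    rw [hL] at hb ⊢
    obtain ⟨s, hs, hbs⟩ := hb
    exact ⟨s, hs, hcb.trans hbs⟩
  · exact Finset.sdiff_ssubset hSL hne
  · rw [Finset.sdiff_sdiff_eq_self hSL]

end HermitianSkew

theorem mainTheorem8 (t : HermitianSkew.HermitianType) {W : Type*} [Group W]
    (cs : CoxeterSystem t.coxeterMatrix W) (u v : W) (M L : Finset (ℕ × ℕ))
    (hML : t.IsSkewDiagram cs u v M L) (hstd : HermitianSkew.IsStandardSkew (L \ M)) :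
    (∃ (n p : ℕ) (hp : 1 ≤ p) (hpn : p ≤ n)
      (u' v' : (HermitianSkew.HermitianType.A n p hp hpn).coxeterMatrix.Group)
      (M' L' : Finset (ℕ × ℕ)),
      (HermitianSkew.HermitianType.A n p hp hpn).IsSkewDiagram
        (HermitianSkew.HermitianType.A n p hp hpn).coxeterMatrix.toCoxeterSystem u' v' M' L' ∧
      HermitianSkew.SameShape (L \ M) (L' \ M')) ∧
    (∀ (n p : ℕ) (hp : 1 ≤ p) (hpn : p ≤ n) (W' : Type*) [Group W']
      (cs' : CoxeterSystem (HermitianSkew.HermitianType.A n p hp hpn).coxeterMatrix W')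
      (u' v' : W') (M' L' : Finset (ℕ × ℕ)),
      (HermitianSkew.HermitianType.A n p hp hpn).IsSkewDiagram cs' u' v' M' L' →
      HermitianSkew.SameShape (L \ M) (L' \ M') →
      HermitianSkew.relR cs t.J u v =
        HermitianSkew.relR cs' (HermitianSkew.HermitianType.A n p hp hpn).J u' v') := by
  have hconv := HermitianSkew.isConvexShape_of_isStandardSkew hstd
  constructor
  · obtain ⟨n, p, hp, hpn, u', v', M', L', h, heq⟩ :=
      HermitianSkew.exists_isSkewDiagram_typeA hconv hML.nonempty
    exact ⟨n, p, hp, hpn, u', v', M', L', h, 0, 0, by rw [heq]⟩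
  · rintro n p hp hpn W' _ cs' u' v' M' L' h ⟨a, b, hab⟩
    rw [hML.relR_eq, h.relR_eq]
    exact HermitianSkew.relRIdeal_eq_of_shape _ _ hML.left_diagram.isIdeal
      hML.right_diagram.isIdeal hML.subset h.left_diagram.isIdeal h.right_diagram.isIdeal h.subset
      hab rfl (hab ▸ HermitianSkew.isConvexShape_image_add.mpr hconv)
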